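/- **Setting.** Let $\kappa>0$ and let $m=(m_j)_{j\in\mathbb N}$ be a non-increasing sequence of positive numbers with exponential decay at rate $\kappa$, that is, for some $M$, $m_j\le M e^{-\kappa(j-i)}m_i$ for all $i\le j$. Let $\ell_\infty$ be the space of bounded complex sequences with the supremum norm, and for $\rho,\sigma>0$ let $$\mathcal Q_{\rho,\sigma}=\{(\varphi,J):\ \varphi\in\ell_\infty/(\ell_\infty\cap 2\pi\mathbb Z^{\mathbb N}),\ J\in\ell_\infty,\ |\mathrm{Im}\,\varphi|_\infty<\sigma,\ |J|_\infty<\rho\}.$$ For finitely supported $l\in\mathbb Z^{\mathbb N}$ and $\alpha\in\mathbb Z_{\ge0}^{\mathbb N}$ consider the monomials $J^\alpha e^{i l\cdot\varphi}$. If $h(\varphi,J)=\sum_{l,\alpha}h^{[l]}_\alpha J^\alpha e^{i l\cdot\varphi}$ with absolute convergence on $\mathcal Q_{\rho,\sigma}$ (the coefficients are then unique), put, for finite $A\subset\mathbb N$, $|h_A|_{\rho,\sigma}=\sum_{\mathrm{supp}(|l|+\alpha)=A}|h^{[l]}_\alpha|\rho^{|\alpha|_1}e^{\sigma|l|_1}$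 and, for $\beta\in(0,1)$, $$\|h\|_{\beta,\rho,\sigma}=\sup_{j}\frac1{m_j}\sum_{A:\ \overline A=j}\Big(\prod_{i\in A\setminus\{\overline A\}}m_i\Big)^{-\beta}|h_A|_{\rho,\sigma},\qquad \overline A=\max A,$$ where $\overline\emptyset$ is, by convention, the first index; if $h$ has no such expansion, $\|h\|_{\beta,\rho,\sigma}=\infty$. For an open set $O\subset\ell_\infty$, $\mathcal Y_{\beta,\rho,\sigma,O}$ is the space of bounded holomorphic $h:\mathcal Q_{\rho,\sigma}\times O\to\mathbb C$ with $\|h\|_{\beta,\rho,\sigma,O}:=\sup_{\xi\in O}\|h(\cdot,\xi)\|_{\beta,\rho,\sigma}<\infty$. The Poisson bracket, at fixed $\xi$, is $$\{h,g\}=\sum_j m_j^{-1}\big(\partial_{\varphi_j}h\,\partial_{J_j}g-\partial_{J_j}h\,\partial_{\varphi_j}g\big),$$ and $\phi^t_g$ is the flow of the Hamiltonian equations $\dot\varphi_j=m_j^{-1}\partial_{J_j}g$, $\dot J_j=-m_j^{-1}\partial_{\varphi_j}g$ (as an ordinary differential equation in the supremum norm, at fixed $\xi$). **Lemma (Poisson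 bracket and flow estimates).** For every $\beta_1\in(0,1)$ there is a constant $K>0$, depending only on $m$, $\kappa$ and $\beta_1$, with the following properties. Let $0<\beta\le\beta_1$, $0<\rho\le\rho_*$, $0<\sigma\le\sigma_*$, $0<r<\rho$, $0<s<\sigma$, let $O\subset\ell_\infty$ be open, and put $$C=K\max\{r^{-1}(\sigma_*-\sigma+s)^{-1},\ s^{-1}(\rho_*-\rho+r)^{-1}\}.$$ 1. The series defining $\{h,g\}$ converges absolutely on $\mathcal Q_{\rho-r,\sigma-s}\times O$ for $h\in\mathcal Y_{\beta,\rho,\sigma,O}$, $g\in\mathcal Y_{\beta,\rho_*,\sigma_*,O}$, and $(h,g)\mapsto\{h,g\}$ is a bilinear map $\mathcal Y_{\beta,\rho,\sigma,O}\times\mathcal Y_{\beta,\rho_*,\sigma_*,O}\to\mathcal Y_{\beta,\rho-r,\sigma-s,O}$ with $$\|\{h,g\}\|_{\beta,\rho-r,\sigma-s,O}\le C\,\|h\|_{\beta,\rho,\sigma,O}\,\|g\|_{\beta,\rho_*,\sigma_*,O}.$$ 2. Let $g\in\mathcal Y_{\beta,\rho_*,\sigma_*,O}$ and $C\|g\|_{\beta,\rho_*,\sigma_*,O}\le\frac12$.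 Then for all $\xi\in O$ the flow $\phi_g^t$, $0\le t\le1$, is defined on $\mathcal Q_{\rho-r,\sigma-s}$ with values in $\mathcal Q_{\rho,\sigma}$, and it is unique even among solutions with values in $\mathcal Q_{\rho_*,\sigma_*}$. For all $h\in\mathcal Y_{\beta,\rho,\sigma,O}$ and $t\in[0,1]$ we have $h\circ\phi^t_g\in\mathcal Y_{\beta,\rho-r,\sigma-s,O}$ and $$\|h\circ\phi^t_g\|_{\beta,\rho-r,\sigma-s,O}\le\big(1+2C\|g\|_{\beta,\rho_*,\sigma_*,O}\big)\|h\|_{\beta,\rho,\sigma,O}.$$ If moreover $h$ and $g$ are real-valued at real $(\varphi,J,\xi)$, then so are $\{h,g\}$ and $h\circ\phi_g^t$. -/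

import Mathlib

open scoped ENNReal

noncomputable section

namespace LongRange

/-- Complex bounded sequences with the supremum norm. -/
abbrev EllInf : Type := lp (fun _ : ℕ => ℂ) (⊤ : ℝ≥0∞)

/-- Pairs `(φ, J)` of an angle sequence and an action sequence. Angles are written in the universal
cover of the infinite torus; functions on the torus are functions that are `2π`-periodic in every
angle (see `IsAnglePeriodic`). -/
abbrev Phase : Type := EllInf × EllInf

/-- Positive, non-increasing masses with exponential decay at rate `κ`:
`m j ≤ M exp (-κ (j - i)) m i` for all `i ≤ j`. -/
def IsMassSequence (κ : ℝ) (m : ℕ → ℝ) : Prop :=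
  (∀ i, 0 < m i) ∧ Antitone m ∧
    ∃ M : ℝ, ∀ i j : ℕ, i ≤ j → m j ≤ M * Real.exp (-κ * ((j : ℝ) - (i : ℝ))) * m i

/-- The domain `|Im φ|_∞ < σ`, `|J|_∞ < ρ`. -/
def domainQ (ρ σ : ℝ) : Set Phase :=
  {x | (⨆ n : ℕ, |(x.1 n).im|) < σ ∧ ‖x.2‖ < ρ}

/-- Indices `(l, α)` of the Taylor-Fourier monomials: finitely supported integer vectors `l` and
finitely supported exponents `α`. -/
abbrev MonoIndex : Type := (ℕ →₀ ℤ) × (ℕ →₀ ℕ)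

/-- The support `supp (|l| + α)` of a monomial. -/
def monoSupport (p : MonoIndex) : Finset ℕ := p.1.support ∪ p.2.support

/-- The monomial `J ^ α * exp (i l · φ)`. -/
def monomialFun (p : MonoIndex) (x : Phase) : ℂ :=
  (p.2.prod fun n k => x.2 n ^ k) *
    Complex.exp (Complex.I * p.1.sum fun n k => (k : ℂ) * x.1 n)

/-- `|α|_1`. -/
def exponentSize (α : ℕ →₀ ℕ) : ℕ := α.sum fun _ k => k

/-- `|l|_1`. -/
def frequencySize (l : ℕ →₀ ℤ) : ℕ := l.sum fun _ k => k.natAbs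

/-- `|h_A|_{ρ,σ}`, the sum of `|c_{l,α}| ρ^{|α|_1} e^{σ |l|_1}` over the monomials with support
exactly `A`. -/
def blockNorm (ρ σ : ℝ) (c : MonoIndex → ℂ) (A : Finset ℕ) : ℝ≥0∞ :=
  ∑' p : {p : MonoIndex // monoSupport p = A},
    ENNReal.ofReal (‖c p.1‖ * ρ ^ exponentSize p.1.2 * Real.exp (σ * frequencySize p.1.1))

/-- The largest element of `A`. The empty set (constant functions) is put together with the
sets whose largest element is the first index. -/
def topIndex (A : Finset ℕ) : ℕ := A.sup id

/-- The product of the masses over `A` without its largest element. -/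
def lowerMass (m : ℕ → ℝ) (A : Finset ℕ) : ℝ := ∏ i ∈ A.erase (topIndex A), m i

/-- `sup_j m_j⁻¹ ∑_{max A = j} (m_{A \ max A})^{-β} |h_A|_{ρ,σ}` in terms of the coefficients. -/
def coeffNorm (m : ℕ → ℝ) (β ρ σ : ℝ) (c : MonoIndex → ℂ) : ℝ≥0∞ :=
  ⨆ j : ℕ, ENNReal.ofReal (m j)⁻¹ *
    ∑' A : {A : Finset ℕ // topIndex A = j},
      ENNReal.ofReal (lowerMass m A.1 ^ (-β)) * blockNorm ρ σ c A.1

/-- `c` is the family of Taylor-Fourier coefficients of `h` on the domain. Since sums in `ℂ` converge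
absolutely, such a family is unique if it exists. -/
def IsTaylorFourier (ρ σ : ℝ) (h : Phase → ℂ) (c : MonoIndex → ℂ) : Prop :=
  ∀ x ∈ domainQ ρ σ, HasSum (fun p => c p * monomialFun p x) (h x)

/-- The norm `‖h‖_{β,ρ,σ}`: the norm of the (unique) coefficient family of `h`, and `⊤` if `h` has
none. -/
def funNorm (m : ℕ → ℝ) (β ρ σ : ℝ) (h : Phase → ℂ) : ℝ≥0∞ :=
  ⨅ (c : MonoIndex → ℂ) (_ : IsTaylorFourier ρ σ h c), coeffNorm m β ρ σ c

/-- The norm `‖h‖_{β,ρ,σ,O}`, the supremum over the parameters of the norms of `h(·, ξ)`. -/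
def paramNorm (m : ℕ → ℝ) (β ρ σ : ℝ) (O : Set EllInf) (h : Phase → EllInf → ℂ) : ℝ≥0∞ :=
  ⨆ ξ ∈ O, funNorm m β ρ σ fun x => h x ξ

/-- `h` is a function of the angles modulo `2π`. -/
def IsAnglePeriodic (ρ σ : ℝ) (O : Set EllInf) (h : Phase → EllInf → ℂ) : Prop :=
  ∀ x ∈ domainQ ρ σ, ∀ ξ ∈ O, ∀ k : EllInf,
    (∀ n, ∃ z : ℤ, k n = 2 * (Real.pi : ℂ) * (z : ℂ)) → h (x.1 + k, x.2) ξ = h x ξ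

/-- The space `Y_{β,ρ,σ,O}`: bounded holomorphic functions on the product of the domain and `O`, of
finite norm. Only the values on this product matter. -/
def MemY (m : ℕ → ℝ) (β ρ σ : ℝ) (O : Set EllInf) (h : Phase → EllInf → ℂ) : Prop :=
  IsAnglePeriodic ρ σ O h ∧
  DifferentiableOn ℂ (fun y : Phase × EllInf => h y.1 y.2) (domainQ ρ σ ×ˢ O) ∧
  (∃ B : ℝ, ∀ x ∈ domainQ ρ σ, ∀ ξ ∈ O, ‖h x ξ‖ ≤ B) ∧
  paramNorm m β ρ σ O h < ⊤

/-- A sequence with real entries. -/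
def IsRealSeq (a : EllInf) : Prop := ∀ n, (a n).im = 0

/-- `h` takes real values at real arguments. -/
def IsRealOnReal (ρ σ : ℝ) (O : Set EllInf) (h : Phase → EllInf → ℂ) : Prop :=
  ∀ x ∈ domainQ ρ σ, ∀ ξ ∈ O, IsRealSeq x.1 → IsRealSeq x.2 → IsRealSeq ξ → (h x ξ).im = 0

/-- The partial derivative with respect to the `j`-th angle. -/
def dAngle (j : ℕ) (f : Phase → ℂ) (x : Phase) : ℂ :=
  fderiv ℂ f x (lp.single (⊤ : ℝ≥0∞) j (1 : ℂ), 0)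

/-- The partial derivative with respect to the `j`-th action. -/
def dAction (j : ℕ) (f : Phase → ℂ) (x : Phase) : ℂ :=
  fderiv ℂ f x (0, lp.single (⊤ : ℝ≥0∞) j (1 : ℂ))

/-- The `j`-th term of the Poisson bracket. -/
def bracketTerm (m : ℕ → ℝ) (f g : Phase → ℂ) (x : Phase) (j : ℕ) : ℂ :=
  ((m j)⁻¹ : ℂ) * (dAngle j f x * dAction j g x - dAction j f x * dAngle j g x)

/-- The Poisson bracket `{h, g}`, taken at fixed parameter. -/
def poisson (m : ℕ → ℝ) (h g : Phase → EllInf → ℂ) : Phase → EllInf → ℂ :=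
  fun x ξ => ∑' j, bracketTerm m (fun y => h y ξ) (fun y => g y ξ) x j

/-- `v` is the value at `x` of the Hamiltonian vector field of `g`: its `j`-th components are
`m_j⁻¹ ∂_{J_j} g` and `- m_j⁻¹ ∂_{φ_j} g`. -/
def IsHamVector (m : ℕ → ℝ) (g : Phase → ℂ) (x v : Phase) : Prop :=
  ∀ j, v.1 j = ((m j)⁻¹ : ℂ) * dAction j g x ∧ v.2 j = -(((m j)⁻¹ : ℂ) * dAngle j g x)

/-- `γ` is an integral curve on `[0, 1]`, inside `D`, of the Hamiltonian vector field of `g`, with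
`γ 0 = x`; the time derivative is taken in the norm of `Phase`. -/
def IsHamCurve (m : ℕ → ℝ) (g : Phase → ℂ) (D : Set Phase) (x : Phase) (γ : ℝ → Phase) : Prop :=
  γ 0 = x ∧ ∀ t ∈ Set.Icc (0 : ℝ) 1, γ t ∈ D ∧
    ∃ v : Phase, IsHamVector m g (γ t) v ∧ HasDerivWithinAt γ v (Set.Icc (0 : ℝ) 1) t

/-- `max {r⁻¹ (σ* - σ + s)⁻¹, s⁻¹ (ρ* - ρ + r)⁻¹}`. -/
def lossConst (r s ρ σ ρ' σ' : ℝ) : ℝ :=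
  max (r⁻¹ * (σ' - σ + s)⁻¹) (s⁻¹ * (ρ' - ρ + r)⁻¹)

end LongRange

end

open scoped ENNReal Topology NNReal

noncomputable section

namespace LongRange

/-! ### Bounded holomorphic functions on complex normed spaces -/

section Holomorphic
open Metric
variable {E : Type*} [NormedAddCommGroup E] [NormedSpace ℂ E]

/-! For nonempty `A` with maximum `a`, the reciprocal weight of a block is `m_a ^ (1 - β) * ∏_{n ∈
A} m_n ^ β`. Bracketing two monomials with supports `A`, `B` and maxima `a`, `b` in an index `i ∈ A
∩ B` gives a monomial whose support `E`, with maximum `e`, lies in `A ∪ B` and misses only indices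
of `A ∩ B`. The products over `A` and `B` combine into those over `A ∪ B` and over `A ∩ B ∋ i`.
Against the factor `m_i⁻¹` of the bracket there remains, up to a constant, `(m_a m_b / (m_i m_e)) ^
(1 - β)`. If `a ≠ b`, the larger of the two cannot be lost, so this is always bounded by a ratio of
two masses to the power `1 - β` (`MassBounds.blockMass_mul_le`), and exponential decay makes such
ratios summable in the numerator.

The derivatives are paid for by Cauchy estimates on coefficients. These retain the share of the
differentiated index in `|l|_1` or `|α|_1`; shares add up to at most one, so the sum over the index
costs only a constant. Together this gives the bracket estimate (`seriesNorm_bracket_le`,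
`memY_poisson`).

For the flow, the monomials containing `j` have total size `O(m_j)`, so the Hamiltonian field is
bounded in the supremum norm and locally Lipschitz; Picard iteration gives a curve that uses at most
half of the domain loss (`MemY.exists_isHamCurve`). Along it, differentiation is the bracket with
`g`, so `h ∘ φ^t` is the Lie series `∑ t^n / n! {…{h, g}…, g}` (`hasSum_lieSeries`). Spreading the
loss evenly over `n` brackets, while `g` is always measured on the large domain, bounds the `n`-fold
bracket by `(C n²)^n / n!`. With the `1 / n!` of the series and `n^n / n! ≤ e^n` this is a geometric
series (`memY_iterBracket`), and its sum is the stated bound.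

Norms are infima over coefficient families. Every estimate is proved for an arbitrary family and
then passed to the infimum, so uniqueness of the coefficients never enters. Holomorphy in the
parameter is obtained for the functions, not for the coefficients, as a locally uniform limit. -/

theorem norm_fderiv_le_of_norm_le {f : E → ℂ} {x : E} {R B : ℝ} (hR : 0 < R)
    (hf : DifferentiableOn ℂ f (ball x R)) (hB : ∀ y ∈ ball x R, ‖f y‖ ≤ B) :
    ‖fderiv ℂ f x‖ ≤ 2 * B / R := by
  refine Complex.norm_fderiv_le_div_of_mapsTo_ball hf (fun y hy => ?_) hR
  rw [mem_closedBall, dist_eq_norm]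
  have h1 := norm_sub_le (f y) (f x)
  have h2 := hB y hy
  have h3 := hB x (mem_ball_self hR)
  linarith

/-- On balls of half the distance to the boundary, Cauchy's estimate turns the summable bound on the
functions into one on their differentials, which permits termwise differentiation. -/
theorem hasFDerivAt_tsum_of_norm_le {ι : Type*} {f : ι → E → ℂ} {u : ι → ℝ} {U : Set E}
    (hU : IsOpen U) (hu : Summable u) (hf : ∀ n, DifferentiableOn ℂ (f n) U)
    (hfu : ∀ n, ∀ x ∈ U, ‖f n x‖ ≤ u n) {x : E} (hx : x ∈ U) :
    HasFDerivAt (fun y => ∑' n, f n y) (∑' n, fderiv ℂ (f n) x) x ∧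
      Summable fun n => ‖fderiv ℂ (f n) x‖ := by
  obtain ⟨R, hR, hRU⟩ := Metric.isOpen_iff.1 hU x hx
  have hR2 : 0 < R / 2 := by positivity
  have hsub : ∀ y ∈ ball x (R / 2), ball y (R / 2) ⊆ U := fun y hy z hz => hRU <| by
    rw [mem_ball] at *
    linarith [dist_triangle z y x]
  have hb : ∀ n, ∀ y ∈ ball x (R / 2), ‖fderiv ℂ (f n) y‖ ≤ 2 * u n / (R / 2) := fun n y hy =>
    norm_fderiv_le_of_norm_le hR2 ((hf n).mono (hsub y hy)) fun z hz => hfu n z (hsub y hy hz)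
  have hu' : Summable fun n => 2 * u n / (R / 2) := (hu.mul_left 2).div_const _
  refine ⟨hasFDerivAt_tsum_of_isPreconnected hu' isOpen_ball (convex_ball x (R / 2)).isPreconnected
    (fun n y hy => ?_) hb (mem_ball_self hR2) (hu.of_norm_bounded fun n => hfu n x hx)
    (mem_ball_self hR2), hu'.of_nonneg_of_le (fun _ => norm_nonneg _)
      fun n => hb n x (mem_ball_self hR2)⟩
  exact ((hf n).differentiableAt (hU.mem_nhds (hsub y hy (mem_ball_self hR2)))).hasFDerivAt

theorem differentiableOn_tsum_of_norm_le {ι : Type*} {f : ι → E → ℂ} {u : ι → ℝ} {U : Set E}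
    (hU : IsOpen U) (hu : Summable u) (hf : ∀ n, DifferentiableOn ℂ (f n) U)
    (hfu : ∀ n, ∀ x ∈ U, ‖f n x‖ ≤ u n) : DifferentiableOn ℂ (fun y => ∑' n, f n y) U :=
  fun _ hx => (hasFDerivAt_tsum_of_norm_le hU hu hf hfu hx).1.differentiableAt.differentiableWithinAt

/-- A quantitative first-order expansion of a bounded holomorphic function of one variable. -/
theorem norm_sub_sub_smul_deriv_le {φ : ℂ → ℂ} {R B : ℝ} (hR : 0 < R)
    (hφ : DifferentiableOn ℂ φ (ball 0 R)) (hB : ∀ z ∈ ball (0 : ℂ) R, ‖φ z‖ ≤ B) {z : ℂ}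
    (hz : z ∈ ball (0 : ℂ) R) : ‖φ z - φ 0 - z * deriv φ 0‖ ≤ 4 * B * (‖z‖ / R) ^ 2 := by
  have hd0 : DifferentiableAt ℂ φ 0 := hφ.differentiableAt (ball_mem_nhds _ hR)
  have hdB : ‖deriv φ 0‖ ≤ 2 * B / R := by
    rw [norm_deriv_eq_norm_fderiv]
    exact norm_fderiv_le_of_norm_le hR hφ hB
  have hder := hd0.hasDerivAt.isLittleO
  -- Schwarz lemma of second order: `φ w - w φ'(0) - φ 0` is `o(w)` at the origin and bounded by `B
  -- + B + 2B` on the disc.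
  have := Complex.dist_le_mul_div_pow_of_mapsTo_ball_of_isLittleO (f := fun w => φ w - w * deriv φ 0)
    (c := 0) (z := z) (R₁ := R) (R₂ := 4 * B) (n := 1) (hφ.sub (by fun_prop)) ?_ ?_ hz
  · simpa [dist_eq_norm, sub_right_comm] using this
  · intro w hw
    rw [mem_closedBall, dist_eq_norm]
    have h1 := hB w hw
    have h2 := hB 0 (mem_ball_self hR)
    have hw' : ‖w‖ ≤ R := by simpa using (mem_ball.1 hw).le
    have h3 : ‖w * deriv φ 0‖ ≤ 2 * B := by
      rw [norm_mul]
      calc ‖w‖ * ‖deriv φ 0‖ ≤ R * (2 * B / R) := by gcongr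
        _ = 2 * B := by field_simp
    calc ‖φ w - w * deriv φ 0 - (φ 0 - 0 * deriv φ 0)‖
        = ‖(φ w - φ 0) - w * deriv φ 0‖ := by congr 1; ring
      _ ≤ ‖φ w‖ + ‖φ 0‖ + ‖w * deriv φ 0‖ :=
          (norm_sub_le _ _).trans (add_le_add_left (norm_sub_le _ _) _)
      _ ≤ 4 * B := by linarith
  · have : (fun w : ℂ => φ w - w * deriv φ 0 - (φ 0 - 0 * deriv φ 0)) =
        fun w => φ w - φ 0 - (w - 0) • deriv φ 0 := by
      funext w; simp; ring
    rw [this]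
    refine hder.trans_isBigO ?_
    simpa using (Asymptotics.isBigO_refl (fun w : ℂ => w) (𝓝 0)).norm_right

/-- The directional derivatives of a holomorphic function are holomorphic. -/
theorem differentiableOn_fderiv_apply {f : E → ℂ} {U : Set E} (hU : IsOpen U)
    (hf : DifferentiableOn ℂ f U) (v : E) : DifferentiableOn ℂ (fun y => fderiv ℂ f y v) U := by
  intro x hx
  refine DifferentiableAt.differentiableWithinAt ?_
  have hcont : ContinuousAt f x := (hf.differentiableAt (hU.mem_nhds hx)).continuousAt
  obtain ⟨R, hR, hRU⟩ : ∃ R > 0, ball x R ⊆ U ∩ {y | ‖f y‖ < ‖f x‖ + 1} := by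
    refine Metric.mem_nhds_iff.1 (Filter.inter_mem (hU.mem_nhds hx) ?_)
    exact hcont.norm.eventually_lt_const (lt_add_one _)
  set B := ‖f x‖ + 1
  have hBpos : 0 ≤ B := by positivity
  -- Step sizes below `D` move a point of the half ball by at most `R / 2` in the direction `v`; the
  -- `+ 1` covers `v = 0`.
  set D : ℝ := R / 2 / (‖v‖ + 1) with hD
  have hv : 0 < ‖v‖ + 1 := by positivity
  have hDpos : 0 < D := by positivity
  have hDv : D * ‖v‖ ≤ R / 2 := by
    rw [hD, div_mul_eq_mul_div, div_le_iff₀ hv]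
    have : 0 < R / 2 := by positivity
    nlinarith [norm_nonneg v]
  have hmem : ∀ y ∈ ball x (R / 2), ∀ z ∈ ball (0 : ℂ) D, y + z • v ∈ ball x R := by
    intro y hy z hz
    rw [mem_ball, dist_eq_norm] at *
    have hz' : ‖z‖ ≤ D := by simpa using hz.le
    calc ‖y + z • v - x‖ ≤ ‖y - x‖ + ‖z • v‖ := by
          rw [add_sub_right_comm]; exact norm_add_le _ _
      _ < R / 2 + R / 2 := by
          refine add_lt_add_of_lt_of_le hy ?_
          rw [norm_smul]
          exact (mul_le_mul_of_nonneg_right hz' (norm_nonneg _)).trans hDv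
      _ = R := by ring
  -- With halving step sizes the difference quotients converge to the directional derivative with a
  -- uniform geometric error. The limit is then a telescoping, uniformly convergent series of
  -- holomorphic functions.
  let t : ℕ → ℂ := fun n => ((D / 2 * (1 / 2) ^ n : ℝ) : ℂ)
  have htn : ∀ n, ‖t n‖ = D / 2 * (1 / 2) ^ n := fun n => by
    rw [Complex.norm_real, Real.norm_of_nonneg (by positivity)]
  have ht0 : ∀ n, t n ≠ 0 := fun n => norm_pos_iff.1 (by rw [htn]; positivity)
  have htD : ∀ n, t n ∈ ball (0 : ℂ) D := fun n => by
    rw [mem_ball_zero_iff, htn]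
    have : (1 / 2 : ℝ) ^ n ≤ 1 := pow_le_one₀ (by norm_num) (by norm_num)
    nlinarith
  let q : ℕ → E → ℂ := fun n y => (t n)⁻¹ * (f (y + t n • v) - f y)
  have hq : ∀ n, ∀ y ∈ ball x (R / 2), ‖q n y - fderiv ℂ f y v‖ ≤ 2 * B / D * (1 / 2) ^ n := by
    intro n y hy
    have hy' : y ∈ ball x R := by simpa using hmem y hy 0 (mem_ball_self hDpos)
    have hline : HasDerivAt (fun z : ℂ => y + z • v) v 0 := by
      simpa using ((hasDerivAt_id (0 : ℂ)).smul_const v).const_add y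
    have hder : deriv (fun z : ℂ => f (y + z • v)) 0 = fderiv ℂ f y v := by
      have h1 : HasFDerivAt f (fderiv ℂ f y) (y + (0 : ℂ) • v) := by
        simpa using (hf.differentiableAt (hU.mem_nhds (hRU hy').1)).hasFDerivAt
      exact (h1.comp_hasDerivAt (0 : ℂ) hline).deriv
    have h := norm_sub_sub_smul_deriv_le (φ := fun z => f (y + z • v)) (B := B) hDpos
      (hf.comp (by fun_prop) fun z hz => (hRU (hmem y hy z hz)).1)
      (fun z hz => (hRU (hmem y hy z hz)).2.le) (htD n)
    rw [hder] at h
    simp only [zero_smul, add_zero] at h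
    have heq : q n y - fderiv ℂ f y v =
        (t n)⁻¹ * (f (y + t n • v) - f y - t n * fderiv ℂ f y v) := by
      simp only [q]; field_simp [ht0 n]
    rw [heq, norm_mul, norm_inv]
    calc ‖t n‖⁻¹ * ‖f (y + t n • v) - f y - t n * fderiv ℂ f y v‖
        ≤ ‖t n‖⁻¹ * (4 * B * (‖t n‖ / D) ^ 2) := by gcongr
      _ = 2 * B / D * (1 / 2) ^ n := by
          have := norm_pos_iff.2 (ht0 n)
          rw [htn n] at *
          field_simp
          ring
  have hlim : ∀ y ∈ ball x (R / 2), Filter.Tendsto (fun n => q n y) Filter.atTop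
      (𝓝 (fderiv ℂ f y v)) := fun y hy => by
    rw [tendsto_iff_norm_sub_tendsto_zero]
    refine squeeze_zero (fun _ => norm_nonneg _) (fun n => hq n y hy) ?_
    simpa using (tendsto_pow_atTop_nhds_zero_of_lt_one (r := (1 / 2 : ℝ)) (by norm_num)
      (by norm_num)).const_mul (2 * B / D)
  have hqd : ∀ n, DifferentiableOn ℂ (q n) (ball x (R / 2)) := by
    intro n
    refine DifferentiableOn.const_mul (DifferentiableOn.sub ?_ ?_) _
    · exact hf.comp (by fun_prop) fun y hy => (hRU (hmem y hy _ (htD n))).1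
    · exact hf.mono fun y hy => (hRU (by simpa using hmem y hy 0 (mem_ball_self hDpos))).1
  have hR2 : 0 < R / 2 := by positivity
  have hsum : Summable fun n : ℕ => 4 * B / D * (1 / 2 : ℝ) ^ n :=
    (summable_geometric_of_lt_one (by norm_num) (by norm_num)).mul_left _
  have hstep : ∀ n, ∀ y ∈ ball x (R / 2), ‖q (n + 1) y - q n y‖ ≤ 4 * B / D * (1 / 2) ^ n := by
    intro n y hy
    have h1 := hq n y hy
    have h2 := hq (n + 1) y hy
    have h3 : 2 * B / D * (1 / 2 : ℝ) ^ (n + 1) ≤ 2 * B / D * (1 / 2 : ℝ) ^ n := by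
      rw [pow_succ]
      have : 0 ≤ 2 * B / D * (1 / 2 : ℝ) ^ n := by positivity
      linarith
    calc ‖q (n + 1) y - q n y‖ = ‖(q (n + 1) y - fderiv ℂ f y v) - (q n y - fderiv ℂ f y v)‖ := by
          congr 1; ring
      _ ≤ _ := norm_sub_le _ _
      _ ≤ 2 * B / D * (1 / 2) ^ n + 2 * B / D * (1 / 2) ^ n := by linarith
      _ = _ := by ring
  have hser := differentiableOn_tsum_of_norm_le isOpen_ball hsum
    (fun n => (hqd (n + 1)).sub (hqd n)) hstep
  have heq : ∀ y ∈ ball x (R / 2), fderiv ℂ f y v = q 0 y + ∑' n, (q (n + 1) y - q n y) := by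
    intro y hy
    have hs : Summable fun n => q (n + 1) y - q n y := hsum.of_norm_bounded fun n => hstep n y hy
    have h1 := hs.hasSum.tendsto_sum_nat
    simp only [Finset.sum_range_sub (fun n => q n y)] at h1
    have h2 := (hlim y hy).sub_const (q 0 y)
    rw [tendsto_nhds_unique h1 h2]
    ring
  have := ((hqd 0).add hser).differentiableAt (ball_mem_nhds x hR2)
  refine this.congr_of_eventuallyEq ?_
  filter_upwards [ball_mem_nhds x hR2] with y hy using heq y hy

end Holomorphic

/-! ### Geometry of the domains -/

/-- The supremum of the absolute values of the imaginary parts. -/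
def imNorm (a : EllInf) : ℝ := ⨆ n : ℕ, |(a n).im|

theorem norm_coord_le (a : EllInf) (n : ℕ) : ‖a n‖ ≤ ‖a‖ :=
  lp.norm_apply_le_norm ENNReal.top_ne_zero a n

theorem bddAbove_abs_im (a : EllInf) : BddAbove (Set.range fun n => |(a n).im|) :=
  ⟨‖a‖, by rintro _ ⟨n, rfl⟩; exact (Complex.abs_im_le_norm _).trans (norm_coord_le a n)⟩

theorem abs_im_le_imNorm (a : EllInf) (n : ℕ) : |(a n).im| ≤ imNorm a :=
  le_ciSup (bddAbove_abs_im a) n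

theorem imNorm_nonneg (a : EllInf) : 0 ≤ imNorm a := (abs_nonneg _).trans (abs_im_le_imNorm a 0)

theorem imNorm_le {a : EllInf} {b : ℝ} (h : ∀ n, |(a n).im| ≤ b) : imNorm a ≤ b := ciSup_le h

theorem imNorm_add_le (a b : EllInf) : imNorm (a + b) ≤ imNorm a + imNorm b := by
  refine imNorm_le fun n => ?_
  have : (a + b) n = a n + b n := rfl
  rw [this, Complex.add_im]
  exact (abs_add_le _ _).trans (add_le_add (abs_im_le_imNorm a n) (abs_im_le_imNorm b n))

theorem imNorm_le_norm (a : EllInf) : imNorm a ≤ ‖a‖ :=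
  imNorm_le fun n => (Complex.abs_im_le_norm _).trans (norm_coord_le a n)

theorem imNorm_smul {t : ℝ} (ht : 0 ≤ t) (a : EllInf) : imNorm (t • a) ≤ t * imNorm a := by
  refine imNorm_le fun n => ?_
  have : (t • a) n = (t : ℂ) * a n := by simp
  rw [this, Complex.im_ofReal_mul, abs_mul, abs_of_nonneg ht]
  exact mul_le_mul_of_nonneg_left (abs_im_le_imNorm a n) ht

theorem imNorm_le_add_norm_sub (a b : EllInf) : imNorm a ≤ imNorm b + ‖a - b‖ := by
  have h := imNorm_add_le b (a - b)
  rw [add_sub_cancel] at h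
  exact h.trans (add_le_add_right (imNorm_le_norm _) _)

theorem continuous_imNorm : Continuous imNorm := by
  refine (LipschitzWith.of_le_add fun a b => ?_ : LipschitzWith 1 imNorm).continuous
  rw [dist_eq_norm]
  exact imNorm_le_add_norm_sub a b

theorem mem_domainQ {ρ σ : ℝ} {x : Phase} : x ∈ domainQ ρ σ ↔ imNorm x.1 < σ ∧ ‖x.2‖ < ρ := Iff.rfl

theorem isOpen_domainQ (ρ σ : ℝ) : IsOpen (domainQ ρ σ) :=
  (isOpen_lt (continuous_imNorm.comp continuous_fst) continuous_const).inter
    (isOpen_lt (continuous_norm.comp continuous_snd) continuous_const)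

theorem domainQ_mono {ρ σ ρ' σ' : ℝ} (hρ : ρ ≤ ρ') (hσ : σ ≤ σ') : domainQ ρ σ ⊆ domainQ ρ' σ' :=
  fun _ hx => ⟨hx.1.trans_le hσ, hx.2.trans_le hρ⟩

theorem convex_domainQ (ρ σ : ℝ) : Convex ℝ (domainQ ρ σ) := by
  intro x hx y hy a b ha hb hab
  rw [mem_domainQ] at *
  have key : ∀ u v w : ℝ, u < w → v < w → a * u + b * v < w := by
    intro u v w hu hv
    rcases ha.eq_or_lt with rfl | ha'
    · have : b = 1 := by linarith
      subst this; linarith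
    · have h1 := mul_lt_mul_of_pos_left hu ha'
      have h2 := mul_le_mul_of_nonneg_left hv.le hb
      have h3 : a * w + b * w = w := by rw [← add_mul, hab, one_mul]
      linarith
  constructor
  · refine ((imNorm_add_le _ _).trans (add_le_add (imNorm_smul ha x.1) (imNorm_smul hb y.1))).trans_lt
      (key _ _ _ hx.1 hy.1)
  · refine (norm_add_le (a • x.2) (b • y.2)).trans_lt ?_
    rw [norm_smul, norm_smul, Real.norm_of_nonneg ha, Real.norm_of_nonneg hb]
    exact key _ _ _ hx.2 hy.2

theorem ball_subset_domainQ {ρ σ δ : ℝ} {x : Phase} (hx : x ∈ domainQ ρ σ) :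
    Metric.ball x δ ⊆ domainQ (ρ + δ) (σ + δ) := by
  intro y hy
  rw [Metric.mem_ball, dist_eq_norm] at hy
  have h1 : ‖y.1 - x.1‖ ≤ ‖y - x‖ := norm_fst_le (y - x)
  have h2 : ‖y.2 - x.2‖ ≤ ‖y - x‖ := norm_snd_le (y - x)
  have h3 := imNorm_le_add_norm_sub y.1 x.1
  have h4 := norm_le_norm_add_norm_sub' y.2 x.2
  have h5 := mem_domainQ.1 hx
  exact mem_domainQ.2 ⟨by linarith, by linarith⟩

/-- A point of the open domain lies in a slightly smaller domain. -/
theorem exists_mem_smaller_domainQ {ρ σ : ℝ} {x : Phase} (hx : x ∈ domainQ ρ σ) :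
    ∃ δ > 0, x ∈ domainQ (ρ - δ) (σ - δ) ∧ δ < ρ ∧ δ < σ := by
  obtain ⟨h1, h2⟩ := mem_domainQ.1 hx
  have h3 := norm_nonneg x.2
  have h4 := imNorm_nonneg x.1
  refine ⟨min (σ - imNorm x.1) (ρ - ‖x.2‖) / 2, ?_, ⟨?_, ?_⟩, ?_, ?_⟩
  · have := lt_min (sub_pos.2 h1) (sub_pos.2 h2); linarith
  · have := min_le_left (σ - imNorm x.1) (ρ - ‖x.2‖)
    change imNorm x.1 < _
    linarith
  all_goals
    have := min_le_right (σ - imNorm x.1) (ρ - ‖x.2‖)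
    have := min_le_left (σ - imNorm x.1) (ρ - ‖x.2‖)
    linarith

/-! ### Monomials, their derivatives and Cauchy estimates -/

/-- Coordinate evaluation. -/
def coordCLM (n : ℕ) : EllInf →L[ℂ] ℂ :=
  lp.evalCLM ℂ (fun _ : ℕ => ℂ) ⊤ n

@[simp] theorem coordCLM_apply (n : ℕ) (a : EllInf) : coordCLM n a = a n := rfl

theorem single_one_apply (j n : ℕ) :
    (lp.single (⊤ : ℝ≥0∞) j (1 : ℂ) : EllInf) n = if n = j then 1 else 0 := by
  rw [lp.single_apply]
  by_cases h : n = j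
  · subst h; simp
  · simp [h]

/-- The weight `ρ ^ |α|_1 * exp (σ |l|_1)` of a monomial, which bounds it on the domain. -/
def monoNorm (ρ σ : ℝ) (p : MonoIndex) : ℝ :=
  ρ ^ exponentSize p.2 * Real.exp (σ * frequencySize p.1)

theorem monoNorm_nonneg {ρ σ : ℝ} (hρ : 0 ≤ ρ) (p : MonoIndex) : 0 ≤ monoNorm ρ σ p := by
  unfold monoNorm; positivity

theorem monoNorm_mono {ρ σ ρ' σ' : ℝ} (hρ : 0 ≤ ρ) (h : ρ ≤ ρ') (h' : σ ≤ σ') (p : MonoIndex) :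
    monoNorm ρ σ p ≤ monoNorm ρ' σ' p := by
  have : 0 ≤ ρ' := hρ.trans h
  unfold monoNorm; gcongr

theorem norm_monomialFun_le {ρ σ : ℝ} {x : Phase} (hx : x ∈ domainQ ρ σ) (p : MonoIndex) :
    ‖monomialFun p x‖ ≤ monoNorm ρ σ p := by
  obtain ⟨h1, h2⟩ := mem_domainQ.1 hx
  unfold monomialFun monoNorm exponentSize frequencySize
  rw [norm_mul]
  have hρ : 0 ≤ ρ := (norm_nonneg _).trans h2.le
  refine mul_le_mul ?_ ?_ (norm_nonneg _) (by positivity)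
  · rw [Finsupp.prod, Finsupp.sum, ← Finset.prod_pow_eq_pow_sum, norm_prod]
    refine Finset.prod_le_prod (fun _ _ => norm_nonneg _) fun n _ => ?_
    rw [norm_pow]
    exact pow_le_pow_left₀ (norm_nonneg _) ((norm_coord_le _ _).trans h2.le) _
  · rw [Complex.norm_exp, Finsupp.sum, Finsupp.sum, Real.exp_le_exp, Complex.I_mul_re, Complex.im_sum,
      ← Finset.sum_neg_distrib, Nat.cast_sum, Finset.mul_sum]
    refine Finset.sum_le_sum fun n _ => ?_
    have h3 : ((p.1 n : ℂ) * x.1 n).im = (p.1 n : ℝ) * (x.1 n).im := by simp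
    rw [h3]
    have h4 : |(x.1 n).im| ≤ σ := (abs_im_le_imNorm _ _).trans h1.le
    calc -((p.1 n : ℝ) * (x.1 n).im) ≤ |(p.1 n : ℝ) * (x.1 n).im| := neg_le_abs _
      _ = |(x.1 n).im| * |(p.1 n : ℝ)| := by rw [abs_mul, mul_comm]
      _ ≤ σ * |(p.1 n : ℝ)| := by gcongr
      _ = σ * ((p.1 n).natAbs : ℕ) := by
          rw [Nat.cast_natAbs, Int.cast_abs]

/-- The derivative of a monomial with respect to the `j`-th angle. -/
def monoAngle (j : ℕ) (p : MonoIndex) (x : Phase) : ℂ := Complex.I * (p.1 j : ℂ) * monomialFun p x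

/-- The derivative of a monomial with respect to the `j`-th action. -/
def monoAction (j : ℕ) (p : MonoIndex) (x : Phase) : ℂ :=
  (p.2 j : ℂ) * monomialFun (p.1, p.2 - Finsupp.single j 1) x

/-- A monomial depends on finitely many coordinates, so its differential on all of `ℓ_∞` is a finite
sum of partial derivatives. For general functions this fails, the coordinate vectors not having
dense span. -/
theorem hasFDerivAt_monomialFun (p : MonoIndex) (x : Phase) :
    ∃ T : Phase →L[ℂ] ℂ, HasFDerivAt (monomialFun p) T x ∧
      ∀ v : Phase, T v = ∑ j ∈ monoSupport p, (monoAngle j p x * v.1 j + monoAction j p x * v.2 j) := by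
  have hJ : ∀ n, HasFDerivAt (fun y : Phase => y.2 n ^ p.2 n)
      ((p.2 n * x.2 n ^ (p.2 n - 1) : ℂ) • (coordCLM n).comp (ContinuousLinearMap.snd ℂ EllInf EllInf))
      x := fun n => by
    have := (hasDerivAt_pow (p.2 n) (x.2 n)).comp_hasFDerivAt x
      ((coordCLM n).comp (ContinuousLinearMap.snd ℂ EllInf EllInf)).hasFDerivAt
    simpa [Function.comp_def] using this
  have hA := HasFDerivAt.finsetProd (u := p.2.support) fun n _ => hJ n
  have hl : HasFDerivAt (fun y : Phase => ∑ n ∈ p.1.support, (p.1 n : ℂ) * y.1 n)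
      (∑ n ∈ p.1.support, (p.1 n : ℂ) •
        (coordCLM n).comp (ContinuousLinearMap.fst ℂ EllInf EllInf)) x := by
    refine HasFDerivAt.fun_sum fun n _ => ?_
    exact ((coordCLM n).comp (ContinuousLinearMap.fst ℂ EllInf EllInf)).hasFDerivAt.const_mul _
  have hE := (hl.const_mul Complex.I).cexp
  refine ⟨_, hA.mul hE, fun v => ?_⟩
  have e1 : ∑ j ∈ monoSupport p, monoAngle j p x * v.1 j =
      ∑ j ∈ p.1.support, monoAngle j p x * v.1 j := by
    symm
    refine Finset.sum_subset Finset.subset_union_left fun j _ hj => ?_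
    simp [monoAngle, Finsupp.notMem_support_iff.1 hj]
  have e2 : ∑ j ∈ monoSupport p, monoAction j p x * v.2 j =
      ∑ j ∈ p.2.support, monoAction j p x * v.2 j := by
    symm
    refine Finset.sum_subset Finset.subset_union_right fun j _ hj => ?_
    simp [monoAction, Finsupp.notMem_support_iff.1 hj]
  rw [Finset.sum_add_distrib, e1, e2]
  have e3 : ∀ j ∈ p.2.support, monoAction j p x = (p.2 j * x.2 j ^ (p.2 j - 1) *
      ∏ n ∈ p.2.support.erase j, x.2 n ^ p.2 n) *
        Complex.exp (Complex.I * ∑ n ∈ p.1.support, (p.1 n : ℂ) * x.1 n) := by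
    intro j hj
    unfold monoAction monomialFun
    rw [Finsupp.prod_of_support_subset (s := p.2.support) _ (Finsupp.support_tsub) _ (by simp),
      ← Finset.mul_prod_erase _ _ hj, Finsupp.sum, ← mul_assoc]
    congr 1
    rw [mul_assoc]
    congr 2
    · simp
    · refine Finset.prod_congr rfl fun n hn => ?_
      rw [Finsupp.tsub_apply, Finsupp.single_eq_of_ne (Finset.ne_of_mem_erase hn), Nat.sub_zero]
  have e4 : ∑ j ∈ p.2.support, monoAction j p x * v.2 j =
      ∑ j ∈ p.2.support, (p.2 j * x.2 j ^ (p.2 j - 1) *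
        ∏ n ∈ p.2.support.erase j, x.2 n ^ p.2 n) *
          Complex.exp (Complex.I * ∑ n ∈ p.1.support, (p.1 n : ℂ) * x.1 n) * v.2 j :=
    Finset.sum_congr rfl fun j hj => by rw [e3 j hj]
  rw [e4]
  simp only [monoAngle, monomialFun, Finsupp.prod, Finsupp.sum, add_apply,
    smul_apply, sum_apply, ContinuousLinearMap.comp_apply,
    ContinuousLinearMap.coe_fst', ContinuousLinearMap.coe_snd', coordCLM_apply, smul_eq_mul]
  generalize Complex.exp (Complex.I * ∑ n ∈ p.1.support, (p.1 n : ℂ) * x.1 n) = W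
  simp only [Finset.mul_sum]
  congr 1
  · refine Finset.sum_congr rfl fun j _ => ?_
    ring
  · refine Finset.sum_congr rfl fun j _ => ?_
    ring

theorem differentiable_monomialFun (p : MonoIndex) : Differentiable ℂ (monomialFun p) := fun x =>
  (hasFDerivAt_monomialFun p x).choose_spec.1.differentiableAt

theorem fderiv_monomialFun (p : MonoIndex) (x v : Phase) :
    fderiv ℂ (monomialFun p) x v =
      ∑ j ∈ monoSupport p, (monoAngle j p x * v.1 j + monoAction j p x * v.2 j) := by
  obtain ⟨T, hT, h⟩ := hasFDerivAt_monomialFun p x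
  rw [hT.fderiv, h]

theorem monoAngle_eq_zero {j : ℕ} {p : MonoIndex} (h : j ∉ monoSupport p) (x : Phase) :
    monoAngle j p x = 0 := by
  have : j ∉ p.1.support := fun h' => h (Finset.mem_union_left _ h')
  simp [monoAngle, Finsupp.notMem_support_iff.1 this]

theorem monoAction_eq_zero {j : ℕ} {p : MonoIndex} (h : j ∉ monoSupport p) (x : Phase) :
    monoAction j p x = 0 := by
  have : j ∉ p.2.support := fun h' => h (Finset.mem_union_right _ h')
  simp [monoAction, Finsupp.notMem_support_iff.1 this]

theorem dAngle_monomialFun (j : ℕ) (p : MonoIndex) (x : Phase) :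
    dAngle j (monomialFun p) x = monoAngle j p x := by
  rw [dAngle, fderiv_monomialFun]
  simp only [single_one_apply, lp.coeFn_zero, Pi.zero_apply, mul_zero, add_zero, mul_ite, mul_one,
    Finset.sum_ite_eq']
  split_ifs with h
  · rfl
  · exact (monoAngle_eq_zero h x).symm

theorem dAction_monomialFun (j : ℕ) (p : MonoIndex) (x : Phase) :
    dAction j (monomialFun p) x = monoAction j p x := by
  rw [dAction, fderiv_monomialFun]
  simp only [single_one_apply, lp.coeFn_zero, Pi.zero_apply, mul_zero, zero_add, mul_ite, mul_one,
    Finset.sum_ite_eq']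
  split_ifs with h
  · rfl
  · exact (monoAction_eq_zero h x).symm

/-- The share of the `j`-th index in `|l|_1`. -/
def freqShare (j : ℕ) (p : MonoIndex) : ℝ := (p.1 j).natAbs / frequencySize p.1

/-- The share of the `j`-th index in `|α|_1`. -/
def expShare (j : ℕ) (p : MonoIndex) : ℝ := p.2 j / exponentSize p.2

theorem freqShare_nonneg (j : ℕ) (p : MonoIndex) : 0 ≤ freqShare j p := by
  unfold freqShare; positivity

theorem expShare_nonneg (j : ℕ) (p : MonoIndex) : 0 ≤ expShare j p := by
  unfold expShare; positivity

theorem sum_freqShare_le (s : Finset ℕ) (p : MonoIndex) : ∑ j ∈ s, freqShare j p ≤ 1 := by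
  unfold freqShare
  rw [← Finset.sum_div]
  refine div_le_one_of_le₀ ?_ (Nat.cast_nonneg _)
  rw [← Nat.cast_sum, Nat.cast_le, frequencySize, Finsupp.sum]
  refine Finset.sum_le_sum_of_ne_zero fun j _ hj => ?_
  rw [Finsupp.mem_support_iff]
  exact Int.natAbs_ne_zero.1 hj

theorem sum_expShare_le (s : Finset ℕ) (p : MonoIndex) : ∑ j ∈ s, expShare j p ≤ 1 := by
  unfold expShare
  rw [← Finset.sum_div]
  refine div_le_one_of_le₀ ?_ (Nat.cast_nonneg _)
  rw [← Nat.cast_sum, Nat.cast_le, exponentSize, Finsupp.sum]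
  refine Finset.sum_le_sum_of_ne_zero fun j _ hj => ?_
  rwa [Finsupp.mem_support_iff]

theorem freqShare_le_one (j : ℕ) (p : MonoIndex) : freqShare j p ≤ 1 := by
  simpa using sum_freqShare_le {j} p

theorem expShare_le_one (j : ℕ) (p : MonoIndex) : expShare j p ≤ 1 := by
  simpa using sum_expShare_le {j} p

/-- This is `y ≤ exp y` at `y = (σ' - σ) t`: Cauchy's estimate in the angles. -/
theorem mul_exp_le {σ σ' : ℝ} (h : σ < σ') (t : ℝ) :
    t * Real.exp (σ * t) ≤ (σ' - σ)⁻¹ * Real.exp (σ' * t) := by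
  have h0 : 0 < σ' - σ := sub_pos.2 h
  rw [inv_mul_eq_div, le_div_iff₀ h0]
  have h1 : (σ' - σ) * t ≤ Real.exp ((σ' - σ) * t) := by
    have := Real.add_one_le_exp ((σ' - σ) * t)
    linarith
  calc t * Real.exp (σ * t) * (σ' - σ) = (σ' - σ) * t * Real.exp (σ * t) := by ring
    _ ≤ Real.exp ((σ' - σ) * t) * Real.exp (σ * t) := by gcongr
    _ = _ := by rw [← Real.exp_add]; congr 1; ring

/-- Each of the `n` terms of `(ρ'^n - ρ^n) / (ρ' - ρ) = ∑ ρ'^i ρ^(n-1-i)` is at least `ρ^(n-1)`: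
Cauchy's estimate in the actions. -/
theorem mul_pow_pred_le {ρ ρ' : ℝ} (h0 : 0 ≤ ρ) (h : ρ < ρ') (n : ℕ) :
    n * ρ ^ (n - 1) ≤ (ρ' - ρ)⁻¹ * ρ' ^ n := by
  have h1 : 0 < ρ' - ρ := sub_pos.2 h
  rw [inv_mul_eq_div, le_div_iff₀ h1]
  rcases n.eq_zero_or_pos with rfl | hn
  · simp
  have h2 : (∑ i ∈ Finset.range n, ρ' ^ i * ρ ^ (n - 1 - i)) * (ρ' - ρ) = ρ' ^ n - ρ ^ n :=
    (Commute.all ρ' ρ).geom_sum₂_mul n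
  have h3 : (n : ℝ) * ρ ^ (n - 1) ≤ ∑ i ∈ Finset.range n, ρ' ^ i * ρ ^ (n - 1 - i) := by
    have h4 : ∑ _i ∈ Finset.range n, ρ ^ (n - 1) = (n : ℝ) * ρ ^ (n - 1) := by simp
    rw [← h4]
    refine Finset.sum_le_sum fun i hi => ?_
    have : i + (n - 1 - i) = n - 1 := by have := Finset.mem_range.1 hi; omega
    calc ρ ^ (n - 1) = ρ ^ i * ρ ^ (n - 1 - i) := by rw [← pow_add, this]
      _ ≤ ρ' ^ i * ρ ^ (n - 1 - i) := by gcongr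
  calc (n : ℝ) * ρ ^ (n - 1) * (ρ' - ρ)
      ≤ (∑ i ∈ Finset.range n, ρ' ^ i * ρ ^ (n - 1 - i)) * (ρ' - ρ) := by gcongr
    _ = ρ' ^ n - ρ ^ n := h2
    _ ≤ ρ' ^ n := sub_le_self (ρ' ^ n) (pow_nonneg h0 n)

/-- Writing `|l_j|` as share times `|l|_1` spends the whole loss of width on `|l|_1` and keeps the
share, which remains summable in `j`. -/
theorem frequency_mul_monoNorm_le {ρ σ ρ' σ' : ℝ} (hρ : 0 ≤ ρ) (h : ρ ≤ ρ') (hσ : σ < σ') (j : ℕ)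
    (p : MonoIndex) :
    (p.1 j).natAbs * monoNorm ρ σ p ≤ (σ' - σ)⁻¹ * freqShare j p * monoNorm ρ' σ' p := by
  rcases eq_or_ne (frequencySize p.1) 0 with h0 | h0
  · have : (p.1 j).natAbs = 0 := by
      by_contra hj
      have hj' : j ∈ p.1.support := Finsupp.mem_support_iff.2 (Int.natAbs_ne_zero.1 hj)
      exact hj ((Finset.sum_eq_zero_iff (M := ℕ)).1 h0 j hj')
    rw [this, freqShare, this]
    simp
  have h1 : (0 : ℝ) < frequencySize p.1 := by positivity
  have e : ((p.1 j).natAbs : ℝ) = freqShare j p * frequencySize p.1 := by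
    rw [freqShare, div_mul_cancel₀ _ h1.ne']
  have h2 := freqShare_nonneg j p
  unfold monoNorm
  calc ((p.1 j).natAbs : ℝ) * (ρ ^ exponentSize p.2 * Real.exp (σ * frequencySize p.1))
      = freqShare j p * ρ ^ exponentSize p.2 *
          (frequencySize p.1 * Real.exp (σ * frequencySize p.1)) := by rw [e]; ring
    _ ≤ freqShare j p * ρ' ^ exponentSize p.2 *
          ((σ' - σ)⁻¹ * Real.exp (σ' * frequencySize p.1)) := by
        have := mul_exp_le hσ (frequencySize p.1)
        have h3 : 0 ≤ ρ' := hρ.trans h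
        gcongr
    _ = _ := by ring

theorem exponent_mul_monoNorm_le {ρ σ ρ' σ' : ℝ} (hρ : 0 ≤ ρ) (h : ρ < ρ') (hσ : σ ≤ σ') (j : ℕ)
    (p : MonoIndex) :
    p.2 j * (ρ ^ (exponentSize p.2 - 1) * Real.exp (σ * frequencySize p.1)) ≤
      (ρ' - ρ)⁻¹ * expShare j p * monoNorm ρ' σ' p := by
  rcases eq_or_ne (exponentSize p.2) 0 with h0 | h0
  · have : p.2 j = 0 := by
      by_contra hj
      exact hj ((Finset.sum_eq_zero_iff (M := ℕ)).1 h0 j (Finsupp.mem_support_iff.2 hj))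
    rw [this, expShare, this]
    simp
  have h1 : (0 : ℝ) < exponentSize p.2 := by positivity
  have e : (p.2 j : ℝ) = expShare j p * exponentSize p.2 := by
    rw [expShare, div_mul_cancel₀ _ h1.ne']
  have h2 := expShare_nonneg j p
  unfold monoNorm
  calc (p.2 j : ℝ) * (ρ ^ (exponentSize p.2 - 1) * Real.exp (σ * frequencySize p.1))
      = expShare j p * (exponentSize p.2 * ρ ^ (exponentSize p.2 - 1)) *
          Real.exp (σ * frequencySize p.1) := by rw [e]; ring
    _ ≤ expShare j p * ((ρ' - ρ)⁻¹ * ρ' ^ exponentSize p.2) *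
          Real.exp (σ' * frequencySize p.1) := by
        have := mul_pow_pred_le hρ h (exponentSize p.2)
        have : 0 ≤ (ρ' - ρ)⁻¹ := inv_nonneg.2 (sub_pos.2 h).le
        have : 0 ≤ ρ' := hρ.trans h.le
        gcongr
    _ = _ := by ring

theorem exponentSize_add (a b : ℕ →₀ ℕ) : exponentSize (a + b) = exponentSize a + exponentSize b :=
  Finsupp.sum_add_index' (fun _ => rfl) fun _ _ _ => rfl

theorem exponentSize_sub_single {a : ℕ →₀ ℕ} {j : ℕ} (h : a j ≠ 0) :
    exponentSize (a - Finsupp.single j 1) = exponentSize a - 1 := by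
  have h1 : Finsupp.single j 1 ≤ a := by
    rw [Finsupp.single_le_iff]; omega
  have h2 : exponentSize (Finsupp.single j 1) = 1 := by simp [exponentSize]
  have h3 := exponentSize_add (a - Finsupp.single j 1) (Finsupp.single j 1)
  rw [tsub_add_cancel_of_le h1, h2] at h3
  omega

theorem frequencySize_add_le (a b : ℕ →₀ ℤ) :
    frequencySize (a + b) ≤ frequencySize a + frequencySize b := by
  have h : ∀ c : ℕ →₀ ℤ, c.support ⊆ a.support ∪ b.support →
      frequencySize c = ∑ j ∈ a.support ∪ b.support, (c j).natAbs := fun c hc =>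
    Finsupp.sum_of_support_subset _ hc _ (by simp)
  rw [h _ Finsupp.support_add, h a Finset.subset_union_left, h b Finset.subset_union_right,
    ← Finset.sum_add_distrib]
  exact Finset.sum_le_sum fun j _ => by rw [Finsupp.add_apply]; exact Int.natAbs_add_le _ _

theorem norm_monoAngle_le {ρ σ ρ' σ' : ℝ} (hρ : 0 ≤ ρ) (h : ρ ≤ ρ') (hσ : σ < σ') {x : Phase}
    (hx : x ∈ domainQ ρ σ) (j : ℕ) (p : MonoIndex) :
    ‖monoAngle j p x‖ ≤ (σ' - σ)⁻¹ * freqShare j p * monoNorm ρ' σ' p := by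
  refine le_trans ?_ (frequency_mul_monoNorm_le hρ h hσ j p)
  rw [monoAngle, norm_mul, norm_mul, Complex.norm_I, one_mul, Complex.norm_intCast,
    Nat.cast_natAbs, Int.cast_abs]
  gcongr
  exact norm_monomialFun_le hx p

theorem norm_monoAction_le {ρ σ ρ' σ' : ℝ} (hρ : 0 ≤ ρ) (h : ρ < ρ') (hσ : σ ≤ σ') {x : Phase}
    (hx : x ∈ domainQ ρ σ) (j : ℕ) (p : MonoIndex) :
    ‖monoAction j p x‖ ≤ (ρ' - ρ)⁻¹ * expShare j p * monoNorm ρ' σ' p := by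
  refine le_trans ?_ (exponent_mul_monoNorm_le hρ h hσ j p)
  rw [monoAction, norm_mul, Complex.norm_natCast]
  rcases eq_or_ne (p.2 j) 0 with h0 | h0
  · simp [h0]
  gcongr
  refine (norm_monomialFun_le hx _).trans_eq ?_
  rw [monoNorm, exponentSize_sub_single h0]

/-! ### Masses and the comparison of block weights -/

/-- Decay of the masses: `(m a / m i) ^ (1 - β)` for `i ≤ a`, and `0` otherwise. -/
def massRatio (m : ℕ → ℝ) (β : ℝ) (a i : ℕ) : ℝ := if i ≤ a then (m a / m i) ^ (1 - β) else 0

/-- The consequences of exponential decay of the masses that enter the estimates. -/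
structure MassBounds (m : ℕ → ℝ) (β₁ P Θ S : ℝ) : Prop where
  pos : ∀ i, 0 < m i
  anti : Antitone m
  lt_one : β₁ < 1
  prod_le : ∀ β, 0 < β → β ≤ β₁ → ∀ s : Finset ℕ, ∏ n ∈ s, m n ^ β ≤ P
  zero_le : ∀ β, 0 < β → β ≤ β₁ → 1 ≤ P * m 0 ^ β
  ratio_le : ∀ i, ∑' a, ENNReal.ofReal (massRatio m β₁ a i) ≤ ENNReal.ofReal Θ
  sum_le : ∑' j, ENNReal.ofReal (m j) ≤ ENNReal.ofReal S

theorem tsum_ite_le_eq (f : ℕ → ℝ≥0∞) (i : ℕ) :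
    ∑' a, (if i ≤ a then f (a - i) else 0) = ∑' n, f n := by
  have hinj : Function.Injective fun n => i + n := fun a b h => by simpa using h
  rw [← hinj.tsum_eq (f := fun a => if i ≤ a then f (a - i) else 0)]
  · simp
  · intro a ha
    by_cases h : i ≤ a
    · exact ⟨a - i, by simp; omega⟩
    · simp [h] at ha

theorem massRatio_nonneg {m : ℕ → ℝ} (hm : ∀ i, 0 < m i) (β : ℝ) (a i : ℕ) :
    0 ≤ massRatio m β a i := by
  unfold massRatio
  split_ifs
  · exact Real.rpow_nonneg (div_nonneg (hm a).le (hm i).le) _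
  · exact le_rfl

/-- All constants are uniform in `β ≤ β₁`. Products are controlled by `m ^ β ≤ 1 + m ≤ exp m` and
the summability of `m`, ratios by a geometric series with quotient `exp (-κ (1 - β₁))`. -/
theorem exists_massBounds {κ : ℝ} (hκ : 0 < κ) {m : ℕ → ℝ} (hm : IsMassSequence κ m) {β₁ : ℝ}
    (h1 : β₁ < 1) : ∃ P Θ S : ℝ, 1 ≤ P ∧ 1 ≤ Θ ∧ 1 ≤ S ∧ MassBounds m β₁ P Θ S := by
  obtain ⟨hpos, hanti, M, hM⟩ := hm
  have hM1 : 1 ≤ M := by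
    have := hM 0 0 le_rfl
    simp only [CharP.cast_eq_zero, sub_zero, mul_zero, Real.exp_zero, mul_one] at this
    by_contra h
    nlinarith [hpos 0]
  have hsum : Summable m := by
    have hg : Summable fun j : ℕ => M * m 0 * Real.exp (-κ) ^ j :=
      (summable_geometric_of_lt_one (Real.exp_pos _).le
        (Real.exp_lt_one_iff.2 (neg_lt_zero.2 hκ))).mul_left _
    refine hg.of_nonneg_of_le (fun j => (hpos j).le) fun j => ?_
    have h2 := hM 0 j (Nat.zero_le j)
    rw [Nat.cast_zero, sub_zero, mul_comm (-κ), Real.exp_nat_mul] at h2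
    linarith
  set T := ∑' j, m j with hT
  have hT0 : 0 ≤ T := tsum_nonneg fun j => (hpos j).le
  set q := Real.exp (-κ * (1 - β₁)) with hq
  have hq0 : 0 < q := Real.exp_pos _
  have hq1 : q < 1 := Real.exp_lt_one_iff.2 (by nlinarith)
  have hratio : ∀ i a, massRatio m β₁ a i ≤ if i ≤ a then M ^ (1 - β₁) * q ^ (a - i) else 0 := by
    intro i a
    unfold massRatio
    split_ifs with h
    · have h2 : m a / m i ≤ M * Real.exp (-κ * ((a : ℝ) - i)) := by
        rw [div_le_iff₀ (hpos i)]; exact hM i a h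
      refine (Real.rpow_le_rpow (div_nonneg (hpos a).le (hpos i).le) h2 (by linarith)).trans_eq ?_
      rw [Real.mul_rpow (by linarith) (Real.exp_pos _).le, ← Real.exp_mul, hq, ← Real.exp_nat_mul,
        Nat.cast_sub h]
      ring_nf
    · exact le_rfl
  have hgq := summable_geometric_of_lt_one hq0.le hq1
  have hM2 : 0 < M ^ (1 - β₁) := Real.rpow_pos_of_pos (by linarith) _
  -- In `P`, `exp T` bounds the products, `(m 0)⁻¹` serves the empty block when `m 0 ≤ 1`, and the
  -- `1` gives `1 ≤ P`.
  refine ⟨Real.exp T + (m 0)⁻¹ + 1, max 1 (∑' n : ℕ, M ^ (1 - β₁) * q ^ n), max 1 T, ?_,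
    le_max_left _ _, le_max_left _ _, hpos, hanti, h1, ?_, ?_, ?_, ?_⟩
  · have := Real.exp_pos T
    have := inv_pos.2 (hpos 0)
    linarith
  · intro β hβ hβ' s
    have h2 : ∏ n ∈ s, m n ^ β ≤ ∏ n ∈ s, Real.exp (m n) := by
      refine Finset.prod_le_prod (fun n _ => Real.rpow_nonneg (hpos n).le _) fun n _ => ?_
      have h3 : 1 + m n ≤ Real.exp (m n) := by linarith [Real.add_one_le_exp (m n)]
      have h4 := hpos n
      calc m n ^ β ≤ (1 + m n) ^ β := Real.rpow_le_rpow h4.le (by linarith) hβ.le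
        _ ≤ (1 + m n) ^ (1 : ℝ) := Real.rpow_le_rpow_of_exponent_le (by linarith) (by linarith)
        _ = 1 + m n := Real.rpow_one _
        _ ≤ _ := h3
    have h3 : ∑ n ∈ s, m n ≤ T := hsum.sum_le_tsum s fun j _ => (hpos j).le
    have := inv_pos.2 (hpos 0)
    rw [← Real.exp_sum] at h2
    have := Real.exp_le_exp.2 h3
    linarith
  · intro β hβ hβ'
    have h0 := hpos 0
    have h2 := Real.exp_pos T
    rcases le_total 1 (m 0) with h | h
    · have h3 : 1 ≤ m 0 ^ β := Real.one_le_rpow h hβ.le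
      have := inv_pos.2 h0
      nlinarith
    · have h3 : m 0 ≤ m 0 ^ β := by
        simpa using Real.rpow_le_rpow_of_exponent_ge h0 h (hβ'.trans h1.le)
      have h4 : 1 = (m 0)⁻¹ * m 0 := (inv_mul_cancel₀ h0.ne').symm
      calc (1 : ℝ) = (m 0)⁻¹ * m 0 := h4
        _ ≤ _ := by
          refine mul_le_mul ?_ h3 h0.le ?_
          · linarith
          · have := inv_pos.2 h0
            linarith
  · intro i
    calc ∑' a, ENNReal.ofReal (massRatio m β₁ a i)
        ≤ ∑' a, (if i ≤ a then ENNReal.ofReal (M ^ (1 - β₁) * q ^ (a - i)) else 0) := by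
          refine ENNReal.tsum_le_tsum fun a => ?_
          have := ENNReal.ofReal_le_ofReal (hratio i a)
          split_ifs at this ⊢ <;> simpa using this
      _ = ∑' n : ℕ, ENNReal.ofReal (M ^ (1 - β₁) * q ^ n) :=
          tsum_ite_le_eq (fun n => ENNReal.ofReal (M ^ (1 - β₁) * q ^ n)) i
      _ = ENNReal.ofReal (∑' n : ℕ, M ^ (1 - β₁) * q ^ n) :=
          (ENNReal.ofReal_tsum_of_nonneg (fun n => by positivity) (hgq.mul_left _)).symm
      _ ≤ _ := ENNReal.ofReal_le_ofReal (le_max_right _ _)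
  · rw [← ENNReal.ofReal_tsum_of_nonneg (fun n => (hpos n).le) hsum]
    exact ENNReal.ofReal_le_ofReal (le_max_right _ _)

/-- The reciprocal `m_{max A} (m_{A \ max A})^β` of the weight of the block `A`. -/
def blockMass (m : ℕ → ℝ) (β : ℝ) (A : Finset ℕ) : ℝ := m (topIndex A) * lowerMass m A ^ β

theorem le_topIndex {A : Finset ℕ} {i : ℕ} (h : i ∈ A) : i ≤ topIndex A := Finset.le_sup (f := id) h

theorem topIndex_mem {A : Finset ℕ} (h : A.Nonempty) : topIndex A ∈ A := by
  obtain ⟨i, hi, e⟩ := Finset.exists_mem_eq_sup A h id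
  rw [topIndex, e]; exact hi

theorem topIndex_mono {A B : Finset ℕ} (h : A ⊆ B) : topIndex A ≤ topIndex B := Finset.sup_mono h

theorem topIndex_union (A B : Finset ℕ) : topIndex (A ∪ B) = max (topIndex A) (topIndex B) :=
  Finset.sup_union

namespace MassBounds

variable {m : ℕ → ℝ} {β₁ P Θ S : ℝ}

theorem blockMass_pos (h : MassBounds m β₁ P Θ S) (β : ℝ) (A : Finset ℕ) : 0 < blockMass m β A :=
  mul_pos (h.pos _) (Real.rpow_pos_of_pos (Finset.prod_pos fun i _ => h.pos i) _)

/-- Moving `m_{max A} ^ β` into the product makes it run over the whole block, so that it behaves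
well under unions and intersections. -/
theorem blockMass_eq (h : MassBounds m β₁ P Θ S) (β : ℝ) {A : Finset ℕ} (hA : A.Nonempty) :
    blockMass m β A = m (topIndex A) ^ (1 - β) * ∏ n ∈ A, m n ^ β := by
  rw [blockMass, lowerMass, ← Finset.mul_prod_erase A _ (topIndex_mem hA), ← mul_assoc,
    ← Real.rpow_add (h.pos _), Real.finsetProd_rpow _ _ fun i _ => (h.pos i).le]
  simp

theorem prod_nonneg (h : MassBounds m β₁ P Θ S) (β : ℝ) (A : Finset ℕ) : 0 ≤ ∏ n ∈ A, m n ^ β :=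
  Finset.prod_nonneg fun n _ => Real.rpow_nonneg (h.pos n).le _

/-- The formula `blockMass_eq` fails only for the empty block, which has to be allowed because a
bracket can produce constants; there the discrepancy is the factor `m 0 ^ β`. -/
theorem le_blockMass (h : MassBounds m β₁ P Θ S) (hP : 1 ≤ P) {β : ℝ} (hβ : 0 < β) (hβ' : β ≤ β₁)
    (E : Finset ℕ) : m (topIndex E) ^ (1 - β) * ∏ n ∈ E, m n ^ β ≤ P * blockMass m β E := by
  rcases E.eq_empty_or_nonempty with rfl | hE
  · have h0 := h.pos 0
    have h1 := h.zero_le β hβ hβ'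
    have h2 : m 0 ^ (1 - β) * m 0 ^ β = m 0 := by rw [← Real.rpow_add h0]; simp
    have h3 : 0 < m 0 ^ (1 - β) := Real.rpow_pos_of_pos h0 _
    simp only [topIndex, blockMass, lowerMass, Finset.sup_empty, Finset.prod_empty,
      Finset.erase_empty, Real.one_rpow, mul_one, bot_eq_zero']
    calc m 0 ^ (1 - β) ≤ m 0 ^ (1 - β) * (P * m 0 ^ β) := le_mul_of_one_le_right h3.le h1
      _ = P * (m 0 ^ (1 - β) * m 0 ^ β) := by ring
      _ = P * m 0 := by rw [h2]
  · rw [← h.blockMass_eq β hE]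
    exact le_mul_of_one_le_left (h.blockMass_pos β E).le hP

theorem blockMass_le (h : MassBounds m β₁ P Θ S) {β : ℝ} (hβ : 0 < β) (hβ' : β ≤ β₁)
    (A : Finset ℕ) : blockMass m β A ≤ P * m (topIndex A) := by
  rw [blockMass, mul_comm]
  refine mul_le_mul_of_nonneg_right ?_ (h.pos _).le
  rw [lowerMass, ← Real.finsetProd_rpow _ _ fun i _ => (h.pos i).le]
  exact h.prod_le β hβ hβ' _

/-- The ratio is at most one since `m` is non-increasing, so lowering the exponent from `1 - β` to
`1 - β₁` only enlarges the power; one exponent serves all `β`. -/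
theorem rpow_le_massRatio (h : MassBounds m β₁ P Θ S) {β : ℝ} (hβ' : β ≤ β₁) {a i : ℕ}
    (hai : i ≤ a) : (m a / m i) ^ (1 - β) ≤ massRatio m β₁ a i := by
  rw [massRatio, if_pos hai]
  exact Real.rpow_le_rpow_of_exponent_ge (div_pos (h.pos a) (h.pos i))
    (div_le_one_of_le₀ (h.anti hai) (h.pos i).le) (by linarith)

/-- Splitting `m_i ^ β` off the product and multiplying by `m_i ^ (1 - β)` yields a full factor
`m_i`. This factor is what cancels the `m_j⁻¹` in Hamilton's equations. -/
theorem blockMass_le_of_mem (h : MassBounds m β₁ P Θ S) {β : ℝ} (hβ : 0 < β) (hβ' : β ≤ β₁)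
    {A : Finset ℕ} {i : ℕ} (hi : i ∈ A) :
    blockMass m β A ≤ P * m i * massRatio m β₁ (topIndex A) i := by
  rw [h.blockMass_eq β ⟨i, hi⟩, ← Finset.mul_prod_erase A _ hi]
  have h1 := h.rpow_le_massRatio hβ' (le_topIndex hi)
  have h2 := h.prod_le β hβ hβ' (A.erase i)
  have h3 : m i ^ (1 - β) * m i ^ β = m i := by rw [← Real.rpow_add (h.pos i)]; simp
  have h4 : 0 < m i ^ (1 - β) := Real.rpow_pos_of_pos (h.pos i) _
  rw [Real.div_rpow (h.pos _).le (h.pos i).le] at h1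
  have h5 := h.prod_nonneg β (A.erase i)
  have h6 := (h.pos i).le
  calc m (topIndex A) ^ (1 - β) * (m i ^ β * ∏ n ∈ A.erase i, m n ^ β)
      = (∏ n ∈ A.erase i, m n ^ β) * (m i ^ (1 - β) * m i ^ β) *
          (m (topIndex A) ^ (1 - β) / m i ^ (1 - β)) := by field_simp
    _ ≤ P * m i * massRatio m β₁ (topIndex A) i := by
        rw [h3]
        have : 0 ≤ m (topIndex A) ^ (1 - β) / m i ^ (1 - β) :=
          div_nonneg (Real.rpow_nonneg (h.pos _).le _) h4.le
        have h7 := (h5.trans h2)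
        exact mul_le_mul (mul_le_mul_of_nonneg_right h2 h6) h1 this (mul_nonneg h7 h6)

/-- The comparison of weights behind the estimate of the Poisson bracket: a product of two monomials
with supports `A`, `B`, differentiated in an index of `A ∩ B`, has support `E`. -/
theorem blockMass_mul_le (h : MassBounds m β₁ P Θ S) (hP : 1 ≤ P) {β : ℝ} (hβ : 0 < β)
    (hβ' : β ≤ β₁) {A B E : Finset ℕ} {i : ℕ} (hA : i ∈ A) (hB : i ∈ B) (hE : E ⊆ A ∪ B)
    (hE' : (A ∪ B) \ E ⊆ A ∩ B) :
    blockMass m β A * blockMass m β B / m i ≤ P ^ 3 * blockMass m β E *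
      ((if topIndex E = topIndex B then massRatio m β₁ (topIndex A) i else 0) +
       (if topIndex E = topIndex A then massRatio m β₁ (topIndex B) i else 0) +
       (if topIndex A = topIndex B then massRatio m β₁ (topIndex A) (topIndex E) else 0)) := by
  have hnn : ∀ (c : Prop) [Decidable c] (a b : ℕ), 0 ≤ if c then massRatio m β₁ a b else 0 :=
    fun c _ a b => by
      split_ifs
      exacts [massRatio_nonneg h.pos _ _ _, le_rfl]
  set a := topIndex A with ha
  set b := topIndex B with hb
  set e := topIndex E with he
  have hia : i ≤ a := le_topIndex hA
  have hib : i ≤ b := le_topIndex hB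
  have hmi := h.pos i
  have hma := h.pos a
  have hmb := h.pos b
  have hme := h.pos e
  have hpow : 0 < 1 - β := by linarith [h.lt_one]
  -- The two products equal the one over `A ∪ B` times the one over `A ∩ B`. The lost indices and `A
  -- ∩ B` without `i` cost one factor `P` each.
  have hprod : (∏ n ∈ A, m n ^ β) * (∏ n ∈ B, m n ^ β) ≤
      P ^ 2 * m i ^ β * ∏ n ∈ E, m n ^ β := by
    rw [← Finset.prod_union_inter, ← Finset.prod_sdiff hE,
      ← Finset.mul_prod_erase (A ∩ B) _ (Finset.mem_inter.2 ⟨hA, hB⟩)]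
    have h1 := h.prod_le β hβ hβ' ((A ∪ B) \ E)
    have h2 := h.prod_le β hβ hβ' ((A ∩ B).erase i)
    have h3 := h.prod_nonneg β E
    have h4 := h.prod_nonneg β ((A ∩ B).erase i)
    have h5 : 0 ≤ m i ^ β := Real.rpow_nonneg hmi.le _
    calc _ = (∏ n ∈ (A ∪ B) \ E, m n ^ β) * (∏ n ∈ (A ∩ B).erase i, m n ^ β) *
          m i ^ β * ∏ n ∈ E, m n ^ β := by ring
      _ ≤ P * P * m i ^ β * ∏ n ∈ E, m n ^ β := by
          gcongr
      _ = _ := by ring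
  have hi : m i ^ β / m i = (m i ^ (1 - β))⁻¹ := by
    rw [Real.rpow_sub hmi, Real.rpow_one, inv_div]
  have key : blockMass m β A * blockMass m β B / m i ≤
      P ^ 3 * blockMass m β E * (m a * m b / (m i * m e)) ^ (1 - β) := by
    rw [h.blockMass_eq β ⟨i, hA⟩, h.blockMass_eq β ⟨i, hB⟩]
    have h1 := h.le_blockMass hP hβ hβ' E
    have hpa : 0 < m a ^ (1 - β) := Real.rpow_pos_of_pos hma _
    have hpb : 0 < m b ^ (1 - β) := Real.rpow_pos_of_pos hmb _
    have hpi : 0 < m i ^ (1 - β) := Real.rpow_pos_of_pos hmi _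
    have hpe : 0 < m e ^ (1 - β) := Real.rpow_pos_of_pos hme _
    rw [Real.div_rpow (by positivity) (by positivity), Real.mul_rpow hma.le hmb.le,
      Real.mul_rpow hmi.le hme.le]
    calc m a ^ (1 - β) * (∏ n ∈ A, m n ^ β) * (m b ^ (1 - β) * ∏ n ∈ B, m n ^ β) / m i
        = m a ^ (1 - β) * m b ^ (1 - β) * ((∏ n ∈ A, m n ^ β) * ∏ n ∈ B, m n ^ β) / m i := by ring
      _ ≤ m a ^ (1 - β) * m b ^ (1 - β) * (P ^ 2 * m i ^ β * ∏ n ∈ E, m n ^ β) / m i := by gcongr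
      _ = P ^ 2 * (m e ^ (1 - β) * ∏ n ∈ E, m n ^ β) * (m i ^ β / m i) *
            (m a ^ (1 - β) * m b ^ (1 - β) / m e ^ (1 - β)) := by field_simp
      _ ≤ P ^ 2 * (P * blockMass m β E) * (m i ^ β / m i) *
            (m a ^ (1 - β) * m b ^ (1 - β) / m e ^ (1 - β)) := by
          have : 0 ≤ m i ^ β / m i := by rw [hi]; positivity
          gcongr
      _ = _ := by rw [hi]; field_simp
  refine key.trans (mul_le_mul_of_nonneg_left ?_ ?_)
  swap
  · have := h.blockMass_pos β E
    positivity
  have hemax : e ≤ max a b := by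
    rw [he, ha, hb, ← topIndex_union]; exact topIndex_mono hE
  -- The larger of two distinct maxima belongs to only one of the supports, hence cannot be lost.
  have hmax : a ≠ b → e = max a b := by
    intro hab
    refine le_antisymm hemax ?_
    have hmem : max a b ∈ E := by
      by_contra hcon
      have h1 : max a b ∈ A ∪ B := by
        rcases max_choice a b with h' | h' <;> rw [h']
        · exact Finset.mem_union_left _ (topIndex_mem ⟨i, hA⟩)
        · exact Finset.mem_union_right _ (topIndex_mem ⟨i, hB⟩)
      have h2 := Finset.mem_inter.1 (hE' (Finset.mem_sdiff.2 ⟨h1, hcon⟩))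
      have h3 : max a b ≤ a := le_topIndex h2.1
      have h4 : max a b ≤ b := le_topIndex h2.2
      omega
    exact le_topIndex hmem
  by_cases heb : e = b
  · have h1 : m a * m b / (m i * m e) = m a / m i := by rw [heb]; field_simp
    rw [h1, if_pos heb, add_assoc]
    exact (h.rpow_le_massRatio hβ' hia).trans
      (le_add_of_nonneg_right (add_nonneg (hnn _ _ _) (hnn _ _ _)))
  by_cases hea : e = a
  · have h1 : m a * m b / (m i * m e) = m b / m i := by rw [hea]; field_simp
    rw [h1, if_neg heb, if_pos hea, zero_add]
    exact (h.rpow_le_massRatio hβ' hib).trans (le_add_of_nonneg_right (hnn _ _ _))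
  have hab : a = b := by
    by_contra hab
    have := hmax hab
    omega
  -- Here the common maximum `a = b` has been lost. The ratio is `(m a / m i) * (m a / m e)` with
  -- first factor at most one.
  rw [if_neg heb, if_neg hea, if_pos hab, zero_add, zero_add]
  refine le_trans (Real.rpow_le_rpow (by positivity) ?_ hpow.le)
    (h.rpow_le_massRatio hβ' (by omega : e ≤ a))
  rw [← hab, mul_div_mul_comm]
  exact mul_le_of_le_one_left (by positivity) (div_le_one_of_le₀ (h.anti hia) hmi.le)

end MassBounds

/-! ### The norm as a supremum of sums over monomials -/

/-- The largest index of a monomial. -/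
def monoTop (p : MonoIndex) : ℕ := topIndex (monoSupport p)

/-- The contribution of a monomial with coefficient of absolute value `b` to the norm. -/
def termWeight (m : ℕ → ℝ) (β ρ σ b : ℝ) (p : MonoIndex) : ℝ :=
  b * monoNorm ρ σ p / blockMass m β (monoSupport p)

/-- The norm of a series of monomials `val t * monomialFun (π t)`, in which a monomial may occur
more than once. -/
def seriesNorm {T : Type*} (m : ℕ → ℝ) (β ρ σ : ℝ) (π : T → MonoIndex) (val : T → ℂ) : ℝ≥0∞ :=
  ⨆ j : ℕ, ∑' t, if monoTop (π t) = j then ENNReal.ofReal (termWeight m β ρ σ ‖val t‖ (π t)) else 0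

/-- Grouping by the value of `τ` gives an `ℓ_1`–`ℓ_∞` pairing. With `τ` the largest index, the
second factor is the weighted norm and the first a sum of masses or mass ratios. -/
theorem tsum_mul_le_tsum_mul_iSup {T : Type*} (τ : T → ℕ) (w : ℕ → ℝ≥0∞) (f : T → ℝ≥0∞) :
    ∑' t, w (τ t) * f t ≤ (∑' j, w j) * ⨆ j, ∑' t, if τ t = j then f t else 0 := by
  calc ∑' t, w (τ t) * f t = ∑' t, ∑' j, w j * (if τ t = j then f t else 0) := by
        refine tsum_congr fun t => ?_
        rw [tsum_eq_single (τ t) fun j hj => by rw [if_neg hj.symm, mul_zero], if_pos rfl]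
    _ = ∑' j, w j * ∑' t, (if τ t = j then f t else 0) := by
        rw [ENNReal.tsum_comm]
        exact tsum_congr fun j => ENNReal.tsum_mul_left
    _ ≤ ∑' j, w j * ⨆ j, ∑' t, (if τ t = j then f t else 0) := by
        refine ENNReal.tsum_le_tsum fun j => ?_
        gcongr
        exact le_iSup (fun j => ∑' t, (if τ t = j then f t else 0)) j
    _ = _ := ENNReal.tsum_mul_right

theorem termWeight_nonneg {m : ℕ → ℝ} (hm : ∀ i, 0 < m i) {β ρ σ b : ℝ} (hρ : 0 ≤ ρ) (hb : 0 ≤ b)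
    (p : MonoIndex) : 0 ≤ termWeight m β ρ σ b p :=
  div_nonneg (mul_nonneg hb (monoNorm_nonneg hρ p)) (mul_nonneg (hm _).le
    (Real.rpow_nonneg (Finset.prod_nonneg fun i _ => (hm i).le) _))

theorem coeffNorm_eq_seriesNorm {m : ℕ → ℝ} (hm : ∀ i, 0 < m i) (β ρ σ : ℝ) (c : MonoIndex → ℂ) :
    coeffNorm m β ρ σ c = seriesNorm m β ρ σ id c := by
  unfold coeffNorm seriesNorm
  refine iSup_congr fun j => ?_
  have hlow : ∀ A, 0 < lowerMass m A := fun A => Finset.prod_pos fun i _ => hm i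
  rw [← ENNReal.tsum_fiberwise _ monoSupport, ← ENNReal.tsum_mul_left]
  refine (tsum_subtype {A : Finset ℕ | topIndex A = j} fun A => ENNReal.ofReal (m j)⁻¹ *
      (ENNReal.ofReal (lowerMass m A ^ (-β)) * blockNorm ρ σ c A)).trans ?_
  refine tsum_congr fun A => ?_
  rw [Set.indicator_apply]
  split_ifs with hA
  · rw [blockNorm, ← ENNReal.tsum_mul_left, ← ENNReal.tsum_mul_left]
    refine tsum_congr fun p => ?_
    obtain ⟨p, rfl⟩ := p
    have hA' : monoTop p = j := hA
    simp only [id, if_pos hA']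
    rw [← ENNReal.ofReal_mul (Real.rpow_nonneg (hlow _).le _),
      ← ENNReal.ofReal_mul (inv_nonneg.2 (hm j).le), termWeight, monoNorm, blockMass,
      Real.rpow_neg (hlow _).le]
    rw [monoTop] at hA'
    rw [hA']
    congr 1
    field_simp
  · symm
    rw [ENNReal.tsum_eq_zero]
    rintro ⟨p, rfl⟩
    exact if_neg hA

section
variable {m : ℕ → ℝ} {β₁ P Θ S : ℝ} {T : Type*} {β ρ σ : ℝ} {π : T → MonoIndex} {val : T → ℂ}

/-- A block with largest index `j` has reciprocal weight at most `P m_j`, and masses are summable.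
So the weighted norm controls absolute convergence and the supremum on the domain. -/
theorem tsum_monoNorm_le (h : MassBounds m β₁ P Θ S) (hβ : 0 < β) (hβ' : β ≤ β₁)
    (hP : 1 ≤ P) (hρ : 0 ≤ ρ) :
    ∑' t, ENNReal.ofReal (‖val t‖ * monoNorm ρ σ (π t)) ≤
      ENNReal.ofReal (P * S) * seriesNorm m β ρ σ π val := by
  have h1 : ∀ t, ENNReal.ofReal (‖val t‖ * monoNorm ρ σ (π t)) ≤
      ENNReal.ofReal (P * m (monoTop (π t))) * ENNReal.ofReal (termWeight m β ρ σ ‖val t‖ (π t)) := by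
    intro t
    have hb := h.blockMass_pos β (monoSupport (π t))
    have hm := h.pos (monoTop (π t))
    rw [← ENNReal.ofReal_mul (by positivity)]
    refine ENNReal.ofReal_le_ofReal ?_
    have h2 := h.blockMass_le hβ hβ' (monoSupport (π t))
    have h3 := termWeight_nonneg h.pos (β := β) (σ := σ) hρ (norm_nonneg (val t)) (π t)
    calc ‖val t‖ * monoNorm ρ σ (π t)
        = blockMass m β (monoSupport (π t)) * termWeight m β ρ σ ‖val t‖ (π t) := by
          unfold termWeight; field_simp
      _ ≤ _ := mul_le_mul_of_nonneg_right h2 h3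
  refine (ENNReal.tsum_le_tsum h1).trans
    ((tsum_mul_le_tsum_mul_iSup (fun t => monoTop (π t)) (fun j => ENNReal.ofReal (P * m j)) _).trans ?_)
  unfold seriesNorm
  gcongr
  calc ∑' j, ENNReal.ofReal (P * m j) = ENNReal.ofReal P * ∑' j, ENNReal.ofReal (m j) := by
        rw [← ENNReal.tsum_mul_left]
        exact tsum_congr fun j => ENNReal.ofReal_mul (by linarith)
    _ ≤ ENNReal.ofReal P * ENNReal.ofReal S := by gcongr; exact h.sum_le
    _ = _ := (ENNReal.ofReal_mul (by linarith)).symm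

/-- The gain of `m i` over the total sum comes from `MassBounds.blockMass_le_of_mem`; the remaining
mass ratio is summed over the largest index. -/
theorem tsum_monoNorm_mem_le (h : MassBounds m β₁ P Θ S) (hβ : 0 < β) (hβ' : β ≤ β₁)
    (hP : 1 ≤ P) (hρ : 0 ≤ ρ) (i : ℕ) :
    ∑' t, (if i ∈ monoSupport (π t) then ENNReal.ofReal (‖val t‖ * monoNorm ρ σ (π t)) else 0) ≤
      ENNReal.ofReal (P * Θ * m i) * seriesNorm m β ρ σ π val := by
  have hmi := h.pos i
  have h1 : ∀ t, (if i ∈ monoSupport (π t) then ENNReal.ofReal (‖val t‖ * monoNorm ρ σ (π t)) else 0) ≤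
      ENNReal.ofReal (P * m i) * ENNReal.ofReal (massRatio m β₁ (monoTop (π t)) i) *
        ENNReal.ofReal (termWeight m β ρ σ ‖val t‖ (π t)) := by
    intro t
    split_ifs with hi
    swap
    · exact zero_le
    have hb := h.blockMass_pos β (monoSupport (π t))
    rw [← ENNReal.ofReal_mul (by positivity), ← ENNReal.ofReal_mul (mul_nonneg (by positivity)
      (massRatio_nonneg h.pos _ _ _))]
    refine ENNReal.ofReal_le_ofReal ?_
    have h2 := h.blockMass_le_of_mem hβ hβ' hi
    have h3 := termWeight_nonneg h.pos (β := β) (σ := σ) hρ (norm_nonneg (val t)) (π t)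
    calc ‖val t‖ * monoNorm ρ σ (π t)
        = blockMass m β (monoSupport (π t)) * termWeight m β ρ σ ‖val t‖ (π t) := by
          unfold termWeight; field_simp
      _ ≤ _ := mul_le_mul_of_nonneg_right h2 h3
  refine (ENNReal.tsum_le_tsum h1).trans ((tsum_mul_le_tsum_mul_iSup (fun t => monoTop (π t))
    (fun j => ENNReal.ofReal (P * m i) * ENNReal.ofReal (massRatio m β₁ j i)) _).trans ?_)
  unfold seriesNorm
  gcongr
  rw [ENNReal.tsum_mul_left]
  calc _ ≤ ENNReal.ofReal (P * m i) * ENNReal.ofReal Θ := by gcongr; exact h.ratio_le i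
    _ = _ := by rw [← ENNReal.ofReal_mul (by positivity)]; congr 1; ring

theorem summable_monoNorm (h : MassBounds m β₁ P Θ S) (hβ : 0 < β) (hβ' : β ≤ β₁)
    (hP : 1 ≤ P) (hρ : 0 ≤ ρ) (hfin : seriesNorm m β ρ σ π val ≠ ⊤) :
    Summable fun t => ‖val t‖ * monoNorm ρ σ (π t) := by
  have h1 : ∑' t, ENNReal.ofReal (‖val t‖ * monoNorm ρ σ (π t)) ≠ ⊤ :=
    ne_top_of_le_ne_top (ENNReal.mul_ne_top ENNReal.ofReal_ne_top hfin)
      (tsum_monoNorm_le h hβ hβ' hP hρ)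
  refine (ENNReal.summable_toReal h1).congr fun t => ?_
  exact ENNReal.toReal_ofReal (mul_nonneg (norm_nonneg _) (monoNorm_nonneg hρ _))

/-- A function given by a series of monomials has norm at most the norm of the series. -/
theorem funNorm_le_seriesNorm (h : MassBounds m β₁ P Θ S) (hβ : 0 < β) (hβ' : β ≤ β₁)
    (hP : 1 ≤ P) (hρ : 0 ≤ ρ) {f : Phase → ℂ}
    (hf : ∀ x ∈ domainQ ρ σ, HasSum (fun t => val t * monomialFun (π t) x) (f x)) :
    funNorm m β ρ σ f ≤ seriesNorm m β ρ σ π val := by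
  rcases eq_or_ne (seriesNorm m β ρ σ π val) ⊤ with htop | hfin
  · rw [htop]; exact le_top
  have hsum := summable_monoNorm h hβ hβ' hP hρ hfin
  -- Repeated monomials are collected into one coefficient; the triangle inequality on each fibre of
  -- `π` shows that this does not increase the norm.
  let c : MonoIndex → ℂ := fun n => ∑' t : π ⁻¹' {n}, val t
  have hc : IsTaylorFourier ρ σ f c := by
    intro x hx
    have h1 := (Equiv.sigmaFiberEquiv π).hasSum_iff.2 (hf x hx)
    refine h1.sigma fun n => ?_
    have hs : Summable fun t : {t // π t = n} => val t * monomialFun (π t) x :=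
      (hf x hx).summable.subtype _
    have he : (fun t : {t // π t = n} => val t * monomialFun (π t) x) =
        fun t : {t // π t = n} => val t * monomialFun n x := funext fun t => by rw [t.2]
    have hgoal : HasSum (fun t : {t // π t = n} => val t * monomialFun (π t) x)
        (c n * monomialFun n x) := by
      rw [he] at hs ⊢
      have : (∑' t : {t // π t = n}, val t) * monomialFun n x =
          ∑' t : {t // π t = n}, val t * monomialFun n x := tsum_mul_right.symm
      change HasSum _ ((∑' t : {t // π t = n}, val t) * monomialFun n x)
      rw [this]
      exact hs.hasSum
    exact hgoal
  refine (iInf₂_le c hc).trans ?_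
  rw [coeffNorm_eq_seriesNorm h.pos]
  refine iSup_mono fun j => ?_
  rw [← ENNReal.tsum_fiberwise _ π]
  refine ENNReal.tsum_le_tsum fun n => ?_
  have hcn : ∀ n, ENNReal.ofReal (termWeight m β ρ σ ‖c n‖ n) ≤
      ∑' t : π ⁻¹' {n}, ENNReal.ofReal (termWeight m β ρ σ ‖val t‖ (π t)) := by
    intro n
    have hw : 0 ≤ monoNorm ρ σ n / blockMass m β (monoSupport n) :=
      div_nonneg (monoNorm_nonneg hρ n) (h.blockMass_pos _ _).le
    have e1 : ∀ b : ℂ, ENNReal.ofReal (termWeight m β ρ σ ‖b‖ n) =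
        ‖b‖ₑ * ENNReal.ofReal (monoNorm ρ σ n / blockMass m β (monoSupport n)) := fun b => by
      rw [termWeight, mul_div_assoc, ENNReal.ofReal_mul (norm_nonneg _), ofReal_norm]
    have e2 : ∀ t : π ⁻¹' {n}, ENNReal.ofReal (termWeight m β ρ σ ‖val t‖ (π t)) =
        ‖val t‖ₑ * ENNReal.ofReal (monoNorm ρ σ n / blockMass m β (monoSupport n)) := fun t => by
      have : π t = n := t.2
      rw [this, e1]
    simp_rw [e2]
    rw [e1, ENNReal.tsum_mul_right]
    gcongr
    exact enorm_tsum_le_tsum_enorm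
  have e3 : ∀ t : π ⁻¹' {n}, (if monoTop (π t) = j then
      ENNReal.ofReal (termWeight m β ρ σ ‖val t‖ (π t)) else 0) = if monoTop n = j then
      ENNReal.ofReal (termWeight m β ρ σ ‖val t‖ (π t)) else 0 := fun t => by
    have : π t = n := t.2
    rw [this]
  simp_rw [e3]
  simp only [id]
  split_ifs
  · exact hcn n
  · exact zero_le

end

/-! ### Termwise differentiation of Taylor-Fourier series -/

section Termwise

variable {ρ σ : ℝ} {f : Phase → ℂ} {c : MonoIndex → ℂ}

theorem hasFDerivAt_of_isTaylorFourier (hc : Summable fun p => ‖c p‖ * monoNorm ρ σ p)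
    (hf : IsTaylorFourier ρ σ f c) {x : Phase} (hx : x ∈ domainQ ρ σ) :
    ∃ T : Phase →L[ℂ] ℂ, HasFDerivAt f T x ∧
      ∀ v, HasSum (fun p => c p * fderiv ℂ (monomialFun p) x v) (T v) := by
  have h1 := hasFDerivAt_tsum_of_norm_le (f := fun p y => c p * monomialFun p y)
    (isOpen_domainQ ρ σ) hc
    (fun p => ((differentiable_monomialFun p).const_mul (c p)).differentiableOn)
    (fun p y hy => by
      rw [norm_mul]
      exact mul_le_mul_of_nonneg_left (norm_monomialFun_le hy p) (norm_nonneg _)) hx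
  refine ⟨_, h1.1.congr_of_eventuallyEq ?_, fun v => ?_⟩
  · filter_upwards [(isOpen_domainQ ρ σ).mem_nhds hx] with y hy using (hf y hy).tsum_eq.symm
  · have h2 := (h1.2.of_norm.hasSum).mapL (ContinuousLinearMap.apply ℂ ℂ v)
    refine h2.congr_fun fun p => ?_
    simp only [ContinuousLinearMap.apply_apply]
    rw [fderiv_const_mul (differentiable_monomialFun p x)]
    simp

theorem hasSum_fderiv (hc : Summable fun p => ‖c p‖ * monoNorm ρ σ p)
    (hf : IsTaylorFourier ρ σ f c) {x : Phase} (hx : x ∈ domainQ ρ σ) (v : Phase) :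
    HasSum (fun p => c p * fderiv ℂ (monomialFun p) x v) (fderiv ℂ f x v) := by
  obtain ⟨T, hT, h⟩ := hasFDerivAt_of_isTaylorFourier hc hf hx
  rw [hT.fderiv]
  exact h v

theorem hasSum_dAngle (hc : Summable fun p => ‖c p‖ * monoNorm ρ σ p)
    (hf : IsTaylorFourier ρ σ f c) {x : Phase} (hx : x ∈ domainQ ρ σ) (j : ℕ) :
    HasSum (fun p => c p * monoAngle j p x) (dAngle j f x) := by
  simp_rw [← dAngle_monomialFun]
  exact hasSum_fderiv hc hf hx _

theorem hasSum_dAction (hc : Summable fun p => ‖c p‖ * monoNorm ρ σ p)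
    (hf : IsTaylorFourier ρ σ f c) {x : Phase} (hx : x ∈ domainQ ρ σ) (j : ℕ) :
    HasSum (fun p => c p * monoAction j p x) (dAction j f x) := by
  simp_rw [← dAction_monomialFun]
  exact hasSum_fderiv hc hf hx _

/-- The differential of a convergent Taylor-Fourier series is given by its partial derivatives. -/
theorem hasSum_partial_mul (hc : Summable fun p => ‖c p‖ * monoNorm ρ σ p)
    (hf : IsTaylorFourier ρ σ f c) {x : Phase} (hx : x ∈ domainQ ρ σ) (v : Phase) :
    HasSum (fun j => dAngle j f x * v.1 j + dAction j f x * v.2 j) (fderiv ℂ f x v) := by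
  obtain ⟨δ, hδ, hxδ, hδρ, hδσ⟩ := exists_mem_smaller_domainQ hx
  have hρδ : 0 ≤ ρ - δ := by linarith
  have hρ : 0 ≤ ρ := by linarith
  -- Summing this double family over monomials first gives the partial derivatives, over indices
  -- first the termwise differential. The shares make it absolutely summable, so both orders agree.
  let F : ℕ × MonoIndex → ℂ := fun t =>
    c t.2 * (monoAngle t.1 t.2 x * v.1 t.1 + monoAction t.1 t.2 x * v.2 t.1)
  have hbound : ∀ t : ℕ × MonoIndex, ‖F t‖ ≤ δ⁻¹ * ‖v‖ * (‖c t.2‖ * monoNorm ρ σ t.2) *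
      (freqShare t.1 t.2 + expShare t.1 t.2) := by
    rintro ⟨j, p⟩
    have h1 := norm_monoAngle_le (σ' := σ) hρδ (by linarith : ρ - δ ≤ ρ) (by linarith) hxδ j p
    have h2 := norm_monoAction_le (ρ' := ρ) hρδ (by linarith) (by linarith : σ - δ ≤ σ) hxδ j p
    rw [sub_sub_cancel] at h1 h2
    have h3 : ‖v.1 j‖ ≤ ‖v‖ := (norm_coord_le _ _).trans (norm_fst_le v)
    have h4 : ‖v.2 j‖ ≤ ‖v‖ := (norm_coord_le _ _).trans (norm_snd_le v)
    have h5 := monoNorm_nonneg (σ := σ) hρ p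
    have h6 := freqShare_nonneg j p
    have h7 := expShare_nonneg j p
    simp only [F]
    rw [norm_mul]
    calc ‖c p‖ * ‖monoAngle j p x * v.1 j + monoAction j p x * v.2 j‖
        ≤ ‖c p‖ * (‖monoAngle j p x‖ * ‖v.1 j‖ + ‖monoAction j p x‖ * ‖v.2 j‖) := by
          refine mul_le_mul_of_nonneg_left ((norm_add_le _ _).trans_eq ?_) (norm_nonneg _)
          rw [norm_mul, norm_mul]
      _ ≤ ‖c p‖ * (δ⁻¹ * freqShare j p * monoNorm ρ σ p * ‖v‖ +
            δ⁻¹ * expShare j p * monoNorm ρ σ p * ‖v‖) := by gcongr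
      _ = _ := by ring
  have hsum : Summable F := by
    refine Summable.of_norm (summable_of_sum_le (c := δ⁻¹ * ‖v‖ * 2 *
      ∑' p, ‖c p‖ * monoNorm ρ σ p) (fun _ => norm_nonneg _) fun u => ?_)
    have hnn : ∀ p, 0 ≤ ‖c p‖ * monoNorm ρ σ p := fun p =>
      mul_nonneg (norm_nonneg _) (monoNorm_nonneg hρ p)
    calc ∑ t ∈ u, ‖F t‖ ≤ ∑ t ∈ u.image Prod.fst ×ˢ u.image Prod.snd, ‖F t‖ :=
          Finset.sum_le_sum_of_subset_of_nonneg Finset.subset_product fun _ _ _ => norm_nonneg _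
      _ ≤ ∑ t ∈ u.image Prod.fst ×ˢ u.image Prod.snd, δ⁻¹ * ‖v‖ * (‖c t.2‖ * monoNorm ρ σ t.2) *
            (freqShare t.1 t.2 + expShare t.1 t.2) := Finset.sum_le_sum fun t _ => hbound t
      _ = ∑ p ∈ u.image Prod.snd, δ⁻¹ * ‖v‖ * (‖c p‖ * monoNorm ρ σ p) *
            (∑ j ∈ u.image Prod.fst, freqShare j p + ∑ j ∈ u.image Prod.fst, expShare j p) := by
          rw [Finset.sum_product_right]
          refine Finset.sum_congr rfl fun p _ => ?_
          rw [← Finset.sum_add_distrib, Finset.mul_sum]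
      _ ≤ ∑ p ∈ u.image Prod.snd, δ⁻¹ * ‖v‖ * (‖c p‖ * monoNorm ρ σ p) * (1 + 1) := by
          refine Finset.sum_le_sum fun p _ => ?_
          refine mul_le_mul_of_nonneg_left
            (add_le_add (sum_freqShare_le _ p) (sum_expShare_le _ p)) ?_
          have := hnn p
          positivity
      _ = δ⁻¹ * ‖v‖ * 2 * ∑ p ∈ u.image Prod.snd, ‖c p‖ * monoNorm ρ σ p := by
          rw [Finset.mul_sum]
          exact Finset.sum_congr rfl fun p _ => by ring
      _ ≤ _ := by
          gcongr
          exact hc.sum_le_tsum _ fun p _ => hnn p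
  have h1 : ∀ j, HasSum (fun p => F (j, p)) (dAngle j f x * v.1 j + dAction j f x * v.2 j) := by
    intro j
    refine (((hasSum_dAngle hc hf hx j).mul_right (v.1 j)).add
      ((hasSum_dAction hc hf hx j).mul_right (v.2 j))).congr_fun fun p => ?_
    simp only [F]; ring
  have h2 : ∀ p, HasSum (fun j => F (j, p)) (c p * fderiv ℂ (monomialFun p) x v) := by
    intro p
    rw [fderiv_monomialFun, Finset.mul_sum]
    refine hasSum_sum_of_ne_finset_zero fun j hj => ?_
    simp only [F]
    rw [monoAngle_eq_zero hj, monoAction_eq_zero hj]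
    simp
  have h3 := hsum.hasSum.prod_fiberwise h1
  have h4 := ((Equiv.prodComm _ _).hasSum_iff.2 hsum.hasSum :
    HasSum (F ∘ Prod.swap) (∑' t, F t)).prod_fiberwise h2
  rwa [h4.unique (hasSum_fderiv hc hf hx v)] at h3

end Termwise

/-! ### Summation over pairs of monomials and a common index -/

section BracketSums

variable {A B : MonoIndex → ℝ≥0∞} {U : ℕ → MonoIndex → ℝ≥0∞} {R : ℕ → ℕ → ℝ≥0∞} {θ : ℝ≥0∞}

/-- The supremum over `j` of the sums over the monomials with largest index `j`. -/
def supTop (A : MonoIndex → ℝ≥0∞) : ℝ≥0∞ := ⨆ j, ∑' p, if monoTop p = j then A p else 0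

/-- The case in which the result inherits the largest index of `q`. The share in `p` is bounded
trivially, so that `p` can be summed against the ratio uniformly in `i`; the share in `q` then pays
for the sum over `i`. -/
theorem tsum_shares_right_le (hU : ∀ i p, U i p ≤ 2) (hUs : ∀ p, ∑' i, U i p ≤ 2)
    (hR : ∀ i, ∑' a, R a i ≤ θ) (e : ℕ) :
    ∑' (i : ℕ) (p : MonoIndex) (q : MonoIndex),
      (if monoTop q = e then A p * B q * (U i p * U i q) * R (monoTop p) i else 0) ≤
        4 * θ * supTop A * supTop B := by
  have h1 : ∀ i, ∑' (p : MonoIndex), R (monoTop p) i * A p ≤ θ * supTop A := fun i =>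
    (tsum_mul_le_tsum_mul_iSup monoTop (fun a => R a i) A).trans (by unfold supTop; gcongr; exact hR i)
  calc _ ≤ ∑' (i : ℕ) (p : MonoIndex) (q : MonoIndex),
        2 * (R (monoTop p) i * A p) * ((if monoTop q = e then B q else 0) * U i q) := by
        refine ENNReal.tsum_le_tsum fun i => ENNReal.tsum_le_tsum fun p =>
          ENNReal.tsum_le_tsum fun q => ?_
        split_ifs
        · calc A p * B q * (U i p * U i q) * R (monoTop p) i
              ≤ A p * B q * (2 * U i q) * R (monoTop p) i := by gcongr; exact hU i p
            _ = _ := by ring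
        · exact zero_le
    _ = ∑' i, 2 * (∑' p, R (monoTop p) i * A p) *
          ∑' q, (if monoTop q = e then B q else 0) * U i q := by
        refine tsum_congr fun i => ?_
        simp_rw [ENNReal.tsum_mul_left, ENNReal.tsum_mul_right]
        rw [ENNReal.tsum_mul_left]
    _ ≤ ∑' i, 2 * (θ * supTop A) * ∑' q, (if monoTop q = e then B q else 0) * U i q := by
        refine ENNReal.tsum_le_tsum fun i => ?_
        gcongr
        exact h1 i
    _ = 2 * (θ * supTop A) * ∑' q, (if monoTop q = e then B q else 0) * ∑' i, U i q := by
        rw [ENNReal.tsum_mul_left, ENNReal.tsum_comm]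
        congr 1
        exact tsum_congr fun q => ENNReal.tsum_mul_left
    _ ≤ 2 * (θ * supTop A) * ∑' q, (if monoTop q = e then B q else 0) * 2 := by
        gcongr with q
        exact hUs q
    _ ≤ 2 * (θ * supTop A) * (supTop B * 2) := by
        rw [ENNReal.tsum_mul_right]
        gcongr
        exact le_iSup (fun j => ∑' p, if monoTop p = j then B p else 0) e
    _ = _ := by ring

/-- The case of a common largest index, which may have been lost. The ratio no longer involves `i`,
so the sum over `i` is taken first, then `q` at the level of `p`, and finally `p` against the ratio.
-/
theorem tsum_shares_diag_le (hU : ∀ i p, U i p ≤ 2) (hUs : ∀ p, ∑' i, U i p ≤ 2)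
    (hR : ∀ i, ∑' a, R a i ≤ θ) (e : ℕ) :
    ∑' (i : ℕ) (p : MonoIndex) (q : MonoIndex),
      (if monoTop p = monoTop q then A p * B q * (U i p * U i q) * R (monoTop p) e else 0) ≤
        4 * θ * supTop A * supTop B := by
  have h1 : ∑' (p : MonoIndex), R (monoTop p) e * A p ≤ θ * supTop A :=
    (tsum_mul_le_tsum_mul_iSup monoTop (fun a => R a e) A).trans (by unfold supTop; gcongr; exact hR e)
  calc _ = ∑' (p : MonoIndex) (q : MonoIndex) (i : ℕ),
        (if monoTop p = monoTop q then A p * B q * (U i p * U i q) * R (monoTop p) e else 0) := by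
        rw [ENNReal.tsum_comm]
        exact tsum_congr fun p => ENNReal.tsum_comm
    _ ≤ ∑' (p : MonoIndex) (q : MonoIndex) (i : ℕ),
        2 * (R (monoTop p) e * A p) * (if monoTop q = monoTop p then B q else 0) * U i q := by
        refine ENNReal.tsum_le_tsum fun p => ENNReal.tsum_le_tsum fun q =>
          ENNReal.tsum_le_tsum fun i => ?_
        simp only [eq_comm (a := monoTop q)]
        split_ifs
        · calc A p * B q * (U i p * U i q) * R (monoTop p) e
              ≤ A p * B q * (2 * U i q) * R (monoTop p) e := by gcongr; exact hU i p
            _ = _ := by ring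
        · exact zero_le
    _ ≤ ∑' (p : MonoIndex) (q : MonoIndex),
        2 * (R (monoTop p) e * A p) * (if monoTop q = monoTop p then B q else 0) * 2 := by
        refine ENNReal.tsum_le_tsum fun p => ENNReal.tsum_le_tsum fun q => ?_
        rw [ENNReal.tsum_mul_left]
        gcongr
        exact hUs q
    _ = ∑' p, 2 * (R (monoTop p) e * A p) * (∑' q, if monoTop q = monoTop p then B q else 0) * 2 := by
        refine tsum_congr fun p => ?_
        rw [ENNReal.tsum_mul_right, ENNReal.tsum_mul_left]
    _ ≤ ∑' p, 2 * (R (monoTop p) e * A p) * supTop B * 2 := by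
        refine ENNReal.tsum_le_tsum fun p => ?_
        gcongr
        exact le_iSup (fun j => ∑' p, if monoTop p = j then B p else 0) (monoTop p)
    _ = 2 * (∑' p, R (monoTop p) e * A p) * supTop B * 2 := by
        rw [ENNReal.tsum_mul_right, ENNReal.tsum_mul_right, ENNReal.tsum_mul_left]
    _ ≤ 2 * (θ * supTop A) * supTop B * 2 := by gcongr
    _ = _ := by ring

end BracketSums

/-! ### Coefficients of the bracket and their estimate -/

section BracketCoefficients

/-- The monomial produced by the `t.1`-th term of the bracket of the monomials `t.2.1`, `t.2.2`. -/
def bracketTarget (t : ℕ × MonoIndex × MonoIndex) : MonoIndex :=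
  (t.2.1.1 + t.2.2.1, t.2.1.2 + t.2.2.2 - Finsupp.single t.1 1)

/-- The coefficient of the `t.1`-th term of the bracket of the monomials `t.2.1`, `t.2.2`. -/
def bracketCoeff (m : ℕ → ℝ) (c d : MonoIndex → ℂ) (t : ℕ × MonoIndex × MonoIndex) : ℂ :=
  ((m t.1)⁻¹ : ℂ) * (Complex.I * ((t.2.1.1 t.1 : ℂ) * (t.2.2.2 t.1 : ℂ) -
    (t.2.1.2 t.1 : ℂ) * (t.2.2.1 t.1 : ℂ))) * (c t.2.1 * d t.2.2)

theorem monomialFun_add (p q : MonoIndex) (x : Phase) :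
    monomialFun (p + q) x = monomialFun p x * monomialFun q x := by
  unfold monomialFun
  rw [Prod.snd_add, Prod.fst_add, Finsupp.prod_add_index' (by simp) (by intros; exact pow_add _ _ _),
    Finsupp.sum_add_index' (by simp) (by intros; push_cast; ring), mul_add, Complex.exp_add]
  ring

/-- Both products of the bracket yield the same monomial. The truncated subtraction in
`bracketTarget` is harmless: when the differentiated exponent is zero, so is the corresponding
coefficient. -/
theorem bracketCoeff_mul_monomialFun (m : ℕ → ℝ) (c d : MonoIndex → ℂ) (i : ℕ) (p q : MonoIndex)
    (x : Phase) :
    bracketCoeff m c d (i, p, q) * monomialFun (bracketTarget (i, p, q)) x =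
      ((m i)⁻¹ : ℂ) * ((c p * monoAngle i p x) * (d q * monoAction i q x) -
        (c p * monoAction i p x) * (d q * monoAngle i q x)) := by
  have h1 : monoAngle i p x * monoAction i q x =
      Complex.I * ((p.1 i : ℂ) * (q.2 i : ℂ)) * monomialFun (bracketTarget (i, p, q)) x := by
    rcases eq_or_ne (q.2 i) 0 with h0 | h0
    · simp [monoAction, h0]
    · have : bracketTarget (i, p, q) = p + (q.1, q.2 - Finsupp.single i 1) := by
        have h2 : Finsupp.single i 1 ≤ q.2 := by rw [Finsupp.single_le_iff]; omega
        rw [bracketTarget, add_tsub_assoc_of_le h2]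
        rfl
      rw [this, monomialFun_add, monoAngle, monoAction]
      ring
  have h2 : monoAction i p x * monoAngle i q x =
      Complex.I * ((p.2 i : ℂ) * (q.1 i : ℂ)) * monomialFun (bracketTarget (i, p, q)) x := by
    rcases eq_or_ne (p.2 i) 0 with h0 | h0
    · simp [monoAction, h0]
    · have : bracketTarget (i, p, q) = (p.1, p.2 - Finsupp.single i 1) + q := by
        have h2 : Finsupp.single i 1 ≤ p.2 := by rw [Finsupp.single_le_iff]; omega
        rw [bracketTarget]
        simp only
        rw [← tsub_add_eq_add_tsub h2]
        rfl
      rw [this, monomialFun_add, monoAngle, monoAction]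
      ring
  calc _ = ((m i)⁻¹ : ℂ) * (c p * d q) *
        (Complex.I * ((p.1 i : ℂ) * (q.2 i : ℂ)) * monomialFun (bracketTarget (i, p, q)) x -
          Complex.I * ((p.2 i : ℂ) * (q.1 i : ℂ)) * monomialFun (bracketTarget (i, p, q)) x) := by
        rw [bracketCoeff]; ring
    _ = _ := by rw [← h1, ← h2]; ring

theorem le_exponentSize (a : ℕ →₀ ℕ) (i : ℕ) : a i ≤ exponentSize a := by
  by_cases h : i ∈ a.support
  · exact Finset.single_le_sum (f := fun n => a n) (fun _ _ => Nat.zero_le _) h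
  · rw [Finsupp.notMem_support_iff.1 h]; exact Nat.zero_le _

theorem mem_monoSupport {p : MonoIndex} {n : ℕ} : n ∈ monoSupport p ↔ p.1 n ≠ 0 ∨ p.2 n ≠ 0 := by
  simp [monoSupport]

/-- The share of an index in the total degree of a monomial. -/
def share (i : ℕ) (p : MonoIndex) : ℝ := freqShare i p + expShare i p

theorem share_nonneg (i : ℕ) (p : MonoIndex) : 0 ≤ share i p :=
  add_nonneg (freqShare_nonneg i p) (expShare_nonneg i p)

theorem monoNorm_bracketTarget_le {ρ σ : ℝ} (hρ : 0 ≤ ρ) (hσ : 0 ≤ σ) (i : ℕ) (p q : MonoIndex)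
    (h : q.2 i ≠ 0) : monoNorm ρ σ (bracketTarget (i, p, q)) ≤
      monoNorm ρ σ p * (ρ ^ (exponentSize q.2 - 1) * Real.exp (σ * frequencySize q.1)) := by
  have h1 : exponentSize (p.2 + q.2 - Finsupp.single i 1) =
      exponentSize p.2 + (exponentSize q.2 - 1) := by
    have := le_exponentSize q.2 i
    rw [exponentSize_sub_single (by simp; omega), exponentSize_add]
    omega
  have h2 := frequencySize_add_le p.1 q.1
  have h3 : (frequencySize (p.1 + q.1) : ℝ) ≤ frequencySize p.1 + frequencySize q.1 := by
    exact_mod_cast h2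
  unfold monoNorm bracketTarget
  simp only
  rw [h1, pow_add]
  calc _ ≤ ρ ^ exponentSize p.2 * ρ ^ (exponentSize q.2 - 1) *
        Real.exp (σ * (frequencySize p.1 + frequencySize q.1)) := by gcongr
    _ = _ := by rw [mul_add, Real.exp_add]; ring

theorem bracketTarget_comm (i : ℕ) (p q : MonoIndex) :
    bracketTarget (i, p, q) = bracketTarget (i, q, p) := by
  simp only [bracketTarget, add_comm]

/-- A Cauchy estimate for one half of a bracket term. -/
theorem freq_mul_exponent_mul_monoNorm_le {ρ₁ σ₁ ρ σ ρ' σ' : ℝ} (hρ₁ : 0 ≤ ρ₁) (hσ₁ : 0 ≤ σ₁)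
    (hρ : ρ₁ ≤ ρ) (hσ : σ₁ < σ) (hρ' : ρ₁ < ρ') (hσ' : σ₁ ≤ σ') (i : ℕ) (p q : MonoIndex) :
    (p.1 i).natAbs * q.2 i * monoNorm ρ₁ σ₁ (bracketTarget (i, p, q)) ≤
      (σ - σ₁)⁻¹ * (ρ' - ρ₁)⁻¹ * (freqShare i p * expShare i q) *
        (monoNorm ρ σ p * monoNorm ρ' σ' q) := by
  have hs : 0 ≤ (σ - σ₁)⁻¹ := inv_nonneg.2 (sub_pos.2 hσ).le
  have hr : 0 ≤ (ρ' - ρ₁)⁻¹ := inv_nonneg.2 (sub_pos.2 hρ').le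
  have h1 := freqShare_nonneg i p
  have h2 := expShare_nonneg i q
  have h3 := monoNorm_nonneg (σ := σ) (hρ₁.trans hρ) p
  have h4 := monoNorm_nonneg (σ := σ') (hρ₁.trans hρ'.le) q
  rcases eq_or_ne (q.2 i) 0 with h0 | h0
  · rw [h0]
    simp only [CharP.cast_eq_zero, mul_zero, zero_mul]
    positivity
  have h5 := monoNorm_nonneg (σ := σ₁) hρ₁ p
  calc _ ≤ (p.1 i).natAbs * q.2 i * (monoNorm ρ₁ σ₁ p *
        (ρ₁ ^ (exponentSize q.2 - 1) * Real.exp (σ₁ * frequencySize q.1))) := by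
        gcongr
        exact monoNorm_bracketTarget_le hρ₁ hσ₁ i p q h0
    _ = ((p.1 i).natAbs * monoNorm ρ₁ σ₁ p) *
          (q.2 i * (ρ₁ ^ (exponentSize q.2 - 1) * Real.exp (σ₁ * frequencySize q.1))) := by ring
    _ ≤ ((σ - σ₁)⁻¹ * freqShare i p * monoNorm ρ σ p) *
          ((ρ' - ρ₁)⁻¹ * expShare i q * monoNorm ρ' σ' q) :=
        mul_le_mul (frequency_mul_monoNorm_le hρ₁ hρ hσ i p) (exponent_mul_monoNorm_le hρ₁ hρ' hσ' i q)
          (by positivity) (by positivity)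
    _ = _ := by ring

variable {m : ℕ → ℝ} {β₁ P Θ S β ρ₁ σ₁ ρ σ ρ' σ' L : ℝ} {c d : MonoIndex → ℂ}

/-- In each product one factor is differentiated in the angle and the other in the action, hence one
loss of width times one of radius. Since `d` is measured on the larger domain, its Cauchy estimate
has the larger distance; this is the origin of the two entries of `lossConst`. -/
theorem norm_bracketCoeff_mul_monoNorm_le (hm : ∀ i, 0 < m i) (hρ₁ : 0 ≤ ρ₁) (hσ₁ : 0 ≤ σ₁)
    (hρ : ρ₁ < ρ) (hσ : σ₁ < σ) (hρ' : ρ ≤ ρ') (hσ' : σ ≤ σ')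
    (hL : (σ - σ₁)⁻¹ * (ρ' - ρ₁)⁻¹ ≤ L) (hL' : (ρ - ρ₁)⁻¹ * (σ' - σ₁)⁻¹ ≤ L)
    (i : ℕ) (p q : MonoIndex) :
    ‖bracketCoeff m c d (i, p, q)‖ * monoNorm ρ₁ σ₁ (bracketTarget (i, p, q)) ≤
      (m i)⁻¹ * L * (share i p * share i q) *
        (‖c p‖ * monoNorm ρ σ p * (‖d q‖ * monoNorm ρ' σ' q)) := by
  have h1 := freq_mul_exponent_mul_monoNorm_le hρ₁ hσ₁ hρ.le hσ (hρ.trans_le hρ')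
    (hσ.le.trans hσ') i p q
  have h2 := freq_mul_exponent_mul_monoNorm_le hρ₁ hσ₁ (hρ.le.trans hρ') (hσ.trans_le hσ') hρ hσ.le
    i q p
  rw [bracketTarget_comm] at h2
  have n1 := monoNorm_nonneg (σ := σ) (hρ₁.trans hρ.le) p
  have n2 := monoNorm_nonneg (σ := σ') ((hρ₁.trans hρ.le).trans hρ') q
  have n3 := monoNorm_nonneg (σ := σ₁) hρ₁ (bracketTarget (i, p, q))
  have f1 := freqShare_nonneg i p
  have f2 := expShare_nonneg i p
  have f3 := freqShare_nonneg i q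
  have f4 := expShare_nonneg i q
  have hmi := inv_pos.2 (hm i)
  have hL0 : 0 ≤ L := le_trans (by
    have := (sub_pos.2 hσ).le
    have := (sub_pos.2 (hρ.trans_le hρ')).le
    positivity) hL
  have h3 : ‖bracketCoeff m c d (i, p, q)‖ ≤
      (m i)⁻¹ * ((p.1 i).natAbs * q.2 i + (q.1 i).natAbs * p.2 i) * (‖c p‖ * ‖d q‖) := by
    rw [bracketCoeff, norm_mul, norm_mul, norm_mul, norm_mul, Complex.norm_I, one_mul, norm_inv,
      Complex.norm_real, Real.norm_of_nonneg (hm i).le]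
    gcongr
    refine (norm_sub_le _ _).trans_eq ?_
    simp only [norm_mul, Complex.norm_intCast, Complex.norm_natCast, Nat.cast_natAbs, Int.cast_abs]
    ring
  calc _ ≤ (m i)⁻¹ * ((p.1 i).natAbs * q.2 i + (q.1 i).natAbs * p.2 i) * (‖c p‖ * ‖d q‖) *
        monoNorm ρ₁ σ₁ (bracketTarget (i, p, q)) := by gcongr
    _ = (m i)⁻¹ * (‖c p‖ * ‖d q‖) *
          ((p.1 i).natAbs * q.2 i * monoNorm ρ₁ σ₁ (bracketTarget (i, p, q)) +
            (q.1 i).natAbs * p.2 i * monoNorm ρ₁ σ₁ (bracketTarget (i, p, q))) := by ring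
    _ ≤ (m i)⁻¹ * (‖c p‖ * ‖d q‖) *
          (L * (freqShare i p * expShare i q) * (monoNorm ρ σ p * monoNorm ρ' σ' q) +
            L * (freqShare i q * expShare i p) * (monoNorm ρ σ p * monoNorm ρ' σ' q)) := by
        refine mul_le_mul_of_nonneg_left (add_le_add (h1.trans ?_) (h2.trans ?_)) (by positivity)
        · gcongr
        · rw [mul_comm (monoNorm ρ' σ' q), mul_comm (σ' - σ₁)⁻¹]
          gcongr
    _ = (m i)⁻¹ * L * (freqShare i p * expShare i q + freqShare i q * expShare i p) *
          (‖c p‖ * monoNorm ρ σ p * (‖d q‖ * monoNorm ρ' σ' q)) := by ring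
    _ ≤ _ := by
        have : freqShare i p * expShare i q + freqShare i q * expShare i p ≤ share i p * share i q := by
          unfold share
          nlinarith [mul_nonneg f1 f3, mul_nonneg f2 f4]
        gcongr

/-- Exponents add up and drop only at `i`. Any other index can disappear only by cancellation of
opposite nonzero frequencies, so it lies in both supports. -/
theorem support_of_bracketCoeff_ne_zero {i : ℕ} {p q : MonoIndex}
    (h : bracketCoeff m c d (i, p, q) ≠ 0) :
    i ∈ monoSupport p ∧ i ∈ monoSupport q ∧
      monoSupport (bracketTarget (i, p, q)) ⊆ monoSupport p ∪ monoSupport q ∧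
      (monoSupport p ∪ monoSupport q) \ monoSupport (bracketTarget (i, p, q)) ⊆
        monoSupport p ∩ monoSupport q := by
  have h0 : i ∈ monoSupport p ∧ i ∈ monoSupport q := by
    simp only [mem_monoSupport]
    by_contra hcon
    refine h ?_
    rw [not_and_or, not_or, not_or, not_not, not_not, not_not, not_not] at hcon
    rcases hcon with ⟨h1, h2⟩ | ⟨h1, h2⟩ <;> simp [bracketCoeff, h1, h2]
  refine ⟨h0.1, h0.2, fun n hn => ?_, fun n hn => ?_⟩
  · rw [Finset.mem_union, mem_monoSupport, mem_monoSupport]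
    rw [mem_monoSupport] at hn
    by_contra hcon
    rw [not_or, not_or, not_or, not_not, not_not, not_not, not_not] at hcon
    obtain ⟨⟨h1, h2⟩, h3, h4⟩ := hcon
    simp [bracketTarget, h1, h2, h3, h4] at hn
  · rcases eq_or_ne n i with rfl | hni
    · exact Finset.mem_inter.2 h0
    rw [Finset.mem_sdiff, Finset.mem_union, mem_monoSupport, mem_monoSupport, mem_monoSupport] at hn
    rw [Finset.mem_inter, mem_monoSupport, mem_monoSupport]
    obtain ⟨h1, h2⟩ := hn
    simp only [bracketTarget, Finsupp.add_apply, Finsupp.tsub_apply,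
      Finsupp.single_eq_of_ne hni] at h2
    omega

/-- The bound of a single bracket term in the weighted norm. -/
theorem termWeight_bracket_le (h : MassBounds m β₁ P Θ S) (hP : 1 ≤ P) (hβ : 0 < β) (hβ' : β ≤ β₁)
    (hρ₁ : 0 ≤ ρ₁) (hσ₁ : 0 ≤ σ₁) (hρ : ρ₁ < ρ) (hσ : σ₁ < σ) (hρ' : ρ ≤ ρ') (hσ' : σ ≤ σ')
    (hL : (σ - σ₁)⁻¹ * (ρ' - ρ₁)⁻¹ ≤ L) (hL' : (ρ - ρ₁)⁻¹ * (σ' - σ₁)⁻¹ ≤ L)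
    (i : ℕ) (p q : MonoIndex) :
    termWeight m β ρ₁ σ₁ ‖bracketCoeff m c d (i, p, q)‖ (bracketTarget (i, p, q)) ≤
      P ^ 3 * L * (termWeight m β ρ σ ‖c p‖ p * termWeight m β ρ' σ' ‖d q‖ q *
        (share i p * share i q) *
        ((if monoTop (bracketTarget (i, p, q)) = monoTop q then massRatio m β₁ (monoTop p) i else 0) +
         (if monoTop (bracketTarget (i, p, q)) = monoTop p then massRatio m β₁ (monoTop q) i else 0) +
         (if monoTop p = monoTop q then
            massRatio m β₁ (monoTop p) (monoTop (bracketTarget (i, p, q))) else 0))) := by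
  have hL0 : 0 ≤ L := le_trans (by
    have := (sub_pos.2 hσ).le
    have := (sub_pos.2 (hρ.trans_le hρ')).le
    positivity) hL
  have hnn : ∀ (e : Prop) [Decidable e] (a b : ℕ), 0 ≤ if e then massRatio m β₁ a b else 0 :=
    fun e _ a b => by
      split_ifs
      exacts [massRatio_nonneg h.pos _ _ _, le_rfl]
  set χ := (if monoTop (bracketTarget (i, p, q)) = monoTop q then massRatio m β₁ (monoTop p) i else 0) +
         (if monoTop (bracketTarget (i, p, q)) = monoTop p then massRatio m β₁ (monoTop q) i else 0) +
         (if monoTop p = monoTop q then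
            massRatio m β₁ (monoTop p) (monoTop (bracketTarget (i, p, q))) else 0) with hχ
  have hχ0 : 0 ≤ χ := add_nonneg (add_nonneg (hnn _ _ _) (hnn _ _ _)) (hnn _ _ _)
  have t1 := termWeight_nonneg h.pos (β := β) (σ := σ) (hρ₁.trans hρ.le) (norm_nonneg (c p)) p
  have t2 := termWeight_nonneg h.pos (β := β) (σ := σ') ((hρ₁.trans hρ.le).trans hρ')
    (norm_nonneg (d q)) q
  have s1 := share_nonneg i p
  have s2 := share_nonneg i q
  rcases eq_or_ne (bracketCoeff m c d (i, p, q)) 0 with h0 | h0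
  · rw [h0, norm_zero, termWeight, zero_mul, zero_div]
    positivity
  obtain ⟨hip, hiq, hE, hE'⟩ := support_of_bracketCoeff_ne_zero h0
  have hA := h.blockMass_pos β (monoSupport p)
  have hB := h.blockMass_pos β (monoSupport q)
  have hC := h.blockMass_pos β (monoSupport (bracketTarget (i, p, q)))
  have hw := h.blockMass_mul_le hP hβ hβ' hip hiq hE hE'
  change _ ≤ P ^ 3 * _ * χ at hw
  have hn := norm_bracketCoeff_mul_monoNorm_le (c := c) (d := d) h.pos hρ₁ hσ₁ hρ hσ hρ' hσ' hL hL'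
    i p q
  have hmi := h.pos i
  have e1 : ‖c p‖ * monoNorm ρ σ p = termWeight m β ρ σ ‖c p‖ p * blockMass m β (monoSupport p) := by
    unfold termWeight; field_simp
  have e2 : ‖d q‖ * monoNorm ρ' σ' q =
      termWeight m β ρ' σ' ‖d q‖ q * blockMass m β (monoSupport q) := by
    unfold termWeight; field_simp
  rw [e1, e2] at hn
  rw [termWeight, div_le_iff₀ hC]
  refine hn.trans ?_
  calc _ = L * (share i p * share i q) * (termWeight m β ρ σ ‖c p‖ p * termWeight m β ρ' σ' ‖d q‖ q) *
        (blockMass m β (monoSupport p) * blockMass m β (monoSupport q) / m i) := by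
        field_simp
    _ ≤ L * (share i p * share i q) * (termWeight m β ρ σ ‖c p‖ p * termWeight m β ρ' σ' ‖d q‖ q) *
        (P ^ 3 * blockMass m β (monoSupport (bracketTarget (i, p, q))) * χ) := by gcongr
    _ = _ := by ring

theorem tsum_share_le (p : MonoIndex) : ∑' i, ENNReal.ofReal (share i p) ≤ 2 := by
  rw [ENNReal.tsum_eq_iSup_sum]
  refine iSup_le fun s => ?_
  rw [← ENNReal.ofReal_sum_of_nonneg fun i _ => share_nonneg i p]
  have h1 : ∑ i ∈ s, share i p ≤ 2 := by
    unfold share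
    rw [Finset.sum_add_distrib]
    linarith [sum_freqShare_le s p, sum_expShare_le s p]
  calc _ ≤ ENNReal.ofReal 2 := ENNReal.ofReal_le_ofReal h1
    _ = 2 := by simp

theorem share_le_two (i : ℕ) (p : MonoIndex) : ENNReal.ofReal (share i p) ≤ 2 :=
  (ENNReal.le_tsum i).trans (tsum_share_le p)

/-- The estimate of the Poisson bracket in terms of coefficients. -/
theorem seriesNorm_bracket_le (h : MassBounds m β₁ P Θ S) (hP : 1 ≤ P) (hβ : 0 < β) (hβ' : β ≤ β₁)
    (hρ₁ : 0 ≤ ρ₁) (hσ₁ : 0 ≤ σ₁) (hρ : ρ₁ < ρ) (hσ : σ₁ < σ) (hρ' : ρ ≤ ρ') (hσ' : σ ≤ σ')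
    (hL : (σ - σ₁)⁻¹ * (ρ' - ρ₁)⁻¹ ≤ L) (hL' : (ρ - ρ₁)⁻¹ * (σ' - σ₁)⁻¹ ≤ L) :
    seriesNorm m β ρ₁ σ₁ bracketTarget (bracketCoeff m c d) ≤
      ENNReal.ofReal (12 * P ^ 3 * Θ * L) * coeffNorm m β ρ σ c * coeffNorm m β ρ' σ' d := by
  have hL0 : 0 ≤ L := le_trans (by
    have := (sub_pos.2 hσ).le
    have := (sub_pos.2 (hρ.trans_le hρ')).le
    positivity) hL
  have hρ0 : 0 ≤ ρ := hρ₁.trans hρ.le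
  let A : MonoIndex → ℝ≥0∞ := fun p => ENNReal.ofReal (termWeight m β ρ σ ‖c p‖ p)
  let B : MonoIndex → ℝ≥0∞ := fun q => ENNReal.ofReal (termWeight m β ρ' σ' ‖d q‖ q)
  let U : ℕ → MonoIndex → ℝ≥0∞ := fun i p => ENNReal.ofReal (share i p)
  let R : ℕ → ℕ → ℝ≥0∞ := fun a i => ENNReal.ofReal (massRatio m β₁ a i)
  have hcA : coeffNorm m β ρ σ c = supTop A := coeffNorm_eq_seriesNorm h.pos _ _ _ _
  have hdB : coeffNorm m β ρ' σ' d = supTop B := coeffNorm_eq_seriesNorm h.pos _ _ _ _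
  rw [hcA, hdB]
  refine iSup_le fun e => ?_
  -- The three summands mirror the three cases of the weight comparison. The second is the first
  -- with the roles of the two monomials exchanged.
  have hterm : ∀ t : ℕ × MonoIndex × MonoIndex,
      (if monoTop (bracketTarget t) = e then
        ENNReal.ofReal (termWeight m β ρ₁ σ₁ ‖bracketCoeff m c d t‖ (bracketTarget t)) else 0) ≤
      ENNReal.ofReal (P ^ 3 * L) *
        ((if monoTop t.2.2 = e then
            A t.2.1 * B t.2.2 * (U t.1 t.2.1 * U t.1 t.2.2) * R (monoTop t.2.1) t.1 else 0) +
         (if monoTop t.2.1 = e then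
            B t.2.2 * A t.2.1 * (U t.1 t.2.2 * U t.1 t.2.1) * R (monoTop t.2.2) t.1 else 0) +
         (if monoTop t.2.1 = monoTop t.2.2 then
            A t.2.1 * B t.2.2 * (U t.1 t.2.1 * U t.1 t.2.2) * R (monoTop t.2.1) e else 0)) := by
    rintro ⟨i, p, q⟩
    by_cases he : monoTop (bracketTarget (i, p, q)) = e
    swap
    · rw [if_neg he]; exact zero_le
    rw [if_pos he]
    have h1 := termWeight_bracket_le (c := c) (d := d) h hP hβ hβ' hρ₁ hσ₁ hρ hσ hρ' hσ' hL hL' i p q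
    refine (ENNReal.ofReal_le_ofReal h1).trans_eq ?_
    have t1 := termWeight_nonneg h.pos (β := β) (σ := σ) hρ0 (norm_nonneg (c p)) p
    have t2 := termWeight_nonneg h.pos (β := β) (σ := σ') (hρ0.trans hρ') (norm_nonneg (d q)) q
    have s1 := share_nonneg i p
    have s2 := share_nonneg i q
    have hnn : ∀ (e : Prop) [Decidable e] (a b : ℕ), 0 ≤ if e then massRatio m β₁ a b else 0 :=
      fun e _ a b => by
        split_ifs
        exacts [massRatio_nonneg h.pos _ _ _, le_rfl]
    have hite : ∀ (e : Prop) [Decidable e] (a b : ℕ),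
        ENNReal.ofReal (if e then massRatio m β₁ a b else 0) = if e then R a b else 0 :=
      fun e _ a b => by split_ifs <;> simp [R]
    rw [he, ENNReal.ofReal_mul (p := P ^ 3 * L) (by positivity),
      ENNReal.ofReal_mul (p := _ * (share i p * share i q)) (by positivity),
      ENNReal.ofReal_mul (q := share i p * share i q) (by positivity), ENNReal.ofReal_mul t1, ENNReal.ofReal_mul s1,
      ENNReal.ofReal_add (add_nonneg (hnn _ _ _) (hnn _ _ _)) (hnn _ _ _),
      ENNReal.ofReal_add (hnn _ _ _) (hnn _ _ _), hite, hite, hite]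
    simp only [eq_comm (a := e)]
    congr 1
    rw [mul_add, mul_add, mul_ite, mul_ite, mul_ite, mul_zero]
    congr 2
    rw [mul_comm (B q), mul_comm (U i q)]
  refine (ENNReal.tsum_le_tsum hterm).trans ?_
  rw [ENNReal.tsum_mul_left, ENNReal.tsum_add, ENNReal.tsum_add]
  have b1 := tsum_shares_right_le (A := A) (B := B) (U := U) (R := R) share_le_two tsum_share_le
    h.ratio_le e
  have b2 := tsum_shares_right_le (A := B) (B := A) (U := U) (R := R) share_le_two tsum_share_le
    h.ratio_le e
  have b3 := tsum_shares_diag_le (A := A) (B := B) (U := U) (R := R) share_le_two tsum_share_le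
    h.ratio_le e
  have hprod : ∀ G : ℕ → MonoIndex → MonoIndex → ℝ≥0∞,
      ∑' t : ℕ × MonoIndex × MonoIndex, G t.1 t.2.1 t.2.2 = ∑' i, ∑' p, ∑' q, G i p q := by
    intro G
    rw [ENNReal.tsum_prod']
    exact tsum_congr fun i => ENNReal.tsum_prod'
  rw [hprod fun i p q => if monoTop q = e then A p * B q * (U i p * U i q) * R (monoTop p) i else 0,
    hprod fun i p q => if monoTop p = e then B q * A p * (U i q * U i p) * R (monoTop q) i else 0,
    hprod fun i p q => if monoTop p = monoTop q then
      A p * B q * (U i p * U i q) * R (monoTop p) e else 0]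
  have b2' : ∑' (i : ℕ) (p : MonoIndex) (q : MonoIndex),
      (if monoTop p = e then B q * A p * (U i q * U i p) * R (monoTop q) i else 0) ≤
        4 * ENNReal.ofReal Θ * supTop B * supTop A := by
    refine le_trans (le_of_eq ?_) b2
    exact tsum_congr fun i => ENNReal.tsum_comm
  -- The constant `12` is three cases times `2 * 2` from the shares.
  calc _ ≤ ENNReal.ofReal (P ^ 3 * L) * (4 * ENNReal.ofReal Θ * supTop A * supTop B +
        4 * ENNReal.ofReal Θ * supTop B * supTop A + 4 * ENNReal.ofReal Θ * supTop A * supTop B) := by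
        gcongr
    _ = 12 * ENNReal.ofReal (P ^ 3 * L) * ENNReal.ofReal Θ * supTop A * supTop B := by ring
    _ = _ := by
        congr 2
        have : (12 : ℝ≥0∞) = ENNReal.ofReal 12 := by simp
        rw [this, ← ENNReal.ofReal_mul (by norm_num), ← ENNReal.ofReal_mul (by positivity)]
        congr 1
        ring

end BracketCoefficients

/-! ### The bracket of functions -/

section BracketEstimate

variable {m : ℕ → ℝ} {β₁ P Θ S β ρ₁ σ₁ ρ σ ρ' σ' L : ℝ} {O : Set EllInf}

/-- Passage from coefficient families to functions: only families of finite norm need be tested,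
because finiteness of the infimum provides one. -/
theorem le_mul_funNorm {a C : ℝ≥0∞} {f : Phase → ℂ} (hC : C ≠ ⊤) (hf : funNorm m β ρ σ f ≠ ⊤)
    (h : ∀ c, IsTaylorFourier ρ σ f c → coeffNorm m β ρ σ c ≠ ⊤ → a ≤ C * coeffNorm m β ρ σ c) :
    a ≤ C * funNorm m β ρ σ f := by
  have hex : ∀ X, funNorm m β ρ σ f < X → ∃ c, IsTaylorFourier ρ σ f c ∧ coeffNorm m β ρ σ c < X := by
    intro X hX
    simpa [funNorm, iInf_lt_iff] using hX
  rcases eq_or_ne C 0 with rfl | hC0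
  · obtain ⟨c, hc, hc'⟩ := hex ⊤ hf.lt_top
    simpa using h c hc hc'.ne
  · rw [mul_comm, ← ENNReal.div_le_iff hC0 hC]
    refine le_of_forall_gt fun X hX => ?_
    obtain ⟨c, hc, hc'⟩ := hex X hX
    refine lt_of_le_of_lt ?_ hc'
    rw [ENNReal.div_le_iff hC0 hC, mul_comm]
    exact h c hc (hc'.trans_le le_top).ne

theorem exists_coeff {f : Phase → ℂ} (hf : funNorm m β ρ σ f ≠ ⊤) :
    ∃ c, IsTaylorFourier ρ σ f c ∧ coeffNorm m β ρ σ c ≠ ⊤ := by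
  have h := hf.lt_top
  simp only [funNorm, iInf_lt_iff] at h
  obtain ⟨c, hc, h⟩ := h
  exact ⟨c, hc, h.ne⟩

theorem summable_coeff (h : MassBounds m β₁ P Θ S) (hβ : 0 < β) (hβ' : β ≤ β₁)
    (hP : 1 ≤ P) (hρ : 0 ≤ ρ) {c : MonoIndex → ℂ} (hc : coeffNorm m β ρ σ c ≠ ⊤) :
    Summable fun p => ‖c p‖ * monoNorm ρ σ p := by
  rw [coeffNorm_eq_seriesNorm h.pos] at hc
  exact summable_monoNorm h hβ hβ' hP hρ hc

/-- Functions of finite norm are bounded. -/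
theorem enorm_le_funNorm (h : MassBounds m β₁ P Θ S) (hβ : 0 < β) (hβ' : β ≤ β₁)
    (hP : 1 ≤ P) (hρ : 0 ≤ ρ) {f : Phase → ℂ} (hf : funNorm m β ρ σ f ≠ ⊤) {x : Phase}
    (hx : x ∈ domainQ ρ σ) : ‖f x‖ₑ ≤ ENNReal.ofReal (P * S) * funNorm m β ρ σ f := by
  refine le_mul_funNorm ENNReal.ofReal_ne_top hf fun c hc hfin => ?_
  rw [← (hc x hx).tsum_eq, coeffNorm_eq_seriesNorm h.pos]
  refine enorm_tsum_le_tsum_enorm.trans ((ENNReal.tsum_le_tsum fun p => ?_).trans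
    (tsum_monoNorm_le h hβ hβ' hP hρ))
  rw [← ofReal_norm, norm_mul]
  exact ENNReal.ofReal_le_ofReal
    (mul_le_mul_of_nonneg_left (norm_monomialFun_le hx p) (norm_nonneg _))

/-- Only monomials containing `j` contribute, and their total size carries a factor `m j`; together
with Cauchy's estimate this bounds the derivative. -/
theorem enorm_dAngle_le (h : MassBounds m β₁ P Θ S) (hβ : 0 < β) (hβ' : β ≤ β₁)
    (hP : 1 ≤ P) (hρ₁ : 0 ≤ ρ₁) (hρ : ρ₁ ≤ ρ) (hσ : σ₁ < σ) {f : Phase → ℂ}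
    (hf : funNorm m β ρ σ f ≠ ⊤) {x : Phase} (hx : x ∈ domainQ ρ₁ σ₁) (j : ℕ) :
    ‖dAngle j f x‖ₑ ≤ ENNReal.ofReal (P * Θ * m j * (σ - σ₁)⁻¹) * funNorm m β ρ σ f := by
  have hρ0 := hρ₁.trans hρ
  have hs : 0 ≤ (σ - σ₁)⁻¹ := inv_nonneg.2 (sub_pos.2 hσ).le
  refine le_mul_funNorm ENNReal.ofReal_ne_top hf fun c hc hfin => ?_
  have hsum := summable_coeff h hβ hβ' hP hρ0 hfin
  rw [← (hasSum_dAngle hsum hc (domainQ_mono hρ hσ.le hx) j).tsum_eq, coeffNorm_eq_seriesNorm h.pos]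
  have hmj := (h.pos j).le
  calc ‖∑' p, c p * monoAngle j p x‖ₑ ≤ ∑' p, ‖c p * monoAngle j p x‖ₑ := enorm_tsum_le_tsum_enorm
    _ ≤ ∑' p, ENNReal.ofReal (σ - σ₁)⁻¹ * (if j ∈ monoSupport (id p) then
          ENNReal.ofReal (‖c p‖ * monoNorm ρ σ (id p)) else 0) := by
        refine ENNReal.tsum_le_tsum fun p => ?_
        by_cases hj : j ∈ monoSupport p
        · rw [id, if_pos hj, ← ENNReal.ofReal_mul hs, ← ofReal_norm, norm_mul]
          refine ENNReal.ofReal_le_ofReal ?_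
          have h1 := norm_monoAngle_le hρ₁ hρ hσ hx j p
          have h2 := freqShare_le_one j p
          have h3 := monoNorm_nonneg (σ := σ) hρ0 p
          calc ‖c p‖ * ‖monoAngle j p x‖ ≤ ‖c p‖ * ((σ - σ₁)⁻¹ * 1 * monoNorm ρ σ p) := by
                gcongr
                exact h1.trans (by gcongr)
            _ = _ := by ring
        · rw [monoAngle_eq_zero hj, mul_zero, enorm_zero]; exact zero_le
    _ ≤ ENNReal.ofReal (σ - σ₁)⁻¹ * (ENNReal.ofReal (P * Θ * m j) * seriesNorm m β ρ σ id c) := by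
        rw [ENNReal.tsum_mul_left]
        gcongr
        exact tsum_monoNorm_mem_le h hβ hβ' hP hρ0 j
    _ = _ := by
        rw [← mul_assoc, ← ENNReal.ofReal_mul hs]
        congr 2
        ring

theorem enorm_dAction_le (h : MassBounds m β₁ P Θ S) (hβ : 0 < β) (hβ' : β ≤ β₁)
    (hP : 1 ≤ P) (hρ₁ : 0 ≤ ρ₁) (hρ : ρ₁ < ρ) (hσ : σ₁ ≤ σ) {f : Phase → ℂ}
    (hf : funNorm m β ρ σ f ≠ ⊤) {x : Phase} (hx : x ∈ domainQ ρ₁ σ₁) (j : ℕ) :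
    ‖dAction j f x‖ₑ ≤ ENNReal.ofReal (P * Θ * m j * (ρ - ρ₁)⁻¹) * funNorm m β ρ σ f := by
  have hρ0 := hρ₁.trans hρ.le
  have hs : 0 ≤ (ρ - ρ₁)⁻¹ := inv_nonneg.2 (sub_pos.2 hρ).le
  refine le_mul_funNorm ENNReal.ofReal_ne_top hf fun c hc hfin => ?_
  have hsum := summable_coeff h hβ hβ' hP hρ0 hfin
  rw [← (hasSum_dAction hsum hc (domainQ_mono hρ.le hσ hx) j).tsum_eq, coeffNorm_eq_seriesNorm h.pos]
  have hmj := (h.pos j).le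
  calc ‖∑' p, c p * monoAction j p x‖ₑ ≤ ∑' p, ‖c p * monoAction j p x‖ₑ := enorm_tsum_le_tsum_enorm
    _ ≤ ∑' p, ENNReal.ofReal (ρ - ρ₁)⁻¹ * (if j ∈ monoSupport (id p) then
          ENNReal.ofReal (‖c p‖ * monoNorm ρ σ (id p)) else 0) := by
        refine ENNReal.tsum_le_tsum fun p => ?_
        by_cases hj : j ∈ monoSupport p
        · rw [id, if_pos hj, ← ENNReal.ofReal_mul hs, ← ofReal_norm, norm_mul]
          refine ENNReal.ofReal_le_ofReal ?_
          have h1 := norm_monoAction_le hρ₁ hρ hσ hx j p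
          have h2 := expShare_le_one j p
          have h3 := monoNorm_nonneg (σ := σ) hρ0 p
          calc ‖c p‖ * ‖monoAction j p x‖ ≤ ‖c p‖ * ((ρ - ρ₁)⁻¹ * 1 * monoNorm ρ σ p) := by
                gcongr
                exact h1.trans (by gcongr)
            _ = _ := by ring
        · rw [monoAction_eq_zero hj, mul_zero, enorm_zero]; exact zero_le
    _ ≤ ENNReal.ofReal (ρ - ρ₁)⁻¹ * (ENNReal.ofReal (P * Θ * m j) * seriesNorm m β ρ σ id c) := by
        rw [ENNReal.tsum_mul_left]
        gcongr
        exact tsum_monoNorm_mem_le h hβ hβ' hP hρ0 j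
    _ = _ := by
        rw [← mul_assoc, ← ENNReal.ofReal_mul hs]
        congr 2
        ring

theorem norm_le_of_enorm_le {a : ℂ} {C : ℝ} {N : ℝ≥0∞} (hC : 0 ≤ C) (hN : N ≠ ⊤)
    (h : ‖a‖ₑ ≤ ENNReal.ofReal C * N) : ‖a‖ ≤ C * N.toReal := by
  have h1 := ENNReal.toReal_mono (ENNReal.mul_ne_top ENNReal.ofReal_ne_top hN) h
  rwa [toReal_enorm, ENNReal.toReal_mul, ENNReal.toReal_ofReal hC] at h1

/-- The bracket as a series of monomials. -/
theorem hasSum_bracket (h : MassBounds m β₁ P Θ S) (hP : 1 ≤ P) (hβ : 0 < β) (hβ' : β ≤ β₁)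
    (hρ₁ : 0 ≤ ρ₁) (hσ₁ : 0 ≤ σ₁) (hρ : ρ₁ < ρ) (hσ : σ₁ < σ) (hρ' : ρ ≤ ρ') (hσ' : σ ≤ σ')
    {f g : Phase → ℂ} {c d : MonoIndex → ℂ} (hc : IsTaylorFourier ρ σ f c)
    (hd : IsTaylorFourier ρ' σ' g d) (hcf : coeffNorm m β ρ σ c ≠ ⊤)
    (hdf : coeffNorm m β ρ' σ' d ≠ ⊤) {x : Phase} (hx : x ∈ domainQ ρ₁ σ₁) :
    Summable (bracketTerm m f g x) ∧
    HasSum (fun t => bracketCoeff m c d t * monomialFun (bracketTarget t) x)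
      (∑' j, bracketTerm m f g x j) := by
  have hfin : seriesNorm m β ρ₁ σ₁ bracketTarget (bracketCoeff m c d) ≠ ⊤ :=
    ne_top_of_le_ne_top (ENNReal.mul_ne_top (ENNReal.mul_ne_top ENNReal.ofReal_ne_top hcf) hdf)
      (seriesNorm_bracket_le h hP hβ hβ' hρ₁ hσ₁ hρ hσ hρ' hσ' (le_max_left _ _) (le_max_right _ _))
  have hs : Summable fun t => bracketCoeff m c d t * monomialFun (bracketTarget t) x := by
    refine (summable_monoNorm h hβ hβ' hP hρ₁ hfin).of_norm_bounded fun t => ?_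
    rw [norm_mul]
    exact mul_le_mul_of_nonneg_left (norm_monomialFun_le hx _) (norm_nonneg _)
  have hx1 := domainQ_mono hρ.le hσ.le hx
  have hx2 := domainQ_mono hρ' hσ' hx1
  have hsc := summable_coeff h hβ hβ' hP (hρ₁.trans hρ.le) hcf
  have hsd := summable_coeff h hβ hβ' hP ((hρ₁.trans hρ.le).trans hρ') hdf
  have hmul : ∀ {u v : MonoIndex → ℂ} {a b : ℂ}, HasSum u a → HasSum v b →
      HasSum (fun t : MonoIndex × MonoIndex => u t.1 * v t.2) (a * b) := fun hu hv =>
    hu.mul hv (summable_mul_of_summable_norm hu.summable.norm hv.summable.norm)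
  have hj : ∀ j, HasSum (fun t : MonoIndex × MonoIndex =>
      bracketCoeff m c d (j, t) * monomialFun (bracketTarget (j, t)) x) (bracketTerm m f g x j) := by
    intro j
    have h1 := hmul (hasSum_dAngle hsc hc hx1 j) (hasSum_dAction hsd hd hx2 j)
    have h2 := hmul (hasSum_dAction hsc hc hx1 j) (hasSum_dAngle hsd hd hx2 j)
    refine ((h1.sub h2).mul_left ((m j)⁻¹ : ℂ)).congr_fun fun t => ?_
    exact bracketCoeff_mul_monomialFun m c d j t.1 t.2 x
  have h1 := hs.hasSum.prod_fiberwise hj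
  refine ⟨h1.summable, ?_⟩
  rw [h1.tsum_eq]
  exact hs.hasSum

theorem funNorm_bracket_le (h : MassBounds m β₁ P Θ S) (hP : 1 ≤ P) (hβ : 0 < β) (hβ' : β ≤ β₁)
    (hρ₁ : 0 ≤ ρ₁) (hσ₁ : 0 ≤ σ₁) (hρ : ρ₁ < ρ) (hσ : σ₁ < σ) (hρ' : ρ ≤ ρ') (hσ' : σ ≤ σ')
    (hL : (σ - σ₁)⁻¹ * (ρ' - ρ₁)⁻¹ ≤ L) (hL' : (ρ - ρ₁)⁻¹ * (σ' - σ₁)⁻¹ ≤ L)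
    {f g : Phase → ℂ} (hf : funNorm m β ρ σ f ≠ ⊤) (hg : funNorm m β ρ' σ' g ≠ ⊤) :
    funNorm m β ρ₁ σ₁ (fun x => ∑' j, bracketTerm m f g x j) ≤
      ENNReal.ofReal (12 * P ^ 3 * Θ * L) * funNorm m β ρ σ f * funNorm m β ρ' σ' g := by
  -- The infimum is taken over families of `g` first and then, with one fixed, over those of `f`.
  refine le_mul_funNorm (ENNReal.mul_ne_top ENNReal.ofReal_ne_top hf) hg fun d hd hdf => ?_
  rw [mul_right_comm]
  refine le_mul_funNorm (ENNReal.mul_ne_top ENNReal.ofReal_ne_top hdf) hf fun c hc hcf => ?_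
  rw [mul_right_comm]
  exact (funNorm_le_seriesNorm h hβ hβ' hP hρ₁ fun x hx =>
    (hasSum_bracket h hP hβ hβ' hρ₁ hσ₁ hρ hσ hρ' hσ' hc hd hcf hdf hx).2).trans
      (seriesNorm_bracket_le h hP hβ hβ' hρ₁ hσ₁ hρ hσ hρ' hσ' hL hL')

theorem funNorm_le_paramNorm (h : Phase → EllInf → ℂ) {ξ : EllInf} (hξ : ξ ∈ O) :
    funNorm m β ρ σ (fun x => h x ξ) ≤ paramNorm m β ρ σ O h :=
  le_iSup₂ (f := fun ξ (_ : ξ ∈ O) => funNorm m β ρ σ fun x => h x ξ) ξ hξ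

theorem MemY.funNorm_ne_top {h : Phase → EllInf → ℂ} (hh : MemY m β ρ σ O h) {ξ : EllInf}
    (hξ : ξ ∈ O) : funNorm m β ρ σ (fun x => h x ξ) ≠ ⊤ :=
  ((funNorm_le_paramNorm h hξ).trans_lt hh.2.2.2).ne

theorem monomialFun_add_period (p : MonoIndex) (x : Phase) {k : EllInf}
    (hk : ∀ n, ∃ z : ℤ, k n = 2 * (Real.pi : ℂ) * (z : ℂ)) :
    monomialFun p (x.1 + k, x.2) = monomialFun p x := by
  choose z hz using hk
  unfold monomialFun
  congr 1
  have h1 : Complex.I * p.1.sum (fun n j => (j : ℂ) * (x.1 + k) n) =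
      Complex.I * p.1.sum (fun n j => (j : ℂ) * x.1 n) +
        (p.1.sum fun n j => j * z n : ℤ) * (2 * Real.pi * Complex.I) := by
    simp only [Finsupp.sum]
    push_cast
    rw [Finset.mul_sum, Finset.mul_sum, Finset.sum_mul, ← Finset.sum_add_distrib]
    refine Finset.sum_congr rfl fun n _ => ?_
    change Complex.I * ((p.1 n : ℂ) * (x.1 n + k n)) = _
    rw [hz]
    ring
  change Complex.exp (Complex.I * p.1.sum (fun n j => (j : ℂ) * (x.1 + k) n)) = _
  rw [h1, Complex.exp_add, Complex.exp_int_mul_two_pi_mul_I, mul_one]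

/-- Periodicity and boundedness are inherited from the expansion at each parameter, so holomorphy
and finite norm already give membership. -/
theorem memY_of_differentiableOn (hM : MassBounds m β₁ P Θ S) (hβ : 0 < β) (hβ' : β ≤ β₁)
    (hP : 1 ≤ P) (hS : 0 ≤ S) (hρ : 0 ≤ ρ) {h : Phase → EllInf → ℂ}
    (hd : DifferentiableOn ℂ (fun y : Phase × EllInf => h y.1 y.2) (domainQ ρ σ ×ˢ O))
    (hn : paramNorm m β ρ σ O h < ⊤) : MemY m β ρ σ O h := by
  have hfin : ∀ ξ ∈ O, funNorm m β ρ σ (fun x => h x ξ) ≠ ⊤ := fun ξ hξ =>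
    ((funNorm_le_paramNorm h hξ).trans_lt hn).ne
  refine ⟨?_, hd, ⟨P * S * (paramNorm m β ρ σ O h).toReal, ?_⟩, hn⟩
  · intro x hx ξ hξ k hk
    obtain ⟨c, hc, -⟩ := exists_coeff (hfin ξ hξ)
    have hx' : (x.1 + k, x.2) ∈ domainQ ρ σ := by
      refine ⟨?_, hx.2⟩
      have : ∀ n, |((x.1 + k) n).im| = |(x.1 n).im| := by
        intro n
        obtain ⟨z, hz⟩ := hk n
        have h1 : (x.1 + k) n = x.1 n + k n := rfl
        rw [h1, hz, Complex.add_im]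
        simp
      change (⨆ n, |((x.1 + k) n).im|) < σ
      simp_rw [this]
      exact hx.1
    have h1 := hc _ hx'
    simp_rw [monomialFun_add_period _ x hk] at h1
    exact h1.unique (hc x hx)
  · intro x hx ξ hξ
    refine norm_le_of_enorm_le (by positivity) hn.ne ?_
    refine (enorm_le_funNorm hM hβ hβ' hP hρ (hfin ξ hξ) hx).trans ?_
    gcongr
    exact funNorm_le_paramNorm h hξ

theorem MemY.differentiableAt {h : Phase → EllInf → ℂ} (hO : IsOpen O) (hh : MemY m β ρ σ O h)
    {x : Phase} {ξ : EllInf} (hx : x ∈ domainQ ρ σ) (hξ : ξ ∈ O) :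
    DifferentiableAt ℂ (fun y : Phase × EllInf => h y.1 y.2) (x, ξ) :=
  hh.2.1.differentiableAt (((isOpen_domainQ ρ σ).prod hO).mem_nhds ⟨hx, hξ⟩)

theorem MemY.hasFDerivAt_slice {h : Phase → EllInf → ℂ} (hO : IsOpen O) (hh : MemY m β ρ σ O h)
    {x : Phase} {ξ : EllInf} (hx : x ∈ domainQ ρ σ) (hξ : ξ ∈ O) :
    HasFDerivAt (fun y => h y ξ) ((fderiv ℂ (fun y : Phase × EllInf => h y.1 y.2) (x, ξ)).comp
      (ContinuousLinearMap.inl ℂ Phase EllInf)) x := by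
  have h1 : HasFDerivAt (fun y : Phase => (y, ξ)) (ContinuousLinearMap.inl ℂ Phase EllInf) x :=
    hasFDerivAt_prodMk_left x ξ
  exact HasFDerivAt.comp (g := fun y : Phase × EllInf => h y.1 y.2) x
    (hh.differentiableAt hO hx hξ).hasFDerivAt h1

theorem MemY.differentiableAt_slice {h : Phase → EllInf → ℂ} (hO : IsOpen O)
    (hh : MemY m β ρ σ O h) {x : Phase} {ξ : EllInf} (hx : x ∈ domainQ ρ σ) (hξ : ξ ∈ O) :
    DifferentiableAt ℂ (fun y => h y ξ) x := (hh.hasFDerivAt_slice hO hx hξ).differentiableAt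

theorem MemY.differentiableOn_fderiv {h : Phase → EllInf → ℂ} (hO : IsOpen O)
    (hh : MemY m β ρ σ O h) (v : Phase) :
    DifferentiableOn ℂ (fun y : Phase × EllInf => fderiv ℂ (fun x => h x y.2) y.1 v)
      (domainQ ρ σ ×ˢ O) := by
  refine (differentiableOn_fderiv_apply ((isOpen_domainQ ρ σ).prod hO) hh.2.1 (v, 0)).congr ?_
  rintro ⟨x, ξ⟩ ⟨hx, hξ⟩
  rw [(hh.hasFDerivAt_slice hO hx hξ).fderiv]
  rfl

theorem MemY.norm_dAngle_le (h : MassBounds m β₁ P Θ S) (hβ : 0 < β) (hβ' : β ≤ β₁)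
    (hP : 1 ≤ P) (hΘ : 0 ≤ Θ) (hρ₁ : 0 ≤ ρ₁) (hρ : ρ₁ ≤ ρ) (hσ : σ₁ < σ) {g : Phase → EllInf → ℂ}
    (hg : MemY m β ρ σ O g) {x : Phase} (hx : x ∈ domainQ ρ₁ σ₁) {ξ : EllInf} (hξ : ξ ∈ O) (j : ℕ) :
    ‖dAngle j (fun y => g y ξ) x‖ ≤
      P * Θ * m j * (σ - σ₁)⁻¹ * (paramNorm m β ρ σ O g).toReal := by
  have hs : 0 ≤ (σ - σ₁)⁻¹ := inv_nonneg.2 (sub_pos.2 hσ).le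
  have hm := (h.pos j).le
  refine norm_le_of_enorm_le (by positivity) hg.2.2.2.ne
    ((enorm_dAngle_le h hβ hβ' hP hρ₁ hρ hσ (hg.funNorm_ne_top hξ) hx j).trans ?_)
  gcongr
  exact funNorm_le_paramNorm g hξ

theorem MemY.norm_dAction_le (h : MassBounds m β₁ P Θ S) (hβ : 0 < β) (hβ' : β ≤ β₁)
    (hP : 1 ≤ P) (hΘ : 0 ≤ Θ) (hρ₁ : 0 ≤ ρ₁) (hρ : ρ₁ < ρ) (hσ : σ₁ ≤ σ) {g : Phase → EllInf → ℂ}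
    (hg : MemY m β ρ σ O g) {x : Phase} (hx : x ∈ domainQ ρ₁ σ₁) {ξ : EllInf} (hξ : ξ ∈ O) (j : ℕ) :
    ‖dAction j (fun y => g y ξ) x‖ ≤
      P * Θ * m j * (ρ - ρ₁)⁻¹ * (paramNorm m β ρ σ O g).toReal := by
  have hs : 0 ≤ (ρ - ρ₁)⁻¹ := inv_nonneg.2 (sub_pos.2 hρ).le
  have hm := (h.pos j).le
  refine norm_le_of_enorm_le (by positivity) hg.2.2.2.ne
    ((enorm_dAction_le h hβ hβ' hP hρ₁ hρ hσ (hg.funNorm_ne_top hξ) hx j).trans ?_)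
  gcongr
  exact funNorm_le_paramNorm g hξ

theorem MassBounds.summable (h : MassBounds m β₁ P Θ S) : Summable m := by
  have h1 : ∑' j, ENNReal.ofReal (m j) ≠ ⊤ := ne_top_of_le_ne_top ENNReal.ofReal_ne_top h.sum_le
  exact (ENNReal.summable_toReal h1).congr fun j => ENNReal.toReal_ofReal (h.pos j).le

/-- Each bracket term is jointly holomorphic in phase point and parameter. Both derivatives in it
are `O(m_j)` against a single `m_j⁻¹`, so the terms are uniformly dominated by the summable `m_j`.
-/
theorem differentiableOn_poisson (hM : MassBounds m β₁ P Θ S) (hP : 1 ≤ P) (hΘ : 0 ≤ Θ) (hβ : 0 < β)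
    (hβ' : β ≤ β₁) (hρ₁ : 0 ≤ ρ₁) (hρ : ρ₁ < ρ) (hσ : σ₁ < σ)
    (hρ' : ρ ≤ ρ') (hσ' : σ ≤ σ') (hO : IsOpen O) {h g : Phase → EllInf → ℂ}
    (hh : MemY m β ρ σ O h) (hg : MemY m β ρ' σ' O g) :
    DifferentiableOn ℂ (fun y : Phase × EllInf => poisson m h g y.1 y.2) (domainQ ρ₁ σ₁ ×ˢ O) := by
  have hsub : domainQ ρ₁ σ₁ ×ˢ O ⊆ domainQ ρ σ ×ˢ O :=
    Set.prod_mono (domainQ_mono hρ.le hσ.le) le_rfl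
  have hsub' : domainQ ρ₁ σ₁ ×ˢ O ⊆ domainQ ρ' σ' ×ˢ O :=
    hsub.trans (Set.prod_mono (domainQ_mono hρ' hσ') le_rfl)
  set H := (paramNorm m β ρ σ O h).toReal
  set G := (paramNorm m β ρ' σ' O g).toReal
  have hH : 0 ≤ H := ENNReal.toReal_nonneg
  have hG : 0 ≤ G := ENNReal.toReal_nonneg
  have s1 : 0 ≤ (σ - σ₁)⁻¹ := inv_nonneg.2 (sub_pos.2 hσ).le
  have s2 : 0 ≤ (ρ - ρ₁)⁻¹ := inv_nonneg.2 (sub_pos.2 hρ).le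
  have s3 : 0 ≤ (σ' - σ₁)⁻¹ := inv_nonneg.2 (sub_pos.2 (hσ.trans_le hσ')).le
  have s4 : 0 ≤ (ρ' - ρ₁)⁻¹ := inv_nonneg.2 (sub_pos.2 (hρ.trans_le hρ')).le
  refine differentiableOn_tsum_of_norm_le (u := fun j => m j * ((P * Θ) ^ 2 * H * G *
    ((σ - σ₁)⁻¹ * (ρ' - ρ₁)⁻¹ + (ρ - ρ₁)⁻¹ * (σ' - σ₁)⁻¹)))
    ((isOpen_domainQ ρ₁ σ₁).prod hO) (hM.summable.mul_right _) (fun j => ?_) ?_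
  · refine DifferentiableOn.const_mul (DifferentiableOn.sub
      (DifferentiableOn.mul ((hh.differentiableOn_fderiv hO _).mono hsub)
        ((hg.differentiableOn_fderiv hO _).mono hsub'))
      (DifferentiableOn.mul ((hh.differentiableOn_fderiv hO _).mono hsub)
        ((hg.differentiableOn_fderiv hO _).mono hsub'))) _
  · rintro j ⟨x, ξ⟩ ⟨hx, hξ⟩
    have a1 := hh.norm_dAngle_le hM hβ hβ' hP hΘ hρ₁ hρ.le hσ hx hξ j
    have a2 := hh.norm_dAction_le hM hβ hβ' hP hΘ hρ₁ hρ hσ.le hx hξ j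
    have a3 := hg.norm_dAngle_le hM hβ hβ' hP hΘ hρ₁ (hρ.le.trans hρ') (hσ.trans_le hσ') hx hξ j
    have a4 := hg.norm_dAction_le hM hβ hβ' hP hΘ hρ₁ (hρ.trans_le hρ') (hσ.le.trans hσ') hx hξ j
    have hmj := hM.pos j
    rw [bracketTerm, norm_mul, norm_inv, Complex.norm_real, Real.norm_of_nonneg hmj.le]
    change _ * ‖dAngle j (fun y => h y ξ) x * dAction j (fun y => g y ξ) x -
      dAction j (fun y => h y ξ) x * dAngle j (fun y => g y ξ) x‖ ≤ _
    calc _ ≤ (m j)⁻¹ * (‖dAngle j (fun y => h y ξ) x‖ * ‖dAction j (fun y => g y ξ) x‖ +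
          ‖dAction j (fun y => h y ξ) x‖ * ‖dAngle j (fun y => g y ξ) x‖) := by
          refine mul_le_mul_of_nonneg_left ((norm_sub_le _ _).trans_eq ?_) (inv_nonneg.2 hmj.le)
          rw [norm_mul, norm_mul]
      _ ≤ (m j)⁻¹ * (P * Θ * m j * (σ - σ₁)⁻¹ * H * (P * Θ * m j * (ρ' - ρ₁)⁻¹ * G) +
          P * Θ * m j * (ρ - ρ₁)⁻¹ * H * (P * Θ * m j * (σ' - σ₁)⁻¹ * G)) := by gcongr
      _ = _ := by field_simp

theorem im_fderiv_eq_zero {f : Phase → ℂ} {x v : Phase} (hf : DifferentiableAt ℂ f x)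
    (h : ∀ᶠ t : ℝ in 𝓝 0, (f (x + (t : ℂ) • v)).im = 0) : (fderiv ℂ f x v).im = 0 := by
  have hline : HasDerivAt (fun t : ℂ => x + t • v) v 0 := by
    simpa using ((hasDerivAt_id (0 : ℂ)).smul_const v).const_add x
  have h1 : HasFDerivAt f (fderiv ℂ f x) (x + (0 : ℂ) • v) := by simpa using hf.hasFDerivAt
  have h2 : HasDerivAt (fun t : ℂ => f (x + t • v)) (fderiv ℂ f x v) ((0 : ℝ) : ℂ) := by
    rw [Complex.ofReal_zero]
    exact h1.comp_hasDerivAt (0 : ℂ) hline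
  have h3 : HasDerivAt (fun t : ℝ => f (x + (t : ℂ) • v)) (fderiv ℂ f x v) 0 := h2.comp_ofReal
  have h4 : HasDerivAt (fun t : ℝ => (f (x + (t : ℂ) • v)).im) (fderiv ℂ f x v).im 0 :=
    (Complex.imCLM.hasFDerivAt).comp_hasDerivAt (0 : ℝ) h3
  exact h4.unique ((hasDerivAt_const (0 : ℝ) (0 : ℝ)).congr_of_eventuallyEq h)

theorem IsRealOnReal.im_fderiv {h : Phase → EllInf → ℂ} (hO : IsOpen O) (hh : MemY m β ρ σ O h)
    (hr : IsRealOnReal ρ σ O h) {x : Phase} (hx : x ∈ domainQ ρ σ) {ξ : EllInf} (hξ : ξ ∈ O)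
    (h1 : IsRealSeq x.1) (h2 : IsRealSeq x.2) (h3 : IsRealSeq ξ) {v : Phase} (v1 : IsRealSeq v.1)
    (v2 : IsRealSeq v.2) : (fderiv ℂ (fun y => h y ξ) x v).im = 0 := by
  refine im_fderiv_eq_zero (hh.differentiableAt_slice hO hx hξ) ?_
  have hcont : ContinuousAt (fun t : ℝ => x + (t : ℂ) • v) 0 := by fun_prop
  have hmem : ∀ᶠ t : ℝ in 𝓝 0, x + (t : ℂ) • v ∈ domainQ ρ σ :=
    hcont.eventually_mem ((isOpen_domainQ ρ σ).mem_nhds (by simpa using hx))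
  filter_upwards [hmem] with t ht
  refine hr _ ht ξ hξ (fun n => ?_) (fun n => ?_) h3
  · have : (x + (t : ℂ) • v).1 n = x.1 n + (t : ℂ) * v.1 n := rfl
    rw [this, Complex.add_im, Complex.im_ofReal_mul, h1 n, v1 n]; simp
  · have : (x + (t : ℂ) • v).2 n = x.2 n + (t : ℂ) * v.2 n := rfl
    rw [this, Complex.add_im, Complex.im_ofReal_mul, h2 n, v2 n]; simp

theorem isRealSeq_single (j : ℕ) : IsRealSeq (lp.single (⊤ : ℝ≥0∞) j (1 : ℂ)) := fun n => by
  rw [single_one_apply]; split_ifs <;> simp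

theorem isRealSeq_zero : IsRealSeq 0 := fun n => by simp

/-- The Poisson bracket maps into the smaller space, with the stated bound. -/
theorem memY_poisson (hM : MassBounds m β₁ P Θ S) (hP : 1 ≤ P) (hΘ : 0 ≤ Θ) (hS : 0 ≤ S) (hβ : 0 < β)
    (hβ' : β ≤ β₁) (hρ₁ : 0 ≤ ρ₁) (hσ₁ : 0 ≤ σ₁) (hρ : ρ₁ < ρ) (hσ : σ₁ < σ)
    (hρ' : ρ ≤ ρ') (hσ' : σ ≤ σ')
    (hL : (σ - σ₁)⁻¹ * (ρ' - ρ₁)⁻¹ ≤ L) (hL' : (ρ - ρ₁)⁻¹ * (σ' - σ₁)⁻¹ ≤ L)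
    (hO : IsOpen O) {h g : Phase → EllInf → ℂ}
    (hh : MemY m β ρ σ O h) (hg : MemY m β ρ' σ' O g) :
    MemY m β ρ₁ σ₁ O (poisson m h g) ∧
    paramNorm m β ρ₁ σ₁ O (poisson m h g) ≤ ENNReal.ofReal (12 * P ^ 3 * Θ * L) *
      paramNorm m β ρ σ O h * paramNorm m β ρ' σ' O g ∧
    (IsRealOnReal ρ σ O h → IsRealOnReal ρ' σ' O g → IsRealOnReal ρ₁ σ₁ O (poisson m h g)) := by
  have hnorm : paramNorm m β ρ₁ σ₁ O (poisson m h g) ≤ ENNReal.ofReal (12 * P ^ 3 * Θ * L) *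
      paramNorm m β ρ σ O h * paramNorm m β ρ' σ' O g := by
    refine iSup₂_le fun ξ hξ => ?_
    refine (funNorm_bracket_le hM hP hβ hβ' hρ₁ hσ₁ hρ hσ hρ' hσ' hL hL' (hh.funNorm_ne_top hξ)
      (hg.funNorm_ne_top hξ)).trans ?_
    gcongr
    · exact funNorm_le_paramNorm h hξ
    · exact funNorm_le_paramNorm g hξ
  refine ⟨memY_of_differentiableOn hM hβ hβ' hP hS hρ₁
    (differentiableOn_poisson hM hP hΘ hβ hβ' hρ₁ hρ hσ hρ' hσ' hO hh hg) (hnorm.trans_lt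
      (ENNReal.mul_lt_top (ENNReal.mul_lt_top ENNReal.ofReal_lt_top hh.2.2.2) hg.2.2.2)), hnorm,
    fun rh rg x hx ξ hξ h1 h2 h3 => ?_⟩
  have hx1 := domainQ_mono hρ.le hσ.le hx
  have hx2 := domainQ_mono hρ' hσ' hx1
  have hterm : ∀ j, (bracketTerm m (fun y => h y ξ) (fun y => g y ξ) x j).im = 0 := by
    intro j
    have e1 : (dAngle j (fun y => h y ξ) x).im = 0 :=
      rh.im_fderiv hO hh hx1 hξ h1 h2 h3 (isRealSeq_single j) isRealSeq_zero
    have e2 : (dAction j (fun y => h y ξ) x).im = 0 :=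
      rh.im_fderiv hO hh hx1 hξ h1 h2 h3 isRealSeq_zero (isRealSeq_single j)
    have e3 : (dAngle j (fun y => g y ξ) x).im = 0 :=
      rg.im_fderiv hO hg hx2 hξ h1 h2 h3 (isRealSeq_single j) isRealSeq_zero
    have e4 : (dAction j (fun y => g y ξ) x).im = 0 :=
      rg.im_fderiv hO hg hx2 hξ h1 h2 h3 isRealSeq_zero (isRealSeq_single j)
    rw [bracketTerm, ← Complex.ofReal_inv, Complex.im_ofReal_mul, Complex.sub_im, Complex.mul_im,
      Complex.mul_im, e1, e2, e3, e4]
    simp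
  rw [poisson, Complex.im_tsum]
  · simp [hterm]
  · obtain ⟨c, hc, hcf⟩ := exists_coeff (hh.funNorm_ne_top hξ)
    obtain ⟨d, hd, hdf⟩ := exists_coeff (hg.funNorm_ne_top hξ)
    exact (hasSum_bracket hM hP hβ hβ' hρ₁ hσ₁ hρ hσ hρ' hσ' hc hd hcf hdf hx).1

end BracketEstimate

/-! ### The Hamiltonian vector field and its integral curves -/

section HamiltonianField

open Metric Set

/-- Speed bounded by the radius keeps the solution inside for unit time. The fixed point of the
Picard operator is used directly, because its confinement to the ball is needed besides the
equation. -/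
theorem exists_solution_mem_closedBall {E : Type*} [NormedAddCommGroup E] [NormedSpace ℝ E]
    [CompleteSpace E] {Z : E → E} {x₀ : E} {a : ℝ≥0} {K : ℝ≥0}
    (hb : ∀ x ∈ closedBall x₀ a, ‖Z x‖ ≤ a) (hl : LipschitzOnWith K Z (closedBall x₀ a)) :
    ∃ γ : ℝ → E, γ 0 = x₀ ∧ ∀ t ∈ Icc (0 : ℝ) 1, γ t ∈ closedBall x₀ a ∧
      HasDerivWithinAt γ (Z (γ t)) (Icc (0 : ℝ) 1) t := by
  have h0 : (0 : ℝ) ∈ Icc (0 : ℝ) 1 := ⟨le_rfl, zero_le_one⟩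
  have hf : IsPicardLindelof (fun _ => Z) (⟨0, h0⟩ : Icc (0 : ℝ) 1) x₀ a 0 a K :=
    IsPicardLindelof.of_time_independent hb hl (by simp)
  obtain ⟨α, hα⟩ := ODE.FunSpace.exists_isFixedPt_next hf (mem_closedBall_self le_rfl)
  have hmem : ∀ t, α.compProj t ∈ closedBall x₀ a := fun t =>
    α.compProj_mem_closedBall hf.mul_max_le
  refine ⟨α.compProj, ?_, fun t ht => ⟨hmem t, ?_⟩⟩
  · have : α.compProj (⟨0, h0⟩ : Icc (0 : ℝ) 1) = x₀ := by
      rw [ODE.FunSpace.compProj_val, ← hα, ODE.FunSpace.next_apply₀]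
    exact this
  · have h1 := ODE.hasDerivWithinAt_picard_Icc (x₀ := x₀) (u := closedBall x₀ a) h0
      hf.continuousOn_uncurry α.continuous_compProj.continuousOn (fun _ _ => hmem _) ht
    refine h1.congr_of_mem (fun t' ht' => ?_) ht
    nth_rw 1 [← hα]
    rw [ODE.FunSpace.compProj_of_mem ht', ODE.FunSpace.next_apply]

/-- Existence up to time one when the two components of the field are small compared with the
respective sizes of a box on which the field is Lipschitz. -/
theorem exists_solution_mem_box {X : Phase → Phase} {x₀ : Phase} {a b : ℝ} (ha : 0 < a) (hb : 0 < b)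
    {D : Set Phase} (hD : ∀ y : Phase, ‖y.1 - x₀.1‖ ≤ a → ‖y.2 - x₀.2‖ ≤ b → y ∈ D)
    (h1 : ∀ y ∈ D, ‖(X y).1‖ ≤ a) (h2 : ∀ y ∈ D, ‖(X y).2‖ ≤ b) {K : ℝ≥0}
    (hl : LipschitzOnWith K X D) :
    ∃ γ : ℝ → Phase, γ 0 = x₀ ∧ ∀ t ∈ Icc (0 : ℝ) 1, γ t ∈ D ∧
      HasDerivWithinAt γ (X (γ t)) (Icc (0 : ℝ) 1) t := by
  -- Scaling the actions by `a / b` maps the box with half-widths `a`, `b` onto a ball of radius `a`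
  -- in the maximum norm, and the speed bounds scale in the same way.
  let scale : ℝ → Phase →L[ℝ] Phase := fun u =>
    (ContinuousLinearMap.fst ℝ EllInf EllInf).prod (u • ContinuousLinearMap.snd ℝ EllInf EllInf)
  have hs : ∀ u (y : Phase), scale u y = (y.1, u • y.2) := fun _ _ => rfl
  have hinv : ∀ y, scale (b / a) (scale (a / b) y) = y := fun y => by
    rw [hs, hs, smul_smul, div_mul_div_cancel₀ ha.ne', div_self hb.ne', one_smul]
  have hinv' : ∀ y, scale (a / b) (scale (b / a) y) = y := fun y => by
    rw [hs, hs, smul_smul, div_mul_div_cancel₀ hb.ne', div_self ha.ne', one_smul]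
  have hmaps : MapsTo (scale (b / a)) (closedBall (scale (a / b) x₀) a) D := by
    intro y hy
    rw [mem_closedBall, dist_eq_norm] at hy
    refine hD _ ((norm_fst_le (y - scale (a / b) x₀)).trans hy) ?_
    have h3 : (scale (b / a) y).2 - x₀.2 = (b / a) • (y - scale (a / b) x₀).2 := by
      rw [Prod.snd_sub, smul_sub, hs, hs, smul_smul, div_mul_div_cancel₀ ha.ne', div_self hb.ne',
        one_smul]
    rw [h3, norm_smul, Real.norm_of_nonneg (by positivity)]
    calc b / a * ‖(y - scale (a / b) x₀).2‖ ≤ b / a * a := by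
          gcongr
          exact (norm_snd_le _).trans hy
      _ = b := by field_simp
  have hex := exists_solution_mem_closedBall (x₀ := scale (a / b) x₀)
    (a := ⟨a, ha.le⟩) (Z := fun y => scale (a / b) (X (scale (b / a) y)))
    (K := ‖scale (a / b)‖₊ * (K * ‖scale (b / a)‖₊)) ?_ ?_
  · obtain ⟨γ, hγ0, hγ⟩ := hex
    refine ⟨fun t => scale (b / a) (γ t), by simp only [hγ0, hinv], fun t ht => ?_⟩
    obtain ⟨h3, h4⟩ := hγ t ht
    refine ⟨hmaps h3, ?_⟩
    have h5 := (scale (b / a)).hasFDerivAt.comp_hasDerivWithinAt t h4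
    rw [hinv] at h5
    exact h5
  · intro y hy
    have h3 := hmaps hy
    rw [hs, Prod.norm_def, max_le_iff]
    refine ⟨h1 _ h3, ?_⟩
    change ‖(a / b) • (X (scale (b / a) y)).2‖ ≤ a
    rw [norm_smul, Real.norm_of_nonneg (by positivity)]
    calc a / b * ‖(X (scale (b / a) y)).2‖ ≤ a / b * b := by gcongr; exact h2 _ h3
      _ = a := by field_simp
  · exact (scale (a / b)).lipschitz.comp_lipschitzOnWith
      (hl.comp (scale (b / a)).lipschitz.lipschitzOnWith hmaps)

open Classical in
/-- The Hamiltonian vector field, where it is bounded. -/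
def hamField (m : ℕ → ℝ) (g : Phase → ℂ) (x : Phase) : Phase :=
  if h : Memℓp (fun j => ((m j)⁻¹ : ℂ) * dAction j g x) ⊤ ∧
      Memℓp (fun j => -(((m j)⁻¹ : ℂ) * dAngle j g x)) ⊤ then (⟨_, h.1⟩, ⟨_, h.2⟩) else 0

theorem isHamVector_hamField {m : ℕ → ℝ} {g : Phase → ℂ} {x : Phase} {B : ℝ}
    (h1 : ∀ j, ‖((m j)⁻¹ : ℂ) * dAction j g x‖ ≤ B) (h2 : ∀ j, ‖((m j)⁻¹ : ℂ) * dAngle j g x‖ ≤ B) :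
    IsHamVector m g x (hamField m g x) := by
  have h3 : Memℓp (fun j => ((m j)⁻¹ : ℂ) * dAction j g x) ⊤ :=
    memℓp_infty ⟨B, by rintro _ ⟨j, rfl⟩; exact h1 j⟩
  have h4 : Memℓp (fun j => -(((m j)⁻¹ : ℂ) * dAngle j g x)) ⊤ :=
    memℓp_infty ⟨B, by rintro _ ⟨j, rfl⟩; simpa using h2 j⟩
  rw [hamField, dif_pos ⟨h3, h4⟩]
  exact fun j => ⟨rfl, rfl⟩

theorem IsHamVector.eq {m : ℕ → ℝ} {g : Phase → ℂ} {x v w : Phase} (hv : IsHamVector m g x v)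
    (hw : IsHamVector m g x w) : v = w := by
  refine Prod.ext (lp.ext (funext fun j => ?_)) (lp.ext (funext fun j => ?_))
  · rw [(hv j).1, (hw j).1]
  · rw [(hv j).2, (hw j).2]

section Field

variable {m : ℕ → ℝ} {β₁ P Θ S β ρ₁ σ₁ ρ σ : ℝ} {O : Set EllInf} {g : Phase → EllInf → ℂ}
  {ξ : EllInf}

theorem MemY.norm_inv_mul_dAction_le (h : MassBounds m β₁ P Θ S) (hβ : 0 < β) (hβ' : β ≤ β₁)
    (hP : 1 ≤ P) (hΘ : 0 ≤ Θ) (hρ₁ : 0 ≤ ρ₁) (hρ : ρ₁ < ρ) (hσ : σ₁ ≤ σ)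
    (hg : MemY m β ρ σ O g) {x : Phase} (hx : x ∈ domainQ ρ₁ σ₁) (hξ : ξ ∈ O) (j : ℕ) :
    ‖((m j)⁻¹ : ℂ) * dAction j (fun y => g y ξ) x‖ ≤
      P * Θ * (ρ - ρ₁)⁻¹ * (paramNorm m β ρ σ O g).toReal := by
  have h1 := hg.norm_dAction_le h hβ hβ' hP hΘ hρ₁ hρ hσ hx hξ j
  have hm := h.pos j
  rw [norm_mul, norm_inv, Complex.norm_real, Real.norm_of_nonneg hm.le, inv_mul_le_iff₀ hm]
  refine h1.trans_eq ?_
  ring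

theorem MemY.norm_inv_mul_dAngle_le (h : MassBounds m β₁ P Θ S) (hβ : 0 < β) (hβ' : β ≤ β₁)
    (hP : 1 ≤ P) (hΘ : 0 ≤ Θ) (hρ₁ : 0 ≤ ρ₁) (hρ : ρ₁ ≤ ρ) (hσ : σ₁ < σ)
    (hg : MemY m β ρ σ O g) {x : Phase} (hx : x ∈ domainQ ρ₁ σ₁) (hξ : ξ ∈ O) (j : ℕ) :
    ‖((m j)⁻¹ : ℂ) * dAngle j (fun y => g y ξ) x‖ ≤
      P * Θ * (σ - σ₁)⁻¹ * (paramNorm m β ρ σ O g).toReal := by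
  have h1 := hg.norm_dAngle_le h hβ hβ' hP hΘ hρ₁ hρ hσ hx hξ j
  have hm := h.pos j
  rw [norm_mul, norm_inv, Complex.norm_real, Real.norm_of_nonneg hm.le, inv_mul_le_iff₀ hm]
  refine h1.trans_eq ?_
  ring

theorem MemY.isHamVector (h : MassBounds m β₁ P Θ S) (hβ : 0 < β) (hβ' : β ≤ β₁)
    (hP : 1 ≤ P) (hΘ : 0 ≤ Θ) (hg : MemY m β ρ σ O g) {x : Phase} (hx : x ∈ domainQ ρ σ)
    (hξ : ξ ∈ O) : IsHamVector m (fun y => g y ξ) x (hamField m (fun y => g y ξ) x) := by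
  obtain ⟨δ, hδ, hxδ, hδρ, hδσ⟩ := exists_mem_smaller_domainQ hx
  exact isHamVector_hamField
    (fun j => (hg.norm_inv_mul_dAction_le h hβ hβ' hP hΘ (by linarith) (by linarith) (by linarith)
      hxδ hξ j).trans (le_max_left _ _))
    (fun j => (hg.norm_inv_mul_dAngle_le h hβ hβ' hP hΘ (by linarith) (by linarith) (by linarith)
      hxδ hξ j).trans (le_max_right _ _))

theorem MemY.norm_hamField_fst_le (h : MassBounds m β₁ P Θ S) (hβ : 0 < β) (hβ' : β ≤ β₁)
    (hP : 1 ≤ P) (hΘ : 0 ≤ Θ) (hρ₁ : 0 ≤ ρ₁) (hρ : ρ₁ < ρ) (hσ : σ₁ ≤ σ)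
    (hg : MemY m β ρ σ O g) {x : Phase} (hx : x ∈ domainQ ρ₁ σ₁) (hξ : ξ ∈ O) :
    ‖(hamField m (fun y => g y ξ) x).1‖ ≤
      P * Θ * (ρ - ρ₁)⁻¹ * (paramNorm m β ρ σ O g).toReal := by
  have h1 := hg.isHamVector h hβ hβ' hP hΘ (domainQ_mono hρ.le hσ hx) hξ
  refine lp.norm_le_of_forall_le' _ fun j => ?_
  rw [(h1 j).1]
  exact hg.norm_inv_mul_dAction_le h hβ hβ' hP hΘ hρ₁ hρ hσ hx hξ j

theorem MemY.norm_hamField_snd_le (h : MassBounds m β₁ P Θ S) (hβ : 0 < β) (hβ' : β ≤ β₁)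
    (hP : 1 ≤ P) (hΘ : 0 ≤ Θ) (hρ₁ : 0 ≤ ρ₁) (hρ : ρ₁ ≤ ρ) (hσ : σ₁ < σ)
    (hg : MemY m β ρ σ O g) {x : Phase} (hx : x ∈ domainQ ρ₁ σ₁) (hξ : ξ ∈ O) :
    ‖(hamField m (fun y => g y ξ) x).2‖ ≤
      P * Θ * (σ - σ₁)⁻¹ * (paramNorm m β ρ σ O g).toReal := by
  have h1 := hg.isHamVector h hβ hβ' hP hΘ (domainQ_mono hρ hσ.le hx) hξ
  refine lp.norm_le_of_forall_le' _ fun j => ?_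
  rw [(h1 j).2, norm_neg]
  exact hg.norm_inv_mul_dAngle_le h hβ hβ' hP hΘ hρ₁ hρ hσ hx hξ j

/-- Each component is scalar holomorphic and bounded, uniformly in the index, on a
`δ`-neighbourhood. Cauchy's estimate and convexity give a common Lipschitz constant, which passes to
the supremum norm without differentiating the field itself. -/
theorem MemY.exists_lipschitzOnWith_hamField (h : MassBounds m β₁ P Θ S) (hβ : 0 < β) (hβ' : β ≤ β₁)
    (hP : 1 ≤ P) (hΘ : 0 ≤ Θ) (hO : IsOpen O) (hρ₁ : 0 ≤ ρ₁) (hρ : ρ₁ < ρ) (hσ : σ₁ < σ)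
    (hg : MemY m β ρ σ O g) (hξ : ξ ∈ O) :
    ∃ K : ℝ≥0, LipschitzOnWith K (hamField m fun y => g y ξ) (domainQ ρ₁ σ₁) := by
  set δ := min (ρ - ρ₁) (σ - σ₁) / 2 with hδ
  have hδ1 := min_le_left (ρ - ρ₁) (σ - σ₁)
  have hδ2 := min_le_right (ρ - ρ₁) (σ - σ₁)
  have hmin := lt_min (sub_pos.2 hρ) (sub_pos.2 hσ)
  have hδ0 : 0 < δ := by linarith
  set B := max (P * Θ * (ρ - (ρ₁ + δ))⁻¹ * (paramNorm m β ρ σ O g).toReal)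
    (P * Θ * (σ - (σ₁ + δ))⁻¹ * (paramNorm m β ρ σ O g).toReal) with hB
  have hB0 : 0 ≤ B := by
    refine le_max_of_le_left ?_
    have : 0 ≤ (ρ - (ρ₁ + δ))⁻¹ := inv_nonneg.2 (by linarith)
    have : 0 ≤ (paramNorm m β ρ σ O g).toReal := ENNReal.toReal_nonneg
    positivity
  have hgen : ∀ (F : Phase → ℂ), DifferentiableOn ℂ F (domainQ ρ σ) →
      (∀ y ∈ domainQ (ρ₁ + δ) (σ₁ + δ), ‖F y‖ ≤ B) → ∀ x ∈ domainQ ρ₁ σ₁, ∀ y ∈ domainQ ρ₁ σ₁,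
      ‖F x - F y‖ ≤ 2 * B / δ * ‖x - y‖ := by
    intro F hF hFB x hx y hy
    refine (convex_domainQ ρ₁ σ₁).norm_image_sub_le_of_norm_fderiv_le (𝕜 := ℂ) (fun z hz => ?_)
      (fun z hz => ?_) hy hx
    · exact hF.differentiableAt ((isOpen_domainQ ρ σ).mem_nhds (domainQ_mono hρ.le hσ.le hz))
    · have hball := ball_subset_domainQ (δ := δ) hz
      exact norm_fderiv_le_of_norm_le hδ0
        (hF.mono (hball.trans (domainQ_mono (by linarith) (by linarith))))
        fun w hw => hFB w (hball hw)
  have hdiff : ∀ v : Phase, DifferentiableOn ℂ (fun x => fderiv ℂ (fun y => g y ξ) x v)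
      (domainQ ρ σ) := fun v =>
    differentiableOn_fderiv_apply (isOpen_domainQ ρ σ)
      (fun x hx => (hg.differentiableAt_slice hO hx hξ).differentiableWithinAt) v
  have hK : 0 ≤ 2 * B / δ := by positivity
  refine ⟨⟨2 * B / δ, hK⟩, LipschitzOnWith.of_dist_le_mul fun x hx y hy => ?_⟩
  have hvx := hg.isHamVector h hβ hβ' hP hΘ (domainQ_mono hρ.le hσ.le hx) hξ
  have hvy := hg.isHamVector h hβ hβ' hP hΘ (domainQ_mono hρ.le hσ.le hy) hξ
  rw [dist_eq_norm, dist_eq_norm, Prod.norm_def, max_le_iff]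
  constructor
  · refine lp.norm_le_of_forall_le' _ fun j => ?_
    have e : (hamField m (fun y => g y ξ) x - hamField m (fun y => g y ξ) y).1 j =
        ((m j)⁻¹ : ℂ) * dAction j (fun y => g y ξ) x - ((m j)⁻¹ : ℂ) * dAction j (fun y => g y ξ) y := by
      rw [← (hvx j).1, ← (hvy j).1]; rfl
    rw [e]
    exact hgen (fun x => ((m j)⁻¹ : ℂ) * dAction j (fun y => g y ξ) x)
      ((hdiff _).const_mul _) (fun z hz => (hg.norm_inv_mul_dAction_le h hβ hβ' hP hΘ (by linarith)
        (by linarith) (by linarith) hz hξ j).trans (le_max_left _ _)) x hx y hy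
  · refine lp.norm_le_of_forall_le' _ fun j => ?_
    have e : (hamField m (fun y => g y ξ) x - hamField m (fun y => g y ξ) y).2 j =
        -(((m j)⁻¹ : ℂ) * dAngle j (fun y => g y ξ) x - ((m j)⁻¹ : ℂ) * dAngle j (fun y => g y ξ) y) := by
      rw [neg_sub', sub_neg_eq_add, ← sub_neg_eq_add, ← (hvx j).2, ← (hvy j).2]; rfl
    rw [e, norm_neg]
    exact hgen (fun x => ((m j)⁻¹ : ℂ) * dAngle j (fun y => g y ξ) x)
      ((hdiff _).const_mul _) (fun z hz => (hg.norm_inv_mul_dAngle_le h hβ hβ' hP hΘ (by linarith)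
        (by linarith) (by linarith) hz hξ j).trans (le_max_right _ _)) x hx y hy

theorem IsHamCurve.continuousOn {f : Phase → ℂ} {D : Set Phase} {x : Phase} {γ : ℝ → Phase}
    (hγ : IsHamCurve m f D x γ) : ContinuousOn γ (Icc 0 1) := fun t ht => by
  obtain ⟨-, v, -, hv⟩ := hγ.2 t ht
  exact hv.continuousWithinAt

/-- By compactness the size of the action and of the imaginary part of the angle attain their maxima
along the curve. This keeps it away from the boundary, near which no Lipschitz constant is
available. -/
theorem exists_smaller_domainQ_of_curve {γ : ℝ → Phase} (hγ : ContinuousOn γ (Icc 0 1))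
    (h : ∀ t ∈ Icc (0 : ℝ) 1, γ t ∈ domainQ ρ σ) :
    ∃ ρ₁ σ₁, 0 ≤ ρ₁ ∧ ρ₁ < ρ ∧ σ₁ < σ ∧ ∀ t ∈ Icc (0 : ℝ) 1, γ t ∈ domainQ ρ₁ σ₁ := by
  have hne : (Icc (0 : ℝ) 1).Nonempty := ⟨0, le_rfl, zero_le_one⟩
  obtain ⟨t1, h1, hm1⟩ := isCompact_Icc.exists_isMaxOn hne
    (continuous_imNorm.comp_continuousOn (continuous_fst.comp_continuousOn hγ))
  obtain ⟨t2, h2, hm2⟩ := isCompact_Icc.exists_isMaxOn hne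
    (continuous_norm.comp_continuousOn (continuous_snd.comp_continuousOn hγ))
  have a1 := (mem_domainQ.1 (h t1 h1)).1
  have a2 := (mem_domainQ.1 (h t2 h2)).2
  have a3 := norm_nonneg (γ t2).2
  refine ⟨(‖(γ t2).2‖ + ρ) / 2, (imNorm (γ t1).1 + σ) / 2, by linarith, by linarith, by linarith,
    fun t ht => mem_domainQ.2 ⟨?_, ?_⟩⟩
  · have : imNorm (γ t).1 ≤ imNorm (γ t1).1 := hm1 ht
    linarith
  · have : ‖(γ t).2‖ ≤ ‖(γ t2).2‖ := hm2 ht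
    linarith

theorem MemY.eqOn_of_isHamCurve (h : MassBounds m β₁ P Θ S) (hβ : 0 < β) (hβ' : β ≤ β₁)
    (hP : 1 ≤ P) (hΘ : 0 ≤ Θ) (hO : IsOpen O) (hg : MemY m β ρ σ O g) (hξ : ξ ∈ O) {x : Phase}
    {γ γ' : ℝ → Phase} (hγ : IsHamCurve m (fun y => g y ξ) (domainQ ρ σ) x γ)
    (hγ' : IsHamCurve m (fun y => g y ξ) (domainQ ρ σ) x γ') : EqOn γ γ' (Icc 0 1) := by
  obtain ⟨ρ₁, σ₁, hρ₁, hρ, hσ, hmem⟩ := exists_smaller_domainQ_of_curve hγ.continuousOn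
    fun t ht => (hγ.2 t ht).1
  obtain ⟨ρ₂, σ₂, hρ₂, hρ', hσ', hmem'⟩ := exists_smaller_domainQ_of_curve hγ'.continuousOn
    fun t ht => (hγ'.2 t ht).1
  obtain ⟨K, hK⟩ := hg.exists_lipschitzOnWith_hamField h hβ hβ' hP hΘ hO
    (hρ₁.trans (le_max_left ρ₁ ρ₂)) (max_lt hρ hρ') (max_lt hσ hσ') hξ
  have hder : ∀ {c : ℝ → Phase}, IsHamCurve m (fun y => g y ξ) (domainQ ρ σ) x c →
      ∀ t ∈ Ico (0 : ℝ) 1, HasDerivWithinAt c (hamField m (fun y => g y ξ) (c t)) (Ici t) t := by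
    intro c hc t ht
    obtain ⟨hD, v, hv, hd⟩ := hc.2 t (Ico_subset_Icc_self ht)
    rw [← hv.eq (hg.isHamVector h hβ hβ' hP hΘ hD hξ)]
    exact hd.mono_of_mem_nhdsWithin (Icc_mem_nhdsGE_of_mem ht)
  exact ODE_solution_unique_of_mem_Icc_right (v := fun _ => hamField m fun y => g y ξ)
    (s := fun _ => domainQ (max ρ₁ ρ₂) (max σ₁ σ₂)) (fun _ _ => hK) hγ.continuousOn (hder hγ)
    (fun t ht => domainQ_mono (le_max_left _ _) (le_max_left _ _) (hmem t (Ico_subset_Icc_self ht)))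
    hγ'.continuousOn (hder hγ')
    (fun t ht => domainQ_mono (le_max_right _ _) (le_max_right _ _)
      (hmem' t (Ico_subset_Icc_self ht))) (hγ.1.trans hγ'.1.symm)

/-- The flow exists up to time one and uses at most half of the available loss of domain. -/
theorem MemY.exists_isHamCurve {ρ' σ' r s : ℝ} (h : MassBounds m β₁ P Θ S) (hβ : 0 < β)
    (hβ' : β ≤ β₁) (hP : 1 ≤ P) (hΘ : 0 ≤ Θ) (hO : IsOpen O) (hρ' : ρ ≤ ρ') (hσ' : σ ≤ σ')
    (hr : 0 < r) (hrρ : r < ρ) (hs : 0 < s) (hg : MemY m β ρ' σ' O g) (hξ : ξ ∈ O)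
    (hsmall : 4 * (P * Θ) * lossConst r s ρ σ ρ' σ' * (paramNorm m β ρ' σ' O g).toReal ≤ 1)
    {x : Phase} (hx : x ∈ domainQ (ρ - r) (σ - s)) :
    ∃ γ, IsHamCurve m (fun y => g y ξ) (domainQ (ρ - r / 2) (σ - s / 2)) x γ := by
  set G := (paramNorm m β ρ' σ' O g).toReal with hG
  have hG0 : 0 ≤ G := ENNReal.toReal_nonneg
  have hPΘ : 0 ≤ P * Θ := by positivity
  have hsub : domainQ (ρ - r / 2) (σ - s / 2) ⊆ domainQ ρ' σ' :=
    domainQ_mono (by linarith) (by linarith)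
  obtain ⟨K, hK⟩ := hg.exists_lipschitzOnWith_hamField (ρ₁ := ρ - r / 2) (σ₁ := σ - s / 2)
    h hβ hβ' hP hΘ hO (by linarith) (by linarith) (by linarith) hξ
  have hinv : ∀ {u v : ℝ}, 0 < u → 0 < v → v ≤ 2 * u → u⁻¹ ≤ 2 * v⁻¹ := by
    intro u v hu hv huv
    rw [inv_eq_one_div, ← div_eq_mul_inv, div_le_div_iff₀ hu hv]
    linarith
  -- With `u = s` this bounds the speed of the angles by `s / 2`, with `u = r` that of the actions
  -- by `r / 2`. The `2 * v` reflects that, after half the loss, at least half the distance to the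
  -- large boundary remains.
  have hsm : ∀ {u v : ℝ}, 0 < u → u⁻¹ * v ≤ lossConst r s ρ σ ρ' σ' → P * Θ * (2 * v) * G ≤ u / 2 := by
    intro u v hu huv
    have h1 : 4 * (P * Θ) * (u⁻¹ * v) * G ≤ 1 := le_trans (by gcongr) hsmall
    have h2 : P * Θ * (2 * v) * G = u / 2 * (4 * (P * Θ) * (u⁻¹ * v) * G) := by field_simp; ring
    rw [h2]
    exact mul_le_of_le_one_right (by positivity) h1
  have hs1 := hsm hs (le_max_right (r⁻¹ * (σ' - σ + s)⁻¹) (s⁻¹ * (ρ' - ρ + r)⁻¹))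
  have hr1 := hsm hr (le_max_left (r⁻¹ * (σ' - σ + s)⁻¹) (s⁻¹ * (ρ' - ρ + r)⁻¹))
  have hex := exists_solution_mem_box (X := hamField m fun y => g y ξ) (x₀ := x)
    (a := s / 2) (b := r / 2) (by positivity) (by positivity)
    (D := domainQ (ρ - r / 2) (σ - s / 2)) ?_ ?_ ?_ hK
  · obtain ⟨γ, h0, hγ⟩ := hex
    exact ⟨γ, h0, fun t ht => ⟨(hγ t ht).1, _, hg.isHamVector h hβ hβ' hP hΘ
      (hsub (hγ t ht).1) hξ, (hγ t ht).2⟩⟩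
  · intro y h1 h2
    obtain ⟨h3, h4⟩ := mem_domainQ.1 hx
    have h5 := imNorm_le_add_norm_sub y.1 x.1
    have h6 := norm_le_norm_add_norm_sub' y.2 x.2
    exact mem_domainQ.2 ⟨by linarith, by linarith⟩
  · intro y hy
    refine (hg.norm_hamField_fst_le h hβ hβ' hP hΘ (by linarith) (by linarith) (by linarith)
      hy hξ).trans (le_trans ?_ hs1)
    have : (ρ' - (ρ - r / 2))⁻¹ ≤ 2 * (ρ' - ρ + r)⁻¹ :=
      hinv (by linarith) (by linarith) (by linarith)
    gcongr
  · intro y hy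
    refine (hg.norm_hamField_snd_le h hβ hβ' hP hΘ (by linarith) (by linarith) (by linarith)
      hy hξ).trans (le_trans ?_ hr1)
    have : (σ' - (σ - s / 2))⁻¹ ≤ 2 * (σ' - σ + s)⁻¹ :=
      hinv (by linarith) (by linarith) (by linarith)
    gcongr

end Field

end HamiltonianField

/-! ### Iterated brackets -/

section LieIteration

open Set

section Series
variable {m : ℕ → ℝ} {β₁ P Θ S β ρ₁ σ₁ ρ σ : ℝ} {O : Set EllInf}

theorem funNorm_const_mul_le (hM : MassBounds m β₁ P Θ S) (hβ : 0 < β) (hβ' : β ≤ β₁)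
    (hP : 1 ≤ P) (hρ : 0 ≤ ρ) (a : ℂ) {f : Phase → ℂ} (hf : funNorm m β ρ σ f ≠ ⊤) :
    funNorm m β ρ σ (fun x => a * f x) ≤ ‖a‖ₑ * funNorm m β ρ σ f := by
  refine le_mul_funNorm enorm_ne_top hf fun c hc _ => ?_
  refine (funNorm_le_seriesNorm hM hβ hβ' hP hρ (π := id) (val := fun p => a * c p)
    fun x hx => ?_).trans ?_
  · simp only [id, mul_assoc]
    exact (hc x hx).mul_left a
  · rw [coeffNorm_eq_seriesNorm hM.pos]
    refine iSup_le fun j => ?_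
    refine le_trans (le_of_eq ?_) (mul_le_mul_right (le_iSup (fun j => ∑' p : MonoIndex,
      if monoTop (id p) = j then ENNReal.ofReal (termWeight m β ρ σ ‖c p‖ (id p)) else 0) j) ‖a‖ₑ)
    rw [← ENNReal.tsum_mul_left]
    refine tsum_congr fun p => ?_
    split_ifs
    · rw [← ofReal_norm, ← ENNReal.ofReal_mul (norm_nonneg _), norm_mul, termWeight, termWeight]
      congr 1
      ring
    · rw [mul_zero]

/-- The norm of a convergent series of functions is at most the sum of the norms. -/
theorem funNorm_le_tsum (hM : MassBounds m β₁ P Θ S) (hβ : 0 < β) (hβ' : β ≤ β₁)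
    (hP : 1 ≤ P) (hρ : 0 ≤ ρ) {f : Phase → ℂ} {F : ℕ → Phase → ℂ}
    (hF : ∑' n, funNorm m β ρ σ (F n) ≠ ⊤)
    (hf : ∀ x ∈ domainQ ρ σ, HasSum (fun n => F n x) (f x)) :
    funNorm m β ρ σ f ≤ ∑' n, funNorm m β ρ σ (F n) := by
  refine ENNReal.le_of_forall_pos_le_add fun ε hε _ => ?_
  -- Nearly minimal families with summable errors are chosen and merged into one series with
  -- repeated monomials.
  obtain ⟨ε', hε', hsum⟩ := ENNReal.exists_pos_sum_of_countable (ENNReal.coe_pos.2 hε).ne' ℕ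
  have hchoice : ∀ n, ∃ c, IsTaylorFourier ρ σ (F n) c ∧
      coeffNorm m β ρ σ c ≤ funNorm m β ρ σ (F n) + ε' n := by
    intro n
    have h1 : funNorm m β ρ σ (F n) < funNorm m β ρ σ (F n) + ε' n :=
      ENNReal.lt_add_right (ENNReal.ne_top_of_tsum_ne_top hF n) (ENNReal.coe_pos.2 (hε' n)).ne'
    conv_lhs at h1 => rw [funNorm]
    simp only [iInf_lt_iff] at h1
    obtain ⟨c, hc, h2⟩ := h1
    exact ⟨c, hc, h2.le⟩
  choose c hc hcn using hchoice
  have hle : seriesNorm m β ρ σ (fun t : ℕ × MonoIndex => t.2) (fun t => c t.1 t.2) ≤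
      ∑' n, funNorm m β ρ σ (F n) + ε := by
    refine iSup_le fun j => ?_
    rw [ENNReal.tsum_prod']
    calc _ ≤ ∑' n, coeffNorm m β ρ σ (c n) := by
          refine ENNReal.tsum_le_tsum fun n => ?_
          rw [coeffNorm_eq_seriesNorm hM.pos]
          exact le_iSup (fun j => ∑' p : MonoIndex,
            if monoTop p = j then ENNReal.ofReal (termWeight m β ρ σ ‖c n p‖ p) else 0) j
      _ ≤ ∑' n, (funNorm m β ρ σ (F n) + ε' n) := ENNReal.tsum_le_tsum hcn
      _ ≤ _ := by
          rw [ENNReal.tsum_add]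
          gcongr
  refine (funNorm_le_seriesNorm hM hβ hβ' hP hρ fun x hx => ?_).trans hle
  have hs := summable_monoNorm hM hβ hβ' hP hρ
    (ne_top_of_le_ne_top (ENNReal.add_ne_top.2 ⟨hF, ENNReal.coe_ne_top⟩) hle)
  have hs' : Summable fun t : ℕ × MonoIndex => c t.1 t.2 * monomialFun t.2 x := by
    refine hs.of_norm_bounded fun t => ?_
    rw [norm_mul]
    exact mul_le_mul_of_nonneg_left (norm_monomialFun_le hx _) (norm_nonneg _)
  have h1 := hs'.hasSum.prod_fiberwise fun n => hc n x hx
  rw [(hf x hx).unique h1]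
  exact hs'.hasSum

theorem coeffNorm_mono (hM : MassBounds m β₁ P Θ S) (hρ₁ : 0 ≤ ρ₁) (hρ : ρ₁ ≤ ρ) (hσ : σ₁ ≤ σ)
    (c : MonoIndex → ℂ) : coeffNorm m β ρ₁ σ₁ c ≤ coeffNorm m β ρ σ c := by
  rw [coeffNorm_eq_seriesNorm hM.pos, coeffNorm_eq_seriesNorm hM.pos]
  refine iSup_mono fun j => ENNReal.tsum_le_tsum fun p => ?_
  split_ifs
  · refine ENNReal.ofReal_le_ofReal ?_
    have := hM.blockMass_pos β (monoSupport (id p))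
    have := monoNorm_mono hρ₁ hρ hσ (id p)
    unfold termWeight
    gcongr
  · exact le_rfl

theorem paramNorm_mono (hM : MassBounds m β₁ P Θ S) (hρ₁ : 0 ≤ ρ₁) (hρ : ρ₁ ≤ ρ) (hσ : σ₁ ≤ σ)
    (h : Phase → EllInf → ℂ) : paramNorm m β ρ₁ σ₁ O h ≤ paramNorm m β ρ σ O h := by
  refine iSup₂_mono fun ξ _ => le_iInf₂ fun c hc => ?_
  exact (iInf₂_le c fun x hx => hc x (domainQ_mono hρ hσ hx)).trans (coeffNorm_mono hM hρ₁ hρ hσ c)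

theorem MemY.mono (hM : MassBounds m β₁ P Θ S) (hρ₁ : 0 ≤ ρ₁) (hρ : ρ₁ ≤ ρ) (hσ : σ₁ ≤ σ)
    {h : Phase → EllInf → ℂ} (hh : MemY m β ρ σ O h) : MemY m β ρ₁ σ₁ O h := by
  have hsub : domainQ ρ₁ σ₁ ⊆ domainQ ρ σ := domainQ_mono hρ hσ
  obtain ⟨h1, h2, ⟨B, hB⟩, h4⟩ := hh
  exact ⟨fun x hx => h1 x (hsub hx), h2.mono (Set.prod_mono hsub le_rfl),
    ⟨B, fun x hx => hB x (hsub hx)⟩, (paramNorm_mono hM hρ₁ hρ hσ h).trans_lt h4⟩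

end Series

/-- Taylor's formula on `[0, 1]` for a sequence of successive derivatives. -/
theorem norm_sub_taylor_le {B : ℝ} (N : ℕ) : ∀ u : ℕ → ℝ → ℂ,
    (∀ n, ∀ t ∈ Icc (0 : ℝ) 1, HasDerivWithinAt (u n) (u (n + 1) t) (Icc (0 : ℝ) 1) t) →
    (∀ t ∈ Icc (0 : ℝ) 1, ‖u N t‖ ≤ B) → ∀ t ∈ Icc (0 : ℝ) 1,
    ‖u 0 t - ∑ k ∈ Finset.range N, ((t ^ k / k.factorial : ℝ) : ℂ) * u k 0‖ ≤
      B * (t ^ N / N.factorial) := by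
  induction N with
  | zero => intro u _ hB t ht; simpa using hB t ht
  | succ N ih =>
    intro u hu hB
    -- The derivative of the remainder is the remainder of order `N` of the shifted sequence;
    -- comparison with the antiderivative of its bound gives the next order.
    have hih := ih (fun n => u (n + 1)) (fun n => hu (n + 1)) hB
    have hpow : ∀ (k : ℕ) (t : ℝ), HasDerivAt (fun t : ℝ => t ^ (k + 1) / (k + 1).factorial)
        (t ^ k / k.factorial) t := by
      intro k t
      have h1 := (hasDerivAt_pow (k + 1) t).div_const ((k + 1).factorial : ℝ)
      refine h1.congr_deriv ?_
      rw [Nat.factorial_succ]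
      push_cast
      have : (k.factorial : ℝ) ≠ 0 := by positivity
      field_simp
    have hsplit : ∀ t : ℝ, ∑ k ∈ Finset.range (N + 1), ((t ^ k / k.factorial : ℝ) : ℂ) * u k 0 =
        ∑ k ∈ Finset.range N, ((t ^ (k + 1) / (k + 1).factorial : ℝ) : ℂ) * u (k + 1) 0 + u 0 0 := by
      intro t
      rw [Finset.sum_range_succ']
      simp
    have hder : ∀ t ∈ Icc (0 : ℝ) 1, HasDerivWithinAt
        (fun t => u 0 t - ∑ k ∈ Finset.range (N + 1), ((t ^ k / k.factorial : ℝ) : ℂ) * u k 0)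
        (u 1 t - ∑ k ∈ Finset.range N, ((t ^ k / k.factorial : ℝ) : ℂ) * u (k + 1) 0)
        (Icc (0 : ℝ) 1) t := by
      intro t ht
      simp_rw [hsplit]
      refine (hu 0 t ht).sub (HasDerivWithinAt.add_const _ (HasDerivWithinAt.fun_sum fun k _ => ?_))
      exact ((hpow k t).ofReal_comp.mul_const _).hasDerivWithinAt
    intro t ht
    refine image_norm_le_of_norm_deriv_right_le_deriv_boundary
      (f' := fun t => u 1 t - ∑ k ∈ Finset.range N, ((t ^ k / k.factorial : ℝ) : ℂ) * u (k + 1) 0)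
      (B := fun t => B * (t ^ (N + 1) / (N + 1).factorial)) (B' := fun t => B * (t ^ N / N.factorial))
      (fun t ht => (hder t ht).continuousWithinAt) (fun t ht => ?_) ?_
      (fun t => (hpow N t).const_mul B) (fun t ht => hih t (Ico_subset_Icc_self ht)) ht
    · exact (hder t (Ico_subset_Icc_self ht)).mono_of_mem_nhdsWithin (Icc_mem_nhdsGE_of_mem ht)
    · rw [hsplit 0]
      simp

/-- The iterated bracket `{…{{h, g}, g}…, g}`. -/
def iterBracket (m : ℕ → ℝ) (g h : Phase → EllInf → ℂ) (n : ℕ) : Phase → EllInf → ℂ :=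
  (fun f => poisson m f g)^[n] h

theorem iterBracket_succ (m : ℕ → ℝ) (g h : Phase → EllInf → ℂ) (n : ℕ) :
    iterBracket m g h (n + 1) = poisson m (iterBracket m g h n) g :=
  Function.iterate_succ_apply' _ _ _

section Lie
variable {m : ℕ → ℝ} {β₁ P Θ S β ρ σ ρ' σ' r s L : ℝ} {O : Set EllInf} {g h : Phase → EllInf → ℂ}

/-- Each of the `N` brackets gives up `r / N` and `s / N`, but the distance to the domain of `g`
grows with every step. Step `k + 1` therefore costs `L N² / (k + 1)` rather than `L N²`, which
produces the `k!` in the denominator. -/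
theorem memY_iterBracket_step (hM : MassBounds m β₁ P Θ S) (hP : 1 ≤ P) (hΘ : 0 ≤ Θ) (hS : 0 ≤ S)
    (hβ : 0 < β) (hβ' : β ≤ β₁) (hρ' : ρ ≤ ρ') (hσ' : σ ≤ σ') (hr : 0 < r) (hrρ : r < ρ)
    (hs : 0 < s) (hsσ : s < σ) (hL : lossConst r s ρ σ ρ' σ' ≤ L) (hO : IsOpen O)
    (hh : MemY m β ρ σ O h) (hg : MemY m β ρ' σ' O g) {N : ℕ} (hN : 0 < N) :
    ∀ k ≤ N, MemY m β (ρ - k / N * r) (σ - k / N * s) O (iterBracket m g h k) ∧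
      paramNorm m β (ρ - k / N * r) (σ - k / N * s) O (iterBracket m g h k) ≤
        ENNReal.ofReal ((12 * P ^ 3 * Θ * L * N ^ 2) ^ k / k.factorial) *
          paramNorm m β ρ σ O h * paramNorm m β ρ' σ' O g ^ k ∧
      (IsRealOnReal ρ σ O h → IsRealOnReal ρ' σ' O g →
        IsRealOnReal (ρ - k / N * r) (σ - k / N * s) O (iterBracket m g h k)) := by
  intro k
  have hL0 : 0 ≤ L := by
    refine le_trans (le_max_of_le_left ?_) hL
    have : 0 ≤ (σ' - σ + s)⁻¹ := inv_nonneg.2 (by linarith)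
    positivity
  have hN0 : (0 : ℝ) < N := Nat.cast_pos.2 hN
  induction k with
  | zero =>
    intro _
    simp only [Nat.cast_zero, zero_div, zero_mul, sub_zero, pow_zero, Nat.factorial_zero, Nat.cast_one,
      div_one, ENNReal.ofReal_one, one_mul, mul_one]
    exact ⟨hh, le_rfl, fun h1 _ => h1⟩
  | succ k ih =>
    intro hk
    obtain ⟨i1, i2, i3⟩ := ih (by omega)
    have hk1 : ((k + 1 : ℕ) : ℝ) / N ≤ 1 := by
      rw [div_le_one hN0]; exact_mod_cast hk
    have hk0 : (0 : ℝ) ≤ (k : ℝ) / N := by positivity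
    have hkk : ((k + 1 : ℕ) : ℝ) / N = k / N + 1 / N := by push_cast; ring
    have hNr : 0 < 1 / (N : ℝ) * r := by positivity
    have hNs : 0 < 1 / (N : ℝ) * s := by positivity
    have hpos : (0 : ℝ) < ((k + 1 : ℕ) : ℝ) / N := by positivity
    have hkr : ((k + 1 : ℕ) : ℝ) / N * r ≤ r := mul_le_of_le_one_left hr.le hk1
    have hks : ((k + 1 : ℕ) : ℝ) / N * s ≤ s := mul_le_of_le_one_left hs.le hk1
    have hkr0 : 0 ≤ (k : ℝ) / N * r := by positivity
    have hks0 : 0 ≤ (k : ℝ) / N * s := by positivity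
    have er : ((k + 1 : ℕ) : ℝ) / N * r = k / N * r + 1 / N * r := by rw [hkk]; ring
    have es : ((k + 1 : ℕ) : ℝ) / N * s = k / N * s + 1 / N * s := by rw [hkk]; ring
    have hgen : ∀ {u v w : ℝ}, 0 < u → 0 < v → 0 ≤ w → u⁻¹ * (w + v)⁻¹ ≤ L →
        (1 / (N : ℝ) * u)⁻¹ * (w + ((k + 1 : ℕ) : ℝ) / N * v)⁻¹ ≤ L * N ^ 2 / (k + 1 : ℕ) := by
      intro u v w hu hv hw huv
      have h1 : ((k + 1 : ℕ) : ℝ) / N * (w + v) ≤ w + ((k + 1 : ℕ) : ℝ) / N * v := by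
        have := mul_le_of_le_one_left hw hk1
        linarith
      calc (1 / (N : ℝ) * u)⁻¹ * (w + ((k + 1 : ℕ) : ℝ) / N * v)⁻¹
          ≤ (1 / (N : ℝ) * u)⁻¹ * (((k + 1 : ℕ) : ℝ) / N * (w + v))⁻¹ := by
            gcongr
        _ = (u⁻¹ * (w + v)⁻¹) * (N ^ 2 / (k + 1 : ℕ)) := by field_simp
        _ ≤ L * (N ^ 2 / (k + 1 : ℕ)) := by gcongr
        _ = _ := by ring
    have hstep := memY_poisson (ρ₁ := ρ - ((k + 1 : ℕ) : ℝ) / N * r)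
      (σ₁ := σ - ((k + 1 : ℕ) : ℝ) / N * s) (L := L * N ^ 2 / (k + 1 : ℕ)) hM hP hΘ hS hβ hβ'
      (by linarith) (by linarith) (by linarith) (by linarith) (by linarith) (by linarith)
      (by
        have e1 : σ - k / N * s - (σ - ((k + 1 : ℕ) : ℝ) / N * s) = 1 / N * s := by linarith
        have e2 : ρ' - (ρ - ((k + 1 : ℕ) : ℝ) / N * r) = (ρ' - ρ) + ((k + 1 : ℕ) : ℝ) / N * r := by ring
        rw [e1, e2]
        exact hgen hs hr (by linarith) ((le_max_right _ _).trans hL))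
      (by
        have e1 : ρ - k / N * r - (ρ - ((k + 1 : ℕ) : ℝ) / N * r) = 1 / N * r := by linarith
        have e2 : σ' - (σ - ((k + 1 : ℕ) : ℝ) / N * s) = (σ' - σ) + ((k + 1 : ℕ) : ℝ) / N * s := by ring
        rw [e1, e2]
        exact hgen hr hs (by linarith) ((le_max_left _ _).trans hL))
      hO i1 hg
    obtain ⟨s1, s2, s3⟩ := hstep
    rw [iterBracket_succ]
    refine ⟨s1, s2.trans ?_, fun h1 h2 => s3 (i3 h1 h2) h2⟩
    calc _ ≤ ENNReal.ofReal (12 * P ^ 3 * Θ * (L * N ^ 2 / (k + 1 : ℕ))) *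
          (ENNReal.ofReal ((12 * P ^ 3 * Θ * L * N ^ 2) ^ k / k.factorial) *
          paramNorm m β ρ σ O h * paramNorm m β ρ' σ' O g ^ k) * paramNorm m β ρ' σ' O g := by
          gcongr
      _ = (ENNReal.ofReal (12 * P ^ 3 * Θ * (L * N ^ 2 / (k + 1 : ℕ))) *
          ENNReal.ofReal ((12 * P ^ 3 * Θ * L * N ^ 2) ^ k / k.factorial)) *
          paramNorm m β ρ σ O h * paramNorm m β ρ' σ' O g ^ (k + 1) := by ring
      _ = _ := by
          rw [← ENNReal.ofReal_mul (by positivity)]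
          congr 3
          rw [Nat.factorial_succ]
          push_cast
          field_simp
          ring

/-- The terms of the Lie series. -/
theorem memY_iterBracket (hM : MassBounds m β₁ P Θ S) (hP : 1 ≤ P) (hΘ : 0 ≤ Θ) (hS : 0 ≤ S)
    (hβ : 0 < β) (hβ' : β ≤ β₁) (hρ' : ρ ≤ ρ') (hσ' : σ ≤ σ') (hr : 0 < r) (hrρ : r < ρ)
    (hs : 0 < s) (hsσ : s < σ) (hL : lossConst r s ρ σ ρ' σ' ≤ L) (hO : IsOpen O)
    (hh : MemY m β ρ σ O h) (hg : MemY m β ρ' σ' O g) (n : ℕ) :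
    MemY m β (ρ - r) (σ - s) O (iterBracket m g h n) ∧
      ENNReal.ofReal (n.factorial : ℝ)⁻¹ *
        paramNorm m β (ρ - r) (σ - s) O (iterBracket m g h n) ≤
        (ENNReal.ofReal (12 * P ^ 3 * Θ * Real.exp 2 * L) * paramNorm m β ρ' σ' O g) ^ n *
          paramNorm m β ρ σ O h ∧
      (IsRealOnReal ρ σ O h → IsRealOnReal ρ' σ' O g →
        IsRealOnReal (ρ - r) (σ - s) O (iterBracket m g h n)) := by
  have hL0 : 0 ≤ L := by
    refine le_trans (le_max_of_le_left ?_) hL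
    have : 0 ≤ (σ' - σ + s)⁻¹ := inv_nonneg.2 (by linarith)
    positivity
  rcases n.eq_zero_or_pos with rfl | hn
  · refine ⟨hh.mono hM (by linarith) (by linarith) (by linarith), ?_, fun h1 _ x hx =>
      h1 x (domainQ_mono (by linarith) (by linarith) hx)⟩
    simpa using! paramNorm_mono hM (by linarith) (by linarith) (by linarith) h
  · obtain ⟨h1, h2, h3⟩ := memY_iterBracket_step hM hP hΘ hS hβ hβ' hρ' hσ' hr hrρ hs hsσ hL hO hh hg
      hn n le_rfl
    have hnn : (n : ℝ) / n = 1 := div_self (by positivity)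
    rw [hnn, one_mul, one_mul] at h1 h2 h3
    refine ⟨h1, (mul_le_mul_right h2 _).trans ?_, h3⟩
    -- One factorial comes from the growing distance to the domain of `g`, the other from the Lie
    -- series. Both are used against `(n²)^n`, whence the factor `Real.exp 2`.
    have hexp : (n : ℝ) ^ n / n.factorial ≤ Real.exp n := Real.pow_div_factorial_le_exp n (by positivity) n
    have hreal : (n.factorial : ℝ)⁻¹ * ((12 * P ^ 3 * Θ * L * n ^ 2) ^ n / n.factorial) ≤
        (12 * P ^ 3 * Θ * Real.exp 2 * L) ^ n := by
      calc (n.factorial : ℝ)⁻¹ * ((12 * P ^ 3 * Θ * L * n ^ 2) ^ n / n.factorial)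
          = (12 * P ^ 3 * Θ * L) ^ n * ((n : ℝ) ^ n / n.factorial) ^ 2 := by
            rw [mul_pow _ ((n : ℝ) ^ 2), ← pow_mul, mul_comm 2 n, pow_mul]
            field_simp
        _ ≤ (12 * P ^ 3 * Θ * L) ^ n * Real.exp n ^ 2 := by gcongr
        _ = _ := by
            rw [← Real.exp_nat_mul, mul_comm ((2 : ℕ) : ℝ), Real.exp_nat_mul]
            push_cast
            rw [← mul_pow]
            ring
    calc _ = ENNReal.ofReal ((n.factorial : ℝ)⁻¹ * ((12 * P ^ 3 * Θ * L * n ^ 2) ^ n / n.factorial)) *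
          paramNorm m β ρ' σ' O g ^ n * paramNorm m β ρ σ O h := by
          rw [ENNReal.ofReal_mul (by positivity)]; ring
      _ ≤ ENNReal.ofReal ((12 * P ^ 3 * Θ * Real.exp 2 * L) ^ n) *
          paramNorm m β ρ' σ' O g ^ n * paramNorm m β ρ σ O h := by gcongr
      _ = _ := by rw [ENNReal.ofReal_pow (by positivity), mul_pow]

/-- Differentiation along a Hamiltonian curve is the bracket. -/
theorem hasDerivWithinAt_comp_isHamCurve (hM : MassBounds m β₁ P Θ S) (hP : 1 ≤ P)
    (hβ : 0 < β) (hβ' : β ≤ β₁) (hρ : 0 ≤ ρ) (hh : MemY m β ρ σ O h) {ξ : EllInf} (hξ : ξ ∈ O)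
    {x : Phase} {γ : ℝ → Phase} (hγ : IsHamCurve m (fun y => g y ξ) (domainQ ρ σ) x γ) {t : ℝ}
    (ht : t ∈ Icc (0 : ℝ) 1) :
    HasDerivWithinAt (fun t => h (γ t) ξ) (poisson m h g (γ t) ξ) (Icc (0 : ℝ) 1) t := by
  obtain ⟨hD, v, hv, hd⟩ := hγ.2 t ht
  obtain ⟨c, hc, hfin⟩ := exists_coeff (hh.funNorm_ne_top hξ)
  have hsum := summable_coeff hM hβ hβ' hP hρ hfin
  obtain ⟨T, hT, -⟩ := hasFDerivAt_of_isTaylorFourier hsum hc hD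
  have h1 := hasSum_partial_mul hsum hc hD v
  rw [hT.fderiv] at h1
  -- The chain rule yields the differential at `v`, and `hasSum_partial_mul` expands it in
  -- coordinates; inserting Hamilton's equations gives the bracket.
  have h2 : poisson m h g (γ t) ξ = T v := by
    rw [← h1.tsum_eq, poisson]
    refine tsum_congr fun j => ?_
    rw [bracketTerm, (hv j).1, (hv j).2]
    ring
  rw [h2]
  exact (hT.restrictScalars ℝ).comp_hasDerivWithinAt t hd

end Lie

end LieIteration

/-! ### The Lie series along the flow -/

section LieSeries
open Set
variable {m : ℕ → ℝ} {β₁ P Θ S β ρ σ ρ' σ' r s L q : ℝ} {O : Set EllInf} {g h : Phase → EllInf → ℂ}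

theorem norm_iterBracket_le (hM : MassBounds m β₁ P Θ S) (hP : 1 ≤ P) (hΘ : 0 ≤ Θ) (hS : 0 ≤ S)
    (hβ : 0 < β) (hβ' : β ≤ β₁) (hρ' : ρ ≤ ρ') (hσ' : σ ≤ σ') (hr : 0 < r) (hrρ : r < ρ)
    (hs : 0 < s) (hsσ : s < σ) (hL : lossConst r s ρ σ ρ' σ' ≤ L) (hO : IsOpen O)
    (hh : MemY m β ρ σ O h) (hg : MemY m β ρ' σ' O g) (hq0 : 0 ≤ q)
    (hq : ENNReal.ofReal (12 * P ^ 3 * Θ * Real.exp 2 * L) * paramNorm m β ρ' σ' O g ≤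
      ENNReal.ofReal q) {x : Phase} (hx : x ∈ domainQ (ρ - r) (σ - s)) {ξ : EllInf} (hξ : ξ ∈ O)
    (n : ℕ) :
    ‖iterBracket m g h n x ξ‖ ≤ P * S * q ^ n * n.factorial * (paramNorm m β ρ σ O h).toReal := by
  obtain ⟨h1, h2, -⟩ := memY_iterBracket hM hP hΘ hS hβ hβ' hρ' hσ' hr hrρ hs hsσ hL hO hh hg n
  refine norm_le_of_enorm_le (by positivity) hh.2.2.2.ne ?_
  have hf : (0 : ℝ) < n.factorial := by positivity
  have hcancel : ∀ X : ℝ≥0∞,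
      X = ENNReal.ofReal n.factorial * (ENNReal.ofReal (n.factorial : ℝ)⁻¹ * X) := by
    intro X
    rw [← mul_assoc, ← ENNReal.ofReal_mul hf.le, mul_inv_cancel₀ hf.ne', ENNReal.ofReal_one, one_mul]
  calc ‖iterBracket m g h n x ξ‖ₑ
      ≤ ENNReal.ofReal (P * S) * paramNorm m β (ρ - r) (σ - s) O (iterBracket m g h n) :=
        (enorm_le_funNorm hM hβ hβ' hP (by linarith) (h1.funNorm_ne_top hξ) hx).trans
          (mul_le_mul_right (funNorm_le_paramNorm _ hξ) _)
    _ = ENNReal.ofReal (P * S) * (ENNReal.ofReal n.factorial * (ENNReal.ofReal (n.factorial : ℝ)⁻¹ *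
          paramNorm m β (ρ - r) (σ - s) O (iterBracket m g h n))) := by rw [← hcancel]
    _ ≤ ENNReal.ofReal (P * S) * (ENNReal.ofReal n.factorial *
          (ENNReal.ofReal q ^ n * paramNorm m β ρ σ O h)) := by
        refine mul_le_mul_right (mul_le_mul_right ?_ _) _
        exact h2.trans (mul_le_mul_left (pow_le_pow_left' hq n) _)
    _ = _ := by
        rw [← ENNReal.ofReal_pow hq0, ENNReal.ofReal_mul (p := P * S * q ^ n) (by positivity),
          ENNReal.ofReal_mul (p := P * S) (by positivity)]
        ring

/-- The iterated brackets have to be bounded along the whole curve, which fills the domain with half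
the loss; the price is this factor `4`. -/
theorem lossConst_half (hr : 0 < r) (hs : 0 < s) (hρ : ρ ≤ ρ') (hσ : σ ≤ σ') :
    lossConst (r / 2) (s / 2) ρ σ ρ' σ' ≤ 4 * lossConst r s ρ σ ρ' σ' := by
  have hgen : ∀ {u v w : ℝ}, 0 < u → 0 < v → 0 ≤ w → (u / 2)⁻¹ * (w + v / 2)⁻¹ ≤
      4 * (u⁻¹ * (w + v)⁻¹) := by
    intro u v w hu hv hw
    calc (u / 2)⁻¹ * (w + v / 2)⁻¹ ≤ (u / 2)⁻¹ * ((w + v) / 2)⁻¹ := by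
          gcongr
          linarith
      _ = _ := by field_simp; norm_num
  refine max_le ((hgen hr hs (sub_nonneg.2 hσ)).trans ?_) ((hgen hs hr (sub_nonneg.2 hρ)).trans ?_)
  · gcongr
    exact le_max_left _ _
  · gcongr
    exact le_max_right _ _

theorem lossConst_pos (hr : 0 < r) (hs : 0 < s) (hσ : σ ≤ σ') : 0 < lossConst r s ρ σ ρ' σ' := by
  refine lt_max_of_lt_left ?_
  have : 0 < σ' - σ + s := by linarith
  positivity

theorem norm_taylorTerm_le {B t : ℝ} (ht : t ∈ Icc (0 : ℝ) 1) {z : ℂ} {n : ℕ}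
    (hz : ‖z‖ ≤ B * n.factorial) : ‖((t ^ n / n.factorial : ℝ) : ℂ) * z‖ ≤ B := by
  have hf : (0 : ℝ) < n.factorial := by positivity
  have ht1 : t ^ n ≤ 1 := pow_le_one₀ ht.1 ht.2
  have ht0 : 0 ≤ t ^ n := pow_nonneg ht.1 n
  rw [norm_mul, Complex.norm_real, Real.norm_of_nonneg (by positivity)]
  calc t ^ n / n.factorial * ‖z‖ ≤ 1 / n.factorial * (B * n.factorial) := by gcongr
    _ = B := by field_simp

/-- Composition with the flow is given by the Lie series. -/
theorem hasSum_lieSeries (hM : MassBounds m β₁ P Θ S) (hP : 1 ≤ P) (hΘ : 0 ≤ Θ) (hS : 0 ≤ S)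
    (hβ : 0 < β) (hβ' : β ≤ β₁) (hρ' : ρ ≤ ρ') (hσ' : σ ≤ σ') (hr : 0 < r) (hrρ : r < ρ)
    (hs : 0 < s) (hsσ : s < σ) (hL : lossConst r s ρ σ ρ' σ' ≤ L) (hO : IsOpen O)
    (hh : MemY m β ρ σ O h) (hg : MemY m β ρ' σ' O g) (hq0 : 0 ≤ q) (hq1 : q < 1)
    (hq : ENNReal.ofReal (12 * P ^ 3 * Θ * Real.exp 2 * L) * paramNorm m β ρ' σ' O g ≤
      ENNReal.ofReal q) {ξ : EllInf} (hξ : ξ ∈ O) {x : Phase} {γ : ℝ → Phase}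
    (hγ : IsHamCurve m (fun y => g y ξ) (domainQ (ρ - r) (σ - s)) x γ)
    {t : ℝ} (ht : t ∈ Icc (0 : ℝ) 1) :
    HasSum (fun n : ℕ => ((t ^ n / n.factorial : ℝ) : ℂ) * iterBracket m g h n x ξ) (h (γ t) ξ) := by
  set H := (paramNorm m β ρ σ O h).toReal
  have hH : 0 ≤ H := ENNReal.toReal_nonneg
  have hbound : ∀ n, ∀ τ ∈ Icc (0 : ℝ) 1, ‖iterBracket m g h n (γ τ) ξ‖ ≤
      P * S * H * q ^ n * n.factorial := fun n τ hτ =>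
    (norm_iterBracket_le hM hP hΘ hS hβ hβ' hρ' hσ' hr hrρ hs hsσ hL hO hh hg hq0 hq (hγ.2 τ hτ).1
      hξ n).trans_eq (by ring)
  have hder : ∀ n, ∀ τ ∈ Icc (0 : ℝ) 1, HasDerivWithinAt (fun τ => iterBracket m g h n (γ τ) ξ)
      (iterBracket m g h (n + 1) (γ τ) ξ) (Icc (0 : ℝ) 1) τ := by
    intro n τ hτ
    rw [iterBracket_succ]
    exact hasDerivWithinAt_comp_isHamCurve hM hP hβ hβ' (by linarith)
      (memY_iterBracket hM hP hΘ hS hβ hβ' hρ' hσ' hr hrρ hs hsσ hL hO hh hg n).1 hξ hγ hτ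
  have h0 : (0 : ℝ) ∈ Icc (0 : ℝ) 1 := ⟨le_rfl, zero_le_one⟩
  have hgeom : Summable fun n : ℕ => P * S * H * q ^ n :=
    (summable_geometric_of_lt_one hq0 hq1).mul_left _
  have hsum : Summable fun n : ℕ =>
      ((t ^ n / n.factorial : ℝ) : ℂ) * iterBracket m g h n x ξ := by
    refine hgeom.of_norm_bounded fun n => norm_taylorTerm_le ht ?_
    have := hbound n 0 h0
    rwa [hγ.1] at this
  refine (hsum.hasSum_iff_tendsto_nat).2 ?_
  rw [tendsto_iff_norm_sub_tendsto_zero]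
  -- The `N`-th bracket along the curve is `O(q^N N!)`, so the Taylor remainder is `O(q^N)`.
  refine squeeze_zero (fun _ => norm_nonneg _) (fun N => ?_) hgeom.tendsto_atTop_zero
  rw [norm_sub_rev]
  have h1 := norm_sub_taylor_le N (fun n τ => iterBracket m g h n (γ τ) ξ) hder (hbound N) t ht
  simp only [hγ.1] at h1
  refine h1.trans ?_
  have hf : (0 : ℝ) < N.factorial := by positivity
  have ht1 : t ^ N ≤ 1 := pow_le_one₀ ht.1 ht.2
  calc P * S * H * q ^ N * N.factorial * (t ^ N / N.factorial) = P * S * H * q ^ N * t ^ N := by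
        field_simp
    _ ≤ _ := mul_le_of_le_one_right (by positivity) ht1

theorem tsum_pow_le {a : ℝ≥0∞} (ha : 8 * a ≤ 1 / 2) : ∑' n : ℕ, a ^ n ≤ 1 + 2 * (8 * a) := by
  have hfin : a ≠ ⊤ := by
    rintro rfl
    rw [ENNReal.mul_top (by norm_num)] at ha
    exact absurd (top_le_iff.1 ha) (by simp)
  have h1 : 8 * a.toReal ≤ 1 / 2 := by
    have h2 := ENNReal.toReal_mono (by simp) ha
    rw [ENNReal.toReal_mul] at h2
    simpa using h2
  have h0 : 0 ≤ a.toReal := ENNReal.toReal_nonneg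
  rw [← ENNReal.ofReal_toReal hfin]
  simp_rw [← ENNReal.ofReal_pow h0]
  rw [← ENNReal.ofReal_tsum_of_nonneg (fun n => pow_nonneg h0 n)
    (summable_geometric_of_lt_one h0 (by linarith)), tsum_geometric_of_lt_one h0 (by linarith)]
  have e : (1 : ℝ≥0∞) + 2 * (8 * ENNReal.ofReal a.toReal) =
      ENNReal.ofReal (1 + 2 * (8 * a.toReal)) := by
    rw [ENNReal.ofReal_add zero_le_one (by positivity), ENNReal.ofReal_mul (by norm_num),
      ENNReal.ofReal_mul (by norm_num)]
    norm_num
  rw [e]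
  refine ENNReal.ofReal_le_ofReal ?_
  rw [inv_le_iff_one_le_mul₀ (by linarith)]
  nlinarith

end LieSeries

/-! ### Composition with the flow, and bilinearity of the bracket -/

section Flow
open Set
variable {m : ℕ → ℝ} {β₁ P Θ S β ρ σ ρ' σ' r s : ℝ} {O : Set EllInf} {g h : Phase → EllInf → ℂ}

/-- Composition with the flow of a small Hamiltonian. -/
theorem memY_comp_flow (hM : MassBounds m β₁ P Θ S) (hP : 1 ≤ P) (hΘ : 0 ≤ Θ) (hS : 0 ≤ S)
    (hβ : 0 < β) (hβ' : β ≤ β₁) (hρ' : ρ ≤ ρ') (hσ' : σ ≤ σ') (hr : 0 < r) (hrρ : r < ρ)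
    (hs : 0 < s) (hsσ : s < σ) (hO : IsOpen O) (hh : MemY m β ρ σ O h) (hg : MemY m β ρ' σ' O g)
    (hsmall : 8 * (ENNReal.ofReal (12 * P ^ 3 * Θ * Real.exp 2 * lossConst r s ρ σ ρ' σ') *
      paramNorm m β ρ' σ' O g) ≤ 1 / 2) {Φ : Phase → EllInf → ℝ → Phase}
    (hΦ : ∀ x ∈ domainQ (ρ - r) (σ - s), ∀ ξ ∈ O,
      IsHamCurve m (fun y => g y ξ) (domainQ (ρ - r / 2) (σ - s / 2)) x (Φ x ξ))
    {t : ℝ} (ht : t ∈ Icc (0 : ℝ) 1) :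
    MemY m β (ρ - r) (σ - s) O (fun x ξ => h (Φ x ξ t) ξ) ∧
    paramNorm m β (ρ - r) (σ - s) O (fun x ξ => h (Φ x ξ t) ξ) ≤
      (1 + 2 * (8 * (ENNReal.ofReal (12 * P ^ 3 * Θ * Real.exp 2 * lossConst r s ρ σ ρ' σ') *
      paramNorm m β ρ' σ' O g))) * paramNorm m β ρ σ O h ∧
    (IsRealOnReal ρ σ O h → IsRealOnReal ρ' σ' O g →
      IsRealOnReal (ρ - r) (σ - s) O (fun x ξ => h (Φ x ξ t) ξ)) := by
  set L := lossConst r s ρ σ ρ' σ' with hLdef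
  set a := ENNReal.ofReal (12 * P ^ 3 * Θ * Real.exp 2 * L) * paramNorm m β ρ' σ' O g with ha
  have hL0 : 0 < L := lossConst_pos hr hs hσ'
  -- Convergence along the curve uses half the loss, hence `4 * L`, with quotient `1 / 2`. The norm
  -- estimate below uses the full loss, with quotient `a`.
  have hq : ENNReal.ofReal (12 * P ^ 3 * Θ * Real.exp 2 * (4 * L)) * paramNorm m β ρ' σ' O g ≤
      ENNReal.ofReal (1 / 2) := by
    have e1 : 12 * P ^ 3 * Θ * Real.exp 2 * (4 * L) = 4 * (12 * P ^ 3 * Θ * Real.exp 2 * L) := by ring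
    have e2 : ENNReal.ofReal (1 / 2) = 1 / 2 := by
      rw [ENNReal.ofReal_div_of_pos (by norm_num)]; simp
    rw [e1, ENNReal.ofReal_mul (by norm_num), mul_assoc, ← ha, e2]
    refine le_trans ?_ hsmall
    gcongr
    norm_num
  have hlie : ∀ x ∈ domainQ (ρ - r) (σ - s), ∀ ξ ∈ O, HasSum
      (fun n : ℕ => ((t ^ n / n.factorial : ℝ) : ℂ) * iterBracket m g h n x ξ) (h (Φ x ξ t) ξ) :=
    fun x hx ξ hξ => hasSum_lieSeries hM hP hΘ hS hβ hβ' hρ' hσ' (half_pos hr) (by linarith)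
      (half_pos hs) (by linarith) (lossConst_half hr hs hρ' hσ') hO hh hg (by norm_num)
      (by norm_num) hq hξ (hΦ x hx ξ hξ) ht
  have hiter := memY_iterBracket hM hP hΘ hS hβ hβ' hρ' hσ' hr hrρ hs hsσ hLdef.ge hO hh hg
  set H := (paramNorm m β ρ σ O h).toReal
  have hH : 0 ≤ H := ENNReal.toReal_nonneg
  have hd : DifferentiableOn ℂ (fun y : Phase × EllInf => h (Φ y.1 y.2 t) y.2)
      (domainQ (ρ - r) (σ - s) ×ˢ O) := by
    refine (differentiableOn_tsum_of_norm_le (u := fun n : ℕ => P * S * H * (1 / 2 : ℝ) ^ n)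
      (f := fun (n : ℕ) (y : Phase × EllInf) =>
        ((t ^ n / n.factorial : ℝ) : ℂ) * iterBracket m g h n y.1 y.2)
      ((isOpen_domainQ _ _).prod hO) (summable_geometric_two.mul_left _)
      (fun n => ((hiter n).1.2.1).const_mul _) ?_).congr ?_
    · rintro n ⟨x, ξ⟩ ⟨hx, hξ⟩
      refine norm_taylorTerm_le ht ?_
      exact (norm_iterBracket_le hM hP hΘ hS hβ hβ' hρ' hσ' (half_pos hr) (by linarith)
        (half_pos hs) (by linarith) (lossConst_half hr hs hρ' hσ') hO hh hg (by norm_num) hq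
        (domainQ_mono (by linarith) (by linarith) hx) hξ n).trans_eq (by ring)
    · rintro ⟨x, ξ⟩ ⟨hx, hξ⟩
      exact (hlie x hx ξ hξ).tsum_eq.symm
  have hgeom : ∑' n : ℕ, a ^ n * paramNorm m β ρ σ O h ≤
      (1 + 2 * (8 * a)) * paramNorm m β ρ σ O h := by
    rw [ENNReal.tsum_mul_right]
    gcongr
    exact tsum_pow_le hsmall
  have hfin : (1 + 2 * (8 * a)) * paramNorm m β ρ σ O h < ⊤ := by
    refine ENNReal.mul_lt_top (ENNReal.add_lt_top.2 ⟨ENNReal.one_lt_top, ENNReal.mul_lt_top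
      (by norm_num) (hsmall.trans_lt (by simp))⟩) hh.2.2.2
  have hn : paramNorm m β (ρ - r) (σ - s) O (fun x ξ => h (Φ x ξ t) ξ) ≤
      (1 + 2 * (8 * a)) * paramNorm m β ρ σ O h := by
    refine iSup₂_le fun ξ hξ => ?_
    have hterm : ∀ n : ℕ, funNorm m β (ρ - r) (σ - s) (fun x =>
        ((t ^ n / n.factorial : ℝ) : ℂ) * iterBracket m g h n x ξ) ≤
        a ^ n * paramNorm m β ρ σ O h := by
      intro n
      refine (funNorm_const_mul_le hM hβ hβ' hP (by linarith) _
        ((hiter n).1.funNorm_ne_top hξ)).trans (le_trans ?_ (hiter n).2.1)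
      refine mul_le_mul' ?_ (funNorm_le_paramNorm _ hξ)
      have ht1 : t ^ n ≤ 1 := pow_le_one₀ ht.1 ht.2
      have ht0 : 0 ≤ t ^ n := pow_nonneg ht.1 n
      rw [← ofReal_norm, Complex.norm_real, Real.norm_of_nonneg (by positivity), inv_eq_one_div]
      gcongr
    have hle := (ENNReal.tsum_le_tsum hterm).trans hgeom
    exact (funNorm_le_tsum hM hβ hβ' hP (by linarith) (hle.trans_lt hfin).ne
      fun x hx => hlie x hx ξ hξ).trans hle
  refine ⟨memY_of_differentiableOn hM hβ hβ' hP hS (by linarith) hd (hn.trans_lt hfin), hn,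
    fun rh rg x hx ξ hξ h1 h2 h3 => ?_⟩
  have him := Complex.hasSum_im (hlie x hx ξ hξ)
  refine him.unique ?_
  convert hasSum_zero using 2 with n
  rw [Complex.im_ofReal_mul, (hiter n).2.2 rh rg x hx ξ hξ h1 h2 h3, mul_zero]

theorem poisson_add_left (a : ℂ) (h₁ h₂ g : Phase → EllInf → ℂ) {x : Phase} {ξ : EllInf}
    (hd₁ : DifferentiableAt ℂ (fun y => h₁ y ξ) x) (hd₂ : DifferentiableAt ℂ (fun y => h₂ y ξ) x)
    (hs₁ : Summable (bracketTerm m (fun y => h₁ y ξ) (fun y => g y ξ) x))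
    (hs₂ : Summable (bracketTerm m (fun y => h₂ y ξ) (fun y => g y ξ) x)) :
    poisson m (fun y η => a * h₁ y η + h₂ y η) g x ξ =
      a * poisson m h₁ g x ξ + poisson m h₂ g x ξ := by
  unfold poisson
  rw [← tsum_mul_left, ← (hs₁.mul_left a).tsum_add hs₂]
  have hf : fderiv ℂ (fun y => a * h₁ y ξ + h₂ y ξ) x =
      a • fderiv ℂ (fun y => h₁ y ξ) x + fderiv ℂ (fun y => h₂ y ξ) x :=
    ((hd₁.hasFDerivAt.const_mul a).add hd₂.hasFDerivAt).fderiv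
  refine tsum_congr fun j => ?_
  simp only [bracketTerm, dAngle, dAction, hf, add_apply,
    smul_apply, smul_eq_mul]
  ring

/-- Antisymmetry carries linearity from the first slot to the second. -/
theorem poisson_swap (h g : Phase → EllInf → ℂ) (x : Phase) (ξ : EllInf) :
    poisson m h g x ξ = -poisson m g h x ξ := by
  unfold poisson
  rw [← tsum_neg]
  refine tsum_congr fun j => ?_
  simp only [bracketTerm]
  ring

theorem summable_bracketTerm_swap {f g : Phase → ℂ} {x : Phase}
    (hs : Summable (bracketTerm m f g x)) : Summable (bracketTerm m g f x) := by
  refine hs.neg.congr fun j => ?_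
  simp only [bracketTerm]
  ring

theorem poisson_add_right (a : ℂ) (h g₁ g₂ : Phase → EllInf → ℂ) {x : Phase} {ξ : EllInf}
    (hd₁ : DifferentiableAt ℂ (fun y => g₁ y ξ) x) (hd₂ : DifferentiableAt ℂ (fun y => g₂ y ξ) x)
    (hs₁ : Summable (bracketTerm m (fun y => h y ξ) (fun y => g₁ y ξ) x))
    (hs₂ : Summable (bracketTerm m (fun y => h y ξ) (fun y => g₂ y ξ) x)) :
    poisson m h (fun y η => a * g₁ y η + g₂ y η) x ξ =
      a * poisson m h g₁ x ξ + poisson m h g₂ x ξ := by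
  rw [poisson_swap, poisson_add_left a g₁ g₂ h hd₁ hd₂ (summable_bracketTerm_swap hs₁)
    (summable_bracketTerm_swap hs₂), poisson_swap h g₁, poisson_swap h g₂]
  ring

theorem MemY.summable_bracketTerm (hM : MassBounds m β₁ P Θ S) (hP : 1 ≤ P) (hβ : 0 < β)
    (hβ' : β ≤ β₁) {ρ₁ σ₁ : ℝ} (hρ₁ : 0 ≤ ρ₁) (hσ₁ : 0 ≤ σ₁) (hρ : ρ₁ < ρ) (hσ : σ₁ < σ)
    (hρ' : ρ ≤ ρ') (hσ' : σ ≤ σ') (hh : MemY m β ρ σ O h) (hg : MemY m β ρ' σ' O g) {x : Phase}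
    (hx : x ∈ domainQ ρ₁ σ₁) {ξ : EllInf} (hξ : ξ ∈ O) :
    Summable (bracketTerm m (fun y => h y ξ) (fun y => g y ξ) x) := by
  obtain ⟨c, hc, hcf⟩ := exists_coeff (hh.funNorm_ne_top hξ)
  obtain ⟨d, hd, hdf⟩ := exists_coeff (hg.funNorm_ne_top hξ)
  exact (hasSum_bracket hM hP hβ hβ' hρ₁ hσ₁ hρ hσ hρ' hσ' hc hd hcf hdf hx).1

end Flow

end LongRange

end

/-! ### Choice of the constant and conclusion -/

theorem mainTheorem8 (κ : ℝ) (hκ : 0 < κ) (m : ℕ → ℝ) (hm : LongRange.IsMassSequence κ m)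
    (β₁ : ℝ) (hβ₁ : 0 < β₁) (hβ₁' : β₁ < 1) :
    ∃ K : ℝ, 0 < K ∧
      ∀ β ρ σ ρ' σ' r s : ℝ, 0 < β → β ≤ β₁ → 0 < ρ → ρ ≤ ρ' → 0 < σ → σ ≤ σ' →
        0 < r → r < ρ → 0 < s → s < σ →
      ∀ O : Set LongRange.EllInf, IsOpen O →
        -- the Poisson bracket is well defined and bilinear
        (∀ h g : LongRange.Phase → LongRange.EllInf → ℂ,
          LongRange.MemY m β ρ σ O h → LongRange.MemY m β ρ' σ' O g →
          ∀ x ∈ LongRange.domainQ (ρ - r) (σ - s), ∀ ξ ∈ O,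
            Summable (LongRange.bracketTerm m (fun y => h y ξ) (fun y => g y ξ) x)) ∧
        (∀ (a : ℂ) (h₁ h₂ g : LongRange.Phase → LongRange.EllInf → ℂ),
          LongRange.MemY m β ρ σ O h₁ → LongRange.MemY m β ρ σ O h₂ →
          LongRange.MemY m β ρ' σ' O g →
          ∀ x ∈ LongRange.domainQ (ρ - r) (σ - s), ∀ ξ ∈ O,
            LongRange.poisson m (fun y η => a * h₁ y η + h₂ y η) g x ξ =
              a * LongRange.poisson m h₁ g x ξ + LongRange.poisson m h₂ g x ξ) ∧
        (∀ (a : ℂ) (h g₁ g₂ : LongRange.Phase → LongRange.EllInf → ℂ),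
          LongRange.MemY m β ρ σ O h → LongRange.MemY m β ρ' σ' O g₁ →
          LongRange.MemY m β ρ' σ' O g₂ →
          ∀ x ∈ LongRange.domainQ (ρ - r) (σ - s), ∀ ξ ∈ O,
            LongRange.poisson m h (fun y η => a * g₁ y η + g₂ y η) x ξ =
              a * LongRange.poisson m h g₁ x ξ + LongRange.poisson m h g₂ x ξ) ∧
        -- it maps into the smaller space, with the stated bound
        (∀ h g : LongRange.Phase → LongRange.EllInf → ℂ,
          LongRange.MemY m β ρ σ O h → LongRange.MemY m β ρ' σ' O g →
          LongRange.MemY m β (ρ - r) (σ - s) O (LongRange.poisson m h g) ∧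
          LongRange.paramNorm m β (ρ - r) (σ - s) O (LongRange.poisson m h g) ≤
            ENNReal.ofReal (K * LongRange.lossConst r s ρ σ ρ' σ') *
              LongRange.paramNorm m β ρ σ O h * LongRange.paramNorm m β ρ' σ' O g ∧
          (LongRange.IsRealOnReal ρ σ O h → LongRange.IsRealOnReal ρ' σ' O g →
            LongRange.IsRealOnReal (ρ - r) (σ - s) O (LongRange.poisson m h g))) ∧
        -- the flow of a small `g` is defined up to time one, and composition with it is bounded
        (∀ g : LongRange.Phase → LongRange.EllInf → ℂ, LongRange.MemY m β ρ' σ' O g →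
          ENNReal.ofReal (K * LongRange.lossConst r s ρ σ ρ' σ') *
            LongRange.paramNorm m β ρ' σ' O g ≤ 1 / 2 →
          ∃ Φ : ℝ → LongRange.Phase → LongRange.EllInf → LongRange.Phase,
            (∀ x ∈ LongRange.domainQ (ρ - r) (σ - s), ∀ ξ ∈ O,
              LongRange.IsHamCurve m (fun y => g y ξ) (LongRange.domainQ ρ σ) x
                (fun t => Φ t x ξ) ∧
              ∀ γ : ℝ → LongRange.Phase,
                LongRange.IsHamCurve m (fun y => g y ξ) (LongRange.domainQ ρ' σ') x γ →
                Set.EqOn γ (fun t => Φ t x ξ) (Set.Icc (0 : ℝ) 1)) ∧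
            ∀ h : LongRange.Phase → LongRange.EllInf → ℂ, LongRange.MemY m β ρ σ O h →
              ∀ t ∈ Set.Icc (0 : ℝ) 1,
                LongRange.MemY m β (ρ - r) (σ - s) O (fun x ξ => h (Φ t x ξ) ξ) ∧
                LongRange.paramNorm m β (ρ - r) (σ - s) O (fun x ξ => h (Φ t x ξ) ξ) ≤
                  (1 + 2 * (ENNReal.ofReal (K * LongRange.lossConst r s ρ σ ρ' σ') *
                    LongRange.paramNorm m β ρ' σ' O g)) * LongRange.paramNorm m β ρ σ O h ∧
                (LongRange.IsRealOnReal ρ σ O h → LongRange.IsRealOnReal ρ' σ' O g →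
                  LongRange.IsRealOnReal (ρ - r) (σ - s) O (fun x ξ => h (Φ t x ξ) ξ))) := by
  obtain ⟨P, Θ, S, hP, hΘ1, hS1, hM⟩ := LongRange.exists_massBounds hκ hm hβ₁'
  have hΘ : 0 ≤ Θ := zero_le_one.trans hΘ1
  have hS : 0 ≤ S := zero_le_one.trans hS1
  have hP0 : 0 < P := zero_lt_one.trans_le hP
  have hΘ0 : 0 < Θ := zero_lt_one.trans_le hΘ1
  have hexp : 1 ≤ Real.exp 2 := Real.one_le_exp (by norm_num)
  -- Here `12 * P ^ 3 * Θ` is the bracket constant and `Real.exp 2` comes from the iteration. The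
  -- `8` covers the factor `4` of the halved loss, with room to spare.
  refine ⟨8 * (12 * P ^ 3 * Θ * Real.exp 2), by positivity, ?_⟩
  intro β ρ σ ρ' σ' r s hβ hβ' hρ hρ' hσ hσ' hr hrρ hs hsσ O hO
  set L := LongRange.lossConst r s ρ σ ρ' σ' with hLdef
  have hL0 : 0 < L := LongRange.lossConst_pos hr hs hσ'
  have hsub : LongRange.domainQ (ρ - r) (σ - s) ⊆ LongRange.domainQ ρ σ :=
    LongRange.domainQ_mono (by linarith) (by linarith)
  have hsub' : LongRange.domainQ ρ σ ⊆ LongRange.domainQ ρ' σ' := LongRange.domainQ_mono hρ' hσ'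
  have hsum : ∀ h g : LongRange.Phase → LongRange.EllInf → ℂ,
      LongRange.MemY m β ρ σ O h → LongRange.MemY m β ρ' σ' O g →
      ∀ x ∈ LongRange.domainQ (ρ - r) (σ - s), ∀ ξ ∈ O,
        Summable (LongRange.bracketTerm m (fun y => h y ξ) (fun y => g y ξ) x) :=
    fun h g hh hg x hx ξ hξ => hh.summable_bracketTerm hM hP hβ hβ' (by linarith) (by linarith)
      (by linarith) (by linarith) hρ' hσ' hg hx hξ
  refine ⟨hsum, ?_, ?_, ?_, ?_⟩
  · intro a h₁ h₂ g hh₁ hh₂ hg x hx ξ hξ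
    exact LongRange.poisson_add_left a h₁ h₂ g (hh₁.differentiableAt_slice hO (hsub hx) hξ)
      (hh₂.differentiableAt_slice hO (hsub hx) hξ) (hsum h₁ g hh₁ hg x hx ξ hξ)
      (hsum h₂ g hh₂ hg x hx ξ hξ)
  · intro a h g₁ g₂ hh hg₁ hg₂ x hx ξ hξ
    exact LongRange.poisson_add_right a h g₁ g₂
      (hg₁.differentiableAt_slice hO (hsub' (hsub hx)) hξ)
      (hg₂.differentiableAt_slice hO (hsub' (hsub hx)) hξ) (hsum h g₁ hh hg₁ x hx ξ hξ)
      (hsum h g₂ hh hg₂ x hx ξ hξ)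
  · intro h g hh hg
    obtain ⟨h1, h2, h3⟩ := LongRange.memY_poisson (ρ₁ := ρ - r) (σ₁ := σ - s) (L := L)
      hM hP hΘ hS hβ hβ' (by linarith) (by linarith) (by linarith) (by linarith) hρ' hσ'
      (by
        rw [sub_sub_cancel, sub_sub_eq_add_sub, add_sub_right_comm]
        exact le_max_right _ _)
      (by
        rw [sub_sub_cancel, sub_sub_eq_add_sub, add_sub_right_comm]
        exact le_max_left _ _) hO hh hg
    have h4 : 12 * P ^ 3 * Θ ≤ 8 * (12 * P ^ 3 * Θ * Real.exp 2) := by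
      have h5 : 0 ≤ 12 * P ^ 3 * Θ := by positivity
      have h6 := le_mul_of_one_le_right h5 hexp
      linarith
    exact ⟨h1, h2.trans (by gcongr), h3⟩
  · intro g hg hsmall
    have hK : ENNReal.ofReal (8 * (12 * P ^ 3 * Θ * Real.exp 2) * L) *
        LongRange.paramNorm m β ρ' σ' O g =
        8 * (ENNReal.ofReal (12 * P ^ 3 * Θ * Real.exp 2 * L) *
          LongRange.paramNorm m β ρ' σ' O g) := by
      rw [mul_assoc 8, ENNReal.ofReal_mul (by norm_num), mul_assoc]
      norm_num
    have hreal : 4 * (P * Θ) * L * (LongRange.paramNorm m β ρ' σ' O g).toReal ≤ 1 := by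
      have h1 := ENNReal.toReal_mono (by simp) hsmall
      rw [ENNReal.toReal_mul, ENNReal.toReal_ofReal (by positivity)] at h1
      have h5 : P ≤ P ^ 3 := le_self_pow₀ hP (by norm_num)
      refine le_trans ?_ (h1.trans (by norm_num))
      refine mul_le_mul_of_nonneg_right (mul_le_mul_of_nonneg_right ?_ hL0.le)
        ENNReal.toReal_nonneg
      calc 4 * (P * Θ) ≤ 96 * (P ^ 3 * Θ) * 1 := by
            have : P * Θ ≤ P ^ 3 * Θ := by gcongr
            have : 0 ≤ P * Θ := by positivity
            linarith
        _ ≤ 96 * (P ^ 3 * Θ) * Real.exp 2 := by gcongr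
        _ = _ := by ring
    -- The curves are chosen for all `x` and `ξ`, with an irrelevant constant curve off the domain.
    -- They lie in the domain with half the loss, as the Lie series requires.
    have hex : ∀ x ξ, ∃ γ : ℝ → LongRange.Phase, x ∈ LongRange.domainQ (ρ - r) (σ - s) → ξ ∈ O →
        LongRange.IsHamCurve m (fun y => g y ξ)
          (LongRange.domainQ (ρ - r / 2) (σ - s / 2)) x γ := by
      intro x ξ
      by_cases hx : x ∈ LongRange.domainQ (ρ - r) (σ - s) ∧ ξ ∈ O
      · obtain ⟨γ, hγ⟩ := hg.exists_isHamCurve hM hβ hβ' hP hΘ hO hρ' hσ' hr hrρ hs hx.2 hreal hx.1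
        exact ⟨γ, fun _ _ => hγ⟩
      · exact ⟨fun _ => x, fun h1 h2 => absurd ⟨h1, h2⟩ hx⟩
    choose Φ hΦ using hex
    refine ⟨fun t x ξ => Φ x ξ t, fun x hx ξ hξ => ?_, fun h hh t ht => ?_⟩
    · have hmono : ∀ {ρ₁ σ₁ : ℝ}, ρ ≤ ρ₁ → σ ≤ σ₁ →
          LongRange.IsHamCurve m (fun y => g y ξ) (LongRange.domainQ ρ₁ σ₁) x (Φ x ξ) :=
        fun h1 h2 => ⟨(hΦ x ξ hx hξ).1, fun t ht => ⟨LongRange.domainQ_mono (by linarith)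
          (by linarith) ((hΦ x ξ hx hξ).2 t ht).1, ((hΦ x ξ hx hξ).2 t ht).2⟩⟩
      exact ⟨hmono le_rfl le_rfl, fun γ hγ => hg.eqOn_of_isHamCurve hM hβ hβ' hP hΘ hO hξ hγ
        (hmono hρ' hσ')⟩
    · rw [hK] at hsmall ⊢
      exact LongRange.memY_comp_flow hM hP hΘ hS hβ hβ' hρ' hσ' hr hrρ hs hsσ hO hh hg hsmall
        (fun x hx ξ hξ => hΦ x ξ hx hξ) ht
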